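/- **Conventions.** Let $\Bbbk=\mathbb C(q)$ and $[k]_q=\frac{q^k-q^{-k}}{q-q^{-1}}$. A $\Bbbk$-algebra is *PBW* (resp. *sub-PBW*) on a totally ordered finite subset $X$ if the ordered monomials in $X$ form a basis of it (resp. span it). For a symmetrized Cartan matrix $C=(d_ia_{ij})$, $q_i=q^{d_i}$, let $U_q(C)$ be the quantized enveloping algebra with generators $E_i,F_i,K_i^{\pm1}$, let $U_q^+(C)$ be the algebra generated by the $E_i$ subject to the quantum Serre relations (the subalgebra of $U_q(C)$ generated by the $E_i$), and let $T_i$ be Lusztig's operators $T'_{i,-1}$ on $U_q(C)$, so that $T_i(E_j)=\sum_{r+s=-a_{ij}}(-1)^rq_i^{-r}E_i^{(r)}E_jE_i^{(s)}$ for $i\ne j$. The modified root vectors of a reduced word $\mathbf i=(i_1,\dots,i_m)$ of $w_\circ$ are $X_k=c_k^{-1}T_{i_1}\cdots T_{i_{k-1}}(E_{i_k})\in U_q^+(C)$, $c_k=\gamma(s_{i_1}\cdots s_{i_{k-1}}\alpha_{i_k}-\alpha_{i_k})$, where $\gamma$ is the homomorphism from the root lattice to $\Bbbk^\times$ with $\gamma(\alpha_i)=q_i-q_i^{-1}$.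 Let $n\ge3$, $\mathfrak g=\mathfrak{sl}_3^{\times n}$, and let $\sigma$ be a cyclic permutation of the $n$ factors. Put $B=U_q^+(\mathfrak{sl}_3^{\times n})$, and let $A=U_q^+({\mathfrak g^\sigma}^\vee)$ be attached to $C^\sigma=\begin{pmatrix}2n&-n\\-n&2n\end{pmatrix}$, i.e. it is $U^+_{q^n}(\mathfrak{sl}_3)$, with generators $E_1,E_2$. For $\mathbf i\in\{(121),(212)\}$ let $X_1,X_2,X_3$ be the modified root vectors of $\mathbf i$ in $A$ and let $\hat X_1,\hat X_2,\hat X_3\in B$ be defined by $\hat X_k=\hat c_k^{-1}\hat T_{i_1}\cdots\hat T_{i_{k-1}}(\hat E_{i_k})$, where $\hat T_r$, $\hat E_r$ are the products of the $T_i$, resp. $E_i$, over the $n$ nodes $i$ in the $\sigma$-orbit $r$, and $\hat c_k=\prod_{i\in i_k}\gamma(\hat s_{i_1}\cdots\hat s_{i_{k-1}}\alpha_i-\alpha_i)$. The quantum folding $\iota_{\mathbf i}:A\to B^\sigma\subset B$ is the injective linear map $X_1^{a_1}X_2^{a_2}X_3^{a_3}\mapsto\hat X_1^{a_1}\hat X_2^{a_2}\hat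 X_3^{a_3}$. An injective linear map $\iota:A\to B$ from an algebra $A$ that is PBW on $X_A$ to a PBW Ore domain $B$ is *enhanced liftable* if $\iota$ is multiplicative on the ordered monomials in $X_A$ and there are a finite set $Z_0\subset B\cap\operatorname{Frac}(\iota(A))$, where $\operatorname{Frac}(\iota(A))$ is the skew-subfield of $\operatorname{Frac}(B)$ generated by $\iota(A)$, and a total order on $\iota(X_A)\cup Z_0$, compatible with that of $X_A$, such that the subalgebra $\langle\iota(A),Z_0\rangle\subset B$ is sub-PBW on $\iota(X_A)\cup Z_0$ and there is an algebra $\hat U(\iota)$, called an *enhanced uberalgebra*, which is PBW on a copy of $\iota(X_A)\cup Z_0$, with an algebra homomorphism onto $\langle\iota(A),Z_0\rangle$ that is the identity on $\iota(X_A)\cup Z_0$ and a surjective algebra homomorphism $\mu:\hat U(\iota)\to A$ with $\mu(\iota(x))=x$ for $x\in X_A$ and $\mu(Z_0)=0$. **Theorem.** The quantum foldings $\iota_{(121)}$ and $\iota_{(212)}$ exist and are both enhanced liftable, with one and the same set $Z_0=\{Z_1,\dots,Z_{n-1}\}\subset B$. For this $Z_0$ (placed, in this order, after the root vectors) the enhanced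 uberalgebra of each of them is unique up to an isomorphism matching generators, and both are isomorphic to the following algebra $\mathcal A$; in particular $\hat U(\iota_{(121)})\cong\hat U(\iota_{(212)})$. (i) $\mathcal A$ is generated by $u_1,u_2,z_1,\dots,z_{n-1}$ subject to the relations, with $z_{k,1}=z_k=z_{n-k,2}$: - $z_kz_l=z_lz_k$ for $1\le k,l\le n-1$; - $u_iz_{k,i}=q^{n-2k}z_{k,i}u_i$ for $i=1,2$, $1\le k\le n-1$; - $u_i^2u_j-(q^n+q^{-n})u_iu_ju_i+u_ju_i^2=(q^{-1}-q)\,u_i\sum_{k=1}^{n-1}q^kz_{k,i}$ for $\{i,j\}=\{1,2\}$. For the word $(r,j,r)$, $\{r,j\}=\{1,2\}$, the generators of $\mathcal A$ corresponding to $\hat X_1,\hat X_2,\hat X_3,Z_1,\dots,Z_{n-1}$ are $u_r$, $(q^n-q^{-n})^{-1}\big(u_ju_r-q^{-n}u_ru_j-\sum_{k=1}^{n-1}[k]_q^{-1}z_{k,j}\big)$, $u_j$, $z_1,\dots,z_{n-1}$. The assignment $u_i\mapsto E_i$, $z_k\mapsto0$ defines a surjective algebra homomorphism $\mu:\mathcal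 A\to A$. (ii) $\mathcal A$ is PBW on the totally ordered set $\{u_2,u_{21},u_1,z_1,\dots,z_{n-1}\}$, where $u_{21}=u_1u_2-q^{-n}u_2u_1-\sum_{k=1}^{n-1}\frac{q-q^{-1}}{q^k-q^{-k}}z_k$, and in these generators it is presented by the relations - $z_kz_l=z_lz_k$ for $1\le k,l\le n-1$; - $u_1u_{21}=q^nu_{21}u_1$, $u_2u_{21}=q^{-n}u_{21}u_2$; - $u_1z_k=q^{n-2k}z_ku_1$, $u_2z_k=q^{2k-n}z_ku_2$, $u_{21}z_k=z_ku_{21}$ for $1\le k\le n-1$; - $u_1u_2=q^{-n}u_2u_1+u_{21}+\sum_{k=1}^{n-1}\frac{q-q^{-1}}{q^k-q^{-k}}z_k$. (iii) $\mathcal A$ is a quantum deformation of $U(\mathbf 1^{n-1}\rtimes(\mathfrak{sl}_3)_+)$, where $\mathbf 1$ is the trivial one-dimensional $(\mathfrak{sl}_3)_+$-module: if $X'X=\sum_Mc^M_{X,X'}M$ ($X<X'$ in the set of (ii), $M$ running over the ordered monomials) are the PBW relations of $\mathcal A$, then all $c^M_{X,X'}$ are regular at $q=1$, and the $\mathbb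 C$-algebra with the same generators and the relations $X'X=\sum_Mc^M_{X,X'}(1)M$ is isomorphic to $U(\mathbf 1^{n-1}\rtimes(\mathfrak{sl}_3)_+)$, with $u_i$ corresponding to the Chevalley generator $e_i$ and $z_1,\dots,z_{n-1}$ to the standard basis of $\mathbf 1^{n-1}$. -/

import Mathlib

open scoped BigOperators nonZeroDivisors

attribute [local instance 100] LieRing.ofAssociativeRing

noncomputable section

namespace QuantumFolding

/-! ### The ground field and quantum integers -/

/-- The ground field `ℂ(q)`. -/
abbrev Kq : Type := RatFunc ℂ

/-- The indeterminate `q`. -/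
def q : Kq := RatFunc.X

/-- The quantum integer `[m]_v = (v ^ m - v ^ (-m)) / (v - v⁻¹)`. -/
def qInt (v : Kq) (m : ℕ) : Kq := (v ^ m - (v ^ m)⁻¹) / (v - v⁻¹)

/-- The quantum factorial `[m]_v !`. -/
def qFact (v : Kq) (m : ℕ) : Kq := ∏ j ∈ Finset.range m, qInt v (j + 1)

/-- The quantum binomial coefficient. -/
def qBinom (v : Kq) (m b : ℕ) : Kq := qFact v m / (qFact v b * qFact v (m - b))

/-! ### PBW algebras -/

section PBW

variable {R A B : Type} [CommRing R] [Ring A] [Algebra R A]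

/-- The ordered monomial `x₁ ^ a₁ ⋯ x_N ^ a_N`. A finite totally ordered set of elements is given
by listing it in increasing order. -/
def orderedMonomial {A : Type} [Monoid A] {N : ℕ} (x : Fin N → A) (a : Fin N → ℕ) : A :=
  (List.ofFn fun i => x i ^ a i).prod

/-- `A` is a PBW algebra on the totally ordered set `x`: the ordered monomials form a basis. -/
structure IsPBW (R : Type) {A : Type} [CommRing R] [Ring A] [Algebra R A] {N : ℕ}
    (x : Fin N → A) : Prop where
  linearIndependent : LinearIndependent R (orderedMonomial x)
  span_eq_top : Submodule.span R (Set.range (orderedMonomial x)) = ⊤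

/-- The basis of ordered monomials of a PBW algebra. -/
def IsPBW.basis {N : ℕ} {x : Fin N → A} (h : IsPBW R x) : Module.Basis (Fin N → ℕ) R A :=
  Module.Basis.mk h.linearIndependent h.span_eq_top.ge

/-- The subalgebra `S` is sub-PBW with respect to the totally ordered set `w`: it contains `w`
and is spanned by the ordered monomials in `w`. -/
def IsSubPBW {N : ℕ} (S : Subalgebra R A) (w : Fin N → A) : Prop :=
  Submodule.span R (Set.range (orderedMonomial w)) = Subalgebra.toSubmodule S

/-- `U`, with generators `v`, is a uberalgebra of the sub-PBW algebra `S` (with respect to `w`):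
`U` is PBW on `v`, and `v j ↦ w j` extends to a surjective algebra homomorphism `U → S`. -/
structure IsUberalgebra {U : Type} [Ring U] [Algebra R U] {N : ℕ} (S : Subalgebra R A)
    (w : Fin N → A) (v : Fin N → U) : Prop where
  isSubPBW : IsSubPBW S w
  isPBW : IsPBW R v
  exists_hom : ∃ φ : U →ₐ[R] A, φ.range = S ∧ ∀ j, φ (v j) = w j

/-- `B` is an Ore domain and `z : B` lies in the skew-subfield, generated by `S`, of the skew-field
of fractions of `B`. -/
def MemSkewFractions {B : Type} [Ring B] (S : Set B) (z : B) : Prop :=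
  ∃ (_ : Nontrivial B) (_ : NoZeroDivisors B) (_ : OreLocalization.OreSet B⁰),
    (OreLocalization.numeratorHom z : OreLocalization B⁰ B) ∈
      Subfield.closure ((fun b : B => (OreLocalization.numeratorHom b : OreLocalization B⁰ B)) '' S)

variable [Ring B] [Algebra R B]

/-- `U`, with generators `v`, is an enhanced uberalgebra of the injective linear map `ι : A → B`,
where `A` is PBW on `x`. Here `w` lists in increasing order the elements of `ι(x) ∪ Z₀`, with
`w (e i) = ι (x i)`; the set `Z₀` consists of the remaining elements of `w`. -/
structure IsEnhancedUberalgebra {U : Type} [Ring U] [Algebra R U] {N K : ℕ} (x : Fin N → A)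
    (ι : A →ₗ[R] B) (e : Fin N ↪o Fin K) (w : Fin K → B) (v : Fin K → U) : Prop where
  source_isPBW : IsPBW R x
  target_isPBW : ∃ (M : ℕ) (y : Fin M → B), IsPBW R y
  target_isDomain : IsDomain B
  injective : Function.Injective ι
  multiplicative : ∀ a, ι (orderedMonomial x a) = orderedMonomial (fun i => ι (x i)) a
  w_injective : Function.Injective w
  w_apply : ∀ i, w (e i) = ι (x i)
  mem_fractions : ∀ j, j ∉ Set.range e → MemSkewFractions (Set.range ι) (w j)
  isUberalgebra : IsUberalgebra (Algebra.adjoin R (Set.range ι ∪ Set.range w)) w v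
  exists_proj : ∃ μ : U →ₐ[R] A, Function.Surjective μ ∧ (∀ i, μ (v (e i)) = x i) ∧
    ∀ j, j ∉ Set.range e → μ (v j) = 0

/-- The injective linear map `ι` is enhanced liftable: it has some enhanced uberalgebra. -/
def EnhancedLiftable {N : ℕ} (x : Fin N → A) (ι : A →ₗ[R] B) : Prop :=
  ∃ (K : ℕ) (e : Fin N ↪o Fin K) (w : Fin K → B) (U : Type) (_ : Ring U) (_ : Algebra R U)
    (v : Fin K → U), IsEnhancedUberalgebra x ι e w v

end PBW

/-! ### Specialization at `q = 1` and quantum deformations -/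

section Specialization

variable {A : Type} [Ring A] [Algebra Kq A] {N : ℕ} {x : Fin N → A}

/-- The coefficient of the ordered monomial with exponent `a` in `x j * x i`. -/
def IsPBW.structConst (h : IsPBW Kq x) (i j : Fin N) : (Fin N → ℕ) →₀ Kq :=
  h.basis.repr (x j * x i)

/-- `f` is defined at `q = 1`. -/
def RegularAtOne (f : Kq) : Prop := f.denom.eval 1 ≠ 0

/-- The value at `q = 1` of a rational function which is defined there. -/
def evalOne (f : Kq) : ℂ := RatFunc.eval (RingHom.id ℂ) 1 f

/-- All structure constants of the PBW algebra are defined at `q = 1`. -/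
def IsPBW.Specializable (h : IsPBW Kq x) : Prop :=
  ∀ i j, i < j → ∀ a, RegularAtOne (h.structConst i j a)

/-- The relations `x_j x_i = ∑ c(1) M`, `i < j`, where `x_j x_i = ∑ c M` in the PBW algebra. -/
inductive IsPBW.SpecRel (h : IsPBW Kq x) : FreeAlgebra ℂ (Fin N) → FreeAlgebra ℂ (Fin N) → Prop
  | mk (i j : Fin N) (hij : i < j) : IsPBW.SpecRel h
      (FreeAlgebra.ι ℂ j * FreeAlgebra.ι ℂ i)
      ((h.structConst i j).sum fun a c => evalOne c • orderedMonomial (FreeAlgebra.ι ℂ) a)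

/-- The specialization at `q = 1` of a PBW algebra, over the field `ℂ` of values at `q = 1`. -/
def IsPBW.Specialization (h : IsPBW Kq x) : Type := RingQuot h.SpecRel

instance (h : IsPBW Kq x) : Ring h.Specialization := inferInstanceAs (Ring (RingQuot _))

instance (h : IsPBW Kq x) : Algebra ℂ h.Specialization :=
  inferInstanceAs (Algebra ℂ (RingQuot _))

/-- The generators of the specialization. -/
def IsPBW.specGen (h : IsPBW Kq x) (i : Fin N) : h.Specialization :=
  RingQuot.mkAlgHom ℂ h.SpecRel (FreeAlgebra.ι ℂ i)

end Specialization

/-! ### Quantized enveloping algebras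

`C` is a symmetrized Cartan matrix: `C i j = d_i a_{ij}` with `C i i = 2 d_i`. -/

section QuantumGroup

variable {I : Type} (C : Matrix I I ℤ)

/-- The entries `a_{ij}` of the Cartan matrix. -/
def cartan (i j : I) : ℤ := 2 * C i j / C i i

/-- `q_i = q ^ d_i`. -/
def qi (i : I) : Kq := q ^ (C i i / 2)

/-- The left-hand side of the quantum Serre relation for `x i`, `x j`. -/
def serre {A : Type} [Ring A] [Algebra Kq A] (x : I → A) (i j : I) : A :=
  ∑ b ∈ Finset.range ((1 - cartan C i j).toNat + 1),
    ((-1) ^ b * qBinom (qi C i) (1 - cartan C i j).toNat b) •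
      (x i ^ b * x j * x i ^ ((1 - cartan C i j).toNat - b))

lemma map_serre {A A' : Type} [Ring A] [Algebra Kq A] [Ring A'] [Algebra Kq A']
    (f : A →ₐ[Kq] A') (x : I → A) (i j : I) :
    f (serre C x i j) = serre C (fun i => f (x i)) i j := by
  simp [serre]

/-- The quantum Serre relations between the generators `E_i`. -/
inductive UplusRel : FreeAlgebra Kq I → FreeAlgebra Kq I → Prop
  | serre (i j : I) (hij : i ≠ j) : UplusRel (serre C (FreeAlgebra.ι Kq) i j) 0

/-- The algebra `U_q^+`, generated by the `E_i` subject to the quantum Serre relations. -/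
def Uplus : Type := RingQuot (UplusRel C)

instance : Ring (Uplus C) := inferInstanceAs (Ring (RingQuot _))

instance : Algebra Kq (Uplus C) := inferInstanceAs (Algebra Kq (RingQuot _))

/-- The generators `E_i` of `U_q^+`. -/
def Uplus.E (i : I) : Uplus C := RingQuot.mkAlgHom Kq (UplusRel C) (FreeAlgebra.ι Kq i)

lemma Uplus.serre_E (i j : I) (hij : i ≠ j) : serre C (Uplus.E C) i j = 0 := by
  have h := RingQuot.mkAlgHom_rel Kq (UplusRel.serre (C := C) i j hij)
  rw [map_serre, map_zero] at h
  exact h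

/-- The algebra homomorphism from `U_q^+` given by elements satisfying the Serre relations. -/
def Uplus.lift {A : Type} [Ring A] [Algebra Kq A] (x : I → A)
    (hx : ∀ i j, i ≠ j → serre C x i j = 0) : Uplus C →ₐ[Kq] A :=
  RingQuot.liftAlgHom Kq ⟨FreeAlgebra.lift Kq x, by
    rintro _ _ ⟨i, j, hij⟩
    rw [map_serre, map_zero]
    simpa using hx i j hij⟩

@[simp] lemma Uplus.lift_E {A : Type} [Ring A] [Algebra Kq A] (x : I → A)
    (hx : ∀ i j, i ≠ j → serre C x i j = 0) (i : I) : Uplus.lift C x hx (Uplus.E C i) = x i := by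
  have h := RingQuot.liftAlgHom_mkAlgHom_apply (S := Kq) (s := UplusRel C)
    (FreeAlgebra.lift Kq x) (by
      rintro _ _ ⟨i, j, hij⟩
      rw [map_serre, map_zero]
      simpa using hx i j hij) (FreeAlgebra.ι Kq i)
  rw [FreeAlgebra.lift_ι_apply] at h
  exact h

/-- The action on `U_q^+` of a diagram automorphism `σ`. -/
def diagramHom (σ : Equiv.Perm I) (hσ : ∀ i j, C (σ i) (σ j) = C i j) :
    Uplus C →ₐ[Kq] Uplus C :=
  Uplus.lift C (fun i => Uplus.E C (σ i)) (by
    intro i j hij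
    have h := Uplus.serre_E C (σ i) (σ j) (σ.injective.ne hij)
    simpa [serre, cartan, qi, hσ] using h)

/-- The generators of the quantized enveloping algebra. -/
inductive Gen (I : Type) : Type
  | E (i : I)
  | F (i : I)
  | K (i : I)
  | Kinv (i : I)

/-- A generator as an element of the free algebra. -/
def fr (g : Gen I) : FreeAlgebra Kq (Gen I) := FreeAlgebra.ι Kq g

/-- The defining relations of the quantized enveloping algebra. -/
inductive UqRel : FreeAlgebra Kq (Gen I) → FreeAlgebra Kq (Gen I) → Prop
  | K_Kinv (i : I) : UqRel (fr (.K i) * fr (.Kinv i)) 1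
  | Kinv_K (i : I) : UqRel (fr (.Kinv i) * fr (.K i)) 1
  | K_K (i j : I) : UqRel (fr (.K i) * fr (.K j)) (fr (.K j) * fr (.K i))
  | E_F_same (i : I) : UqRel (fr (.E i) * fr (.F i) - fr (.F i) * fr (.E i))
      ((qi C i - (qi C i)⁻¹)⁻¹ • (fr (.K i) - fr (.Kinv i)))
  | E_F (i j : I) (hij : i ≠ j) : UqRel (fr (.E i) * fr (.F j)) (fr (.F j) * fr (.E i))
  | K_E (i j : I) : UqRel (fr (.K i) * fr (.E j) * fr (.Kinv i))
      (qi C i ^ cartan C i j • fr (.E j))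
  | K_F (i j : I) : UqRel (fr (.K i) * fr (.F j) * fr (.Kinv i))
      (qi C i ^ (-cartan C i j) • fr (.F j))
  | serre_E (i j : I) (hij : i ≠ j) : UqRel (serre C (fun i => fr (.E i)) i j) 0
  | serre_F (i j : I) (hij : i ≠ j) : UqRel (serre C (fun i => fr (.F i)) i j) 0

/-- The quantized enveloping algebra `U_q`. -/
def Uq : Type := RingQuot (UqRel C)

instance : Ring (Uq C) := inferInstanceAs (Ring (RingQuot _))

instance : Algebra Kq (Uq C) := inferInstanceAs (Algebra Kq (RingQuot _))

/-- The generators of `U_q`. -/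
def Uq.gen (g : Gen I) : Uq C := RingQuot.mkAlgHom Kq (UqRel C) (fr g)

/-- The canonical homomorphism `U_q^+ → U_q`, `E_i ↦ E_i` (the inclusion of `U_q^+` in `U_q`). -/
def incl : Uplus C →ₐ[Kq] Uq C :=
  Uplus.lift C (fun i => Uq.gen C (.E i)) (by
    intro i j hij
    have h := RingQuot.mkAlgHom_rel Kq (UqRel.serre_E (C := C) i j hij)
    rw [map_serre, map_zero] at h
    exact h)

/-- Integer powers of `K_i`. -/
def Uq.Kpow (i : I) (m : ℤ) : Uq C :=
  if 0 ≤ m then Uq.gen C (.K i) ^ m.toNat else Uq.gen C (.Kinv i) ^ (-m).toNat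

/-- The divided power `x ^ k / [k]_v !`. -/
def divPow (v : Kq) (x : Uq C) (k : ℕ) : Uq C := (qFact v k)⁻¹ • x ^ k

/-- The `T i` are Lusztig's braid group operators `T'_{i,-1}` on `U_q`. -/
structure IsBraidAction (T : I → Uq C →ₐ[Kq] Uq C) : Prop where
  K : ∀ i j, T i (Uq.gen C (.K j)) = Uq.gen C (.K j) * Uq.Kpow C i (-cartan C i j)
  Kinv : ∀ i j, T i (Uq.gen C (.Kinv j)) = Uq.gen C (.Kinv j) * Uq.Kpow C i (cartan C i j)
  E_same : ∀ i, T i (Uq.gen C (.E i)) = -(Uq.gen C (.Kinv i) * Uq.gen C (.F i))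
  F_same : ∀ i, T i (Uq.gen C (.F i)) = -(Uq.gen C (.E i) * Uq.gen C (.K i))
  E : ∀ i j, i ≠ j → T i (Uq.gen C (.E j)) =
    ∑ p ∈ Finset.HasAntidiagonal.antidiagonal (-cartan C i j).toNat,
      ((-1) ^ p.1 * (qi C i ^ p.1)⁻¹) •
        (divPow C (qi C i) (Uq.gen C (.E i)) p.1 * Uq.gen C (.E j) *
          divPow C (qi C i) (Uq.gen C (.E i)) p.2)
  F : ∀ i j, i ≠ j → T i (Uq.gen C (.F j)) =
    ∑ p ∈ Finset.HasAntidiagonal.antidiagonal (-cartan C i j).toNat,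
      ((-1) ^ p.1 * qi C i ^ p.1) •
        (divPow C (qi C i) (Uq.gen C (.F i)) p.2 * Uq.gen C (.F j) *
          divPow C (qi C i) (Uq.gen C (.F i)) p.1)

variable [Fintype I] [DecidableEq I]

/-- The simple reflection `s_i(α_j) = α_j - a_{ij} α_i` of the root lattice `ℤ^I`. -/
def reflection (i : I) (β : I → ℤ) : I → ℤ :=
  β - (∑ j, β j * cartan C i j) • Pi.single i 1

/-- The homomorphism from the root lattice to `ℂ(q)ˣ` with `α_i ↦ q_i - q_i⁻¹`. -/
def gammaWt (β : I → ℤ) : Kq := ∏ i, (qi C i - (qi C i)⁻¹) ^ β i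

/-- `X` is the sequence of modified PBW root vectors `X_k = c_k⁻¹ T_{r_1} ⋯ T_{r_{k-1}}(E_{r_k})`
of the word `r`, where `T_r` and `E_r` are the products of the `T_i` and of the `E_i` over the
list `o r` of indices, and `c_k = ∏_{i ∈ o r_k} γ(s_{r_1} ⋯ s_{r_{k-1}} α_i - α_i)`.
For `o r = [r]` these are the modified root vectors of the word `r` itself; when the `o r` are the
orbits of a diagram automorphism, they are the root vectors of the folded word. -/
def IsRootVectors {J : Type} {m : ℕ} (o : J → List I) (r : Fin m → J)
    (X : Fin m → Uplus C) : Prop :=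
  ∃ T : I → Uq C →ₐ[Kq] Uq C, IsBraidAction C T ∧ ∀ k : Fin m,
    incl C (X k) =
      (((o (r k)).map fun i => gammaWt C
        ((((List.ofFn r).take k).flatMap o).foldr (reflection C) (Pi.single i 1)
          - Pi.single i 1)).prod)⁻¹ •
      (((List.ofFn r).take k).flatMap o).foldr (fun i y => T i y)
        (((o (r k)).map fun i => Uq.gen C (.E i)).prod)

/-- The folded symmetrized Cartan matrix: sums of the entries of `C` over pairs of orbits. -/
def foldedMatrix {J : Type} (o : J → List I) : Matrix J J ℤ :=
  fun r s => ((o r).map fun i => ((o s).map fun j => C i j).sum).sum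

/-- `ι` is the quantum folding `U_q^+(C^σ) → U_q^+(C)^σ` attached to the word `r`, where `X` and `Y`
are the modified root vectors of `r` and of the folded word: `ι (X^a) = Y^a` for all `a`. -/
structure IsQuantumFolding {J : Type} [Fintype J] [DecidableEq J] {m : ℕ} (σ : Equiv.Perm I)
    (hσ : ∀ i j, C (σ i) (σ j) = C i j) (o : J → List I) (r : Fin m → J)
    (X : Fin m → Uplus (foldedMatrix C o)) (Y : Fin m → Uplus C)
    (ι : Uplus (foldedMatrix C o) →ₗ[Kq] Uplus C) : Prop where
  rootVectors : IsRootVectors (foldedMatrix C o) (fun s => [s]) r X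
  foldedRootVectors : IsRootVectors C o r Y
  map_monomial : ∀ a, ι (orderedMonomial X a) = orderedMonomial Y a
  injective : Function.Injective ι
  fixed : ∀ x, diagramHom C σ hσ (ι x) = ι x

end QuantumGroup

/-! ### The folding of `n` copies of `sl_3` -/

section SL3

variable (n : ℕ)

/-- The Cartan matrix of `sl_3 × ⋯ × sl_3` (`n` factors). The index `(i, s)` is the node `i` of the
factor `s`; the nodes `1`, `2` of the Dynkin diagram of `sl_3` are `0`, `1` here. -/
def sl3Pow : Matrix (Fin 2 × Fin n) (Fin 2 × Fin n) ℤ :=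
  Matrix.blockDiagonal fun _ => CartanMatrix.A 2

/-- The diagram automorphism of `sl_3 × ⋯ × sl_3` permuting the factors by `σ`. -/
def factorPerm (σ : Equiv.Perm (Fin n)) : Equiv.Perm (Fin 2 × Fin n) :=
  Equiv.prodCongr (Equiv.refl _) σ

lemma sl3Pow_factorPerm (σ : Equiv.Perm (Fin n)) (i j : Fin 2 × Fin n) :
    sl3Pow n (factorPerm n σ i) (factorPerm n σ j) = sl3Pow n i j := by
  simp [sl3Pow, factorPerm, Matrix.blockDiagonal_apply]

/-- The orbit of the nodes `(r, s)`, `s = 0, …, n - 1`, under a cyclic permutation of factors. -/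
def orbit (r : Fin 2) : List (Fin 2 × Fin n) := List.ofFn fun s : Fin n => (r, s)

/-- `U_q^+(sl_3 × ⋯ × sl_3)`. -/
abbrev UplusBig : Type := Uplus (sl3Pow n)

/-- `U_q^+` of the folded symmetrized Cartan matrix. -/
abbrev UplusSmall : Type := Uplus (foldedMatrix (sl3Pow n) (orbit n))

/-- The reduced word `(121)` for `r = 0` and `(212)` for `r = 1`. -/
def word (r : Fin 2) : Fin 3 → Fin 2 := ![r, r.rev, r]

/-- Index of `z_{k,i}`: the elements `z_1, …, z_{n-1}` are indexed by `0, …, n - 2`, and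
`z_{k,1} = z_k`, `z_{k,2} = z_{n-k}`. -/
def zIndex {n : ℕ} (k : Fin (n - 1)) (i : Fin 2) : Fin (n - 1) := if i = 0 then k else k.rev

/-- Generators `u_1, u_2` and `z_1, …, z_{n-1}`. -/
inductive AGen (n : ℕ) : Type
  | u (i : Fin 2)
  | z (k : Fin (n - 1))

/-- Free generators. -/
def fu (i : Fin 2) : FreeAlgebra Kq (AGen n) := FreeAlgebra.ι Kq (.u i)

/-- Free generators. -/
def fz (k : Fin (n - 1)) : FreeAlgebra Kq (AGen n) := FreeAlgebra.ι Kq (.z k)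

/-- The Serre-like relations. -/
inductive ARel : FreeAlgebra Kq (AGen n) → FreeAlgebra Kq (AGen n) → Prop
  | z_z (k l : Fin (n - 1)) : ARel (fz n k * fz n l) (fz n l * fz n k)
  | u_z (i : Fin 2) (k : Fin (n - 1)) : ARel (fu n i * fz n (zIndex k i))
      (q ^ ((n : ℤ) - 2 * ((k : ℤ) + 1)) • (fz n (zIndex k i) * fu n i))
  | serre (i j : Fin 2) (hij : i ≠ j) :
      ARel (fu n i ^ 2 * fu n j - (q ^ n + (q ^ n)⁻¹) • (fu n i * fu n j * fu n i)
          + fu n j * fu n i ^ 2)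
        ((q⁻¹ - q) • (fu n i * ∑ k : Fin (n - 1), q ^ ((k : ℕ) + 1) • fz n (zIndex k i)))

/-- The algebra with generators `u_1, u_2, z_1, …, z_{n-1}` and the Serre-like relations. -/
def AAlg : Type := RingQuot (ARel n)

instance : Ring (AAlg n) := inferInstanceAs (Ring (RingQuot _))

instance : Algebra Kq (AAlg n) := inferInstanceAs (Algebra Kq (RingQuot _))

/-- The generators `u_1, u_2`. -/
def AAlg.u (i : Fin 2) : AAlg n := RingQuot.mkAlgHom Kq (ARel n) (fu n i)

/-- The generators `z_1, …, z_{n-1}`. -/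
def AAlg.z (k : Fin (n - 1)) : AAlg n := RingQuot.mkAlgHom Kq (ARel n) (fz n k)

/-- For `{i, j} = {1, 2}`, the element `u_i u_j - q^{-n} u_j u_i - ∑_k [k]_q⁻¹ z_{k,i}`. -/
def AAlg.uu (i : Fin 2) : AAlg n :=
  AAlg.u n i * AAlg.u n i.rev - (q ^ n)⁻¹ • (AAlg.u n i.rev * AAlg.u n i)
    - ∑ k : Fin (n - 1), (qInt q ((k : ℕ) + 1))⁻¹ • AAlg.z n (zIndex k i)

/-- The totally ordered set `u_2, u_21, u_1, z_1, …, z_{n-1}`. -/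
def AAlg.pbwGen : Fin (3 + (n - 1)) → AAlg n :=
  Fin.append ![AAlg.u n 1, AAlg.uu n 0, AAlg.u n 0] (AAlg.z n)

/-- The generators of the uberalgebra corresponding to the modified root vectors of the word
`(r, j, r)`, followed by `z_1, …, z_{n-1}`. -/
def AAlg.uberGen (r : Fin 2) : Fin (3 + (n - 1)) → AAlg n :=
  Fin.append ![AAlg.u n r, (q ^ n - (q ^ n)⁻¹)⁻¹ • AAlg.uu n r.rev, AAlg.u n r.rev] (AAlg.z n)

/-- Generators of PBW type. -/
inductive PGen (n : ℕ) : Type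
  | u2
  | u21
  | u1
  | z (k : Fin (n - 1))

/-- Free generators. -/
def fp (g : PGen n) : FreeAlgebra Kq (PGen n) := FreeAlgebra.ι Kq g

/-- The PBW-type commutation relations. -/
inductive PRel : FreeAlgebra Kq (PGen n) → FreeAlgebra Kq (PGen n) → Prop
  | z_z (k l : Fin (n - 1)) : PRel (fp n (.z k) * fp n (.z l)) (fp n (.z l) * fp n (.z k))
  | u1_u21 : PRel (fp n .u1 * fp n .u21) (q ^ n • (fp n .u21 * fp n .u1))
  | u2_u21 : PRel (fp n .u2 * fp n .u21) ((q ^ n)⁻¹ • (fp n .u21 * fp n .u2))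
  | u1_z (k : Fin (n - 1)) : PRel (fp n .u1 * fp n (.z k))
      (q ^ ((n : ℤ) - 2 * ((k : ℤ) + 1)) • (fp n (.z k) * fp n .u1))
  | u2_z (k : Fin (n - 1)) : PRel (fp n .u2 * fp n (.z k))
      (q ^ (2 * ((k : ℤ) + 1) - (n : ℤ)) • (fp n (.z k) * fp n .u2))
  | u21_z (k : Fin (n - 1)) : PRel (fp n .u21 * fp n (.z k)) (fp n (.z k) * fp n .u21)
  | u1_u2 : PRel (fp n .u1 * fp n .u2)
      ((q ^ n)⁻¹ • (fp n .u2 * fp n .u1) + fp n .u21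
        + ∑ k : Fin (n - 1), ((q - q⁻¹) / (q ^ ((k : ℕ) + 1) - (q ^ ((k : ℕ) + 1))⁻¹)) • fp n (.z k))

/-- The algebra with generators `u_2, u_21, u_1, z_1, …, z_{n-1}` and the PBW-type relations. -/
def PAlg : Type := RingQuot (PRel n)

instance : Ring (PAlg n) := inferInstanceAs (Ring (RingQuot _))

instance : Algebra Kq (PAlg n) := inferInstanceAs (Algebra Kq (RingQuot _))

/-- The generators. -/
def PAlg.gen (g : PGen n) : PAlg n := RingQuot.mkAlgHom Kq (PRel n) (fp n g)

end SL3

/-! ### The Lie algebra `1^m ⋊ (sl_3)_+` -/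

section LieAlgebras

/-- The Chevalley generators `e_1`, `e_2` of `sl_3`. -/
def chevalley : Fin 2 → LieAlgebra.SpecialLinear.sl (Fin 3) ℂ :=
  ![LieAlgebra.SpecialLinear.single 0 1 (by decide) 1,
    LieAlgebra.SpecialLinear.single 1 2 (by decide) 1]

/-- `(sl_3)_+`, the Lie subalgebra generated by `e_1` and `e_2`. -/
def sl3Plus : LieSubalgebra ℂ (LieAlgebra.SpecialLinear.sl (Fin 3) ℂ) :=
  LieSubalgebra.lieSpan ℂ _ (Set.range chevalley)

/-- The Chevalley generators as elements of `(sl_3)_+`. -/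
def sl3Plus.e (i : Fin 2) : sl3Plus :=
  ⟨chevalley i, LieSubalgebra.subset_lieSpan (Set.mem_range_self i)⟩

/-- The `m`-dimensional abelian Lie algebra. -/
def AbelianLie (m : ℕ) : Type := Fin m → ℂ

instance (m : ℕ) : AddCommGroup (AbelianLie m) := inferInstanceAs (AddCommGroup (Fin m → ℂ))

instance (m : ℕ) : Module ℂ (AbelianLie m) := inferInstanceAs (Module ℂ (Fin m → ℂ))

instance (m : ℕ) : LieRing (AbelianLie m) where
  bracket _ _ := 0
  add_lie _ _ _ := by simp
  lie_add _ _ _ := by simp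
  lie_self _ := rfl
  leibniz_lie _ _ _ := by simp

instance (m : ℕ) : LieAlgebra ℂ (AbelianLie m) where
  lie_smul c _ _ := (smul_zero c).symm

/-- `1^m ⋊ (sl_3)_+`, where `1` is the trivial one-dimensional module. -/
abbrev TrivSl3 (m : ℕ) : Type :=
  LieAlgebra.SemiDirectSum (AbelianLie m) sl3Plus
    (0 : sl3Plus →ₗ⁅ℂ⁆ LieDerivation ℂ (AbelianLie m) (AbelianLie m))

/-- `e_i` in the enveloping algebra of `1^m ⋊ (sl_3)_+`. -/
def envE (m : ℕ) (i : Fin 2) : UniversalEnvelopingAlgebra ℂ (TrivSl3 m) :=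
  UniversalEnvelopingAlgebra.ι ℂ (⟨0, sl3Plus.e i⟩ : TrivSl3 m)

/-- The standard basis vectors of `1^m` in the enveloping algebra of `1^m ⋊ (sl_3)_+`. -/
def envZ (m : ℕ) (k : Fin m) : UniversalEnvelopingAlgebra ℂ (TrivSl3 m) :=
  UniversalEnvelopingAlgebra.ι ℂ (⟨(Pi.single k 1 : Fin m → ℂ), 0⟩ : TrivSl3 m)

end LieAlgebras

end QuantumFolding

end

open QuantumFolding

/-!
The algebra `AAlg n` is realized inside the `n`-fold power `B` of `U_q^+(sl_3)`. The generator
`u_i` is mapped to the product over all copies of the Chevalley generators `E_{(i, s)}`. In the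
copy `s`, write `p s` and `p' s` for the middle modified root vectors of the two reduced words;
the products of the two Chevalley generators are `p + q p'` and `q p + p'`. As different copies
commute, both `u_1 u_2` and `u_2 u_1` are combinations of the elementary symmetric elements `e_k =
∑_{|S| = k} ∏_{s ∈ S} p' s ∏_{s ∉ S} p s`, and so is the `q^n`-commutator of the `u_i`: see
`Copies.commutator_prod`. Its term for `k = 0` is a multiple of the middle folded root vector, and
the other terms are, up to normalization, the `z_k`. Since both Chevalley generators of a copy
skew-commute with `p s` and `p' s`, the relations of `AAlg n` follow; see `exists_toBig`. The
equivalence of its two presentations, `exists_presentation_equiv`, is a rewriting of the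
Serre-like relation as a skew-commutation relation for the corrected commutator.

All PBW statements come from two tools. Spanning is a straightening argument for iterated Ore
extensions without any consistency check, `span_orderedMonomial_eq_adjoin`. Linear independence is
read off from leading exponents: `B` acts by weighted shift operators on the space with basis a
lexicographically ordered lattice (`copies_rep`, the embedding of `U_q^+(sl_3)` in a quantum
torus), an operator that raises the largest exponent of every vector by a fixed amount has a
leading exponent (`HasLead`), leading exponents add under products, and operators with distinct
leading exponents are independent (`linearIndependent_of_hasLead`). This gives the PBW property of
`B`, of the folded algebra and of `AAlg n`, the injectivity of the folding, and, because each
nonzero element of `B` acts with a leading exponent, that `B` is a domain. The Ore condition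
follows from the polynomial growth of `B` (`nonempty_oreSet_of_growth`).

The `z_k` lie in the skew-subfield generated by the image of the folding: a combination of all of
them with nonzero coefficients is a polynomial in the folded root vectors, and they are
eigenvectors for the conjugation by `u_j` with the distinct eigenvalues `q^{n - 2k}`
(`memSkewFractions_of_sum`). An enhanced uberalgebra for these `z_k` maps to `B`, injectively by
the linear independence of the ordered monomials, with an image that does not depend on it: this
is the uniqueness, `enhancedUberalgebra_unique`.

That the folded root vectors are the expected products needs Lusztig's operators on the full
quantized enveloping algebra. They are constructed on `U_q(sl_3)` by checking the defining
relations (`Sl3Rel.braid`), then copy by copy (`IsA2Power.exists_isBraidAction`), and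
`IsA2Power.isRootVectors` evaluates them.

At `q = 1` the PBW relations say that the `z_k` are central and that `u_1 u_2 - u_2 u_1` is
central, equal to `u_21 + ∑ z_k / k`. These are the relations of `U(1^{n-1} ⋊ (sl_3)_+)`, as
`(sl_3)_+` is spanned by `e_1`, `e_2` and `[e_1, e_2]`; see `AAlg.exists_specialization_equiv`.
-/

set_option linter.unusedSectionVars false
set_option linter.unusedSimpArgs false
set_option linter.unnecessarySeqFocus false

noncomputable section

namespace QuantumFolding

/-! ### Leading exponents of operators -/

section Leading

variable {K M : Type} [Field K] [AddCommGroup M] [LinearOrder M] [IsOrderedAddMonoid M]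

/-- `m` is the largest exponent occurring in `f`. -/
def IsTop (f : M →₀ K) (m : M) : Prop := f m ≠ 0 ∧ ∀ m', m < m' → f m' = 0

/-- The operator `T` raises the largest exponent of every vector by exactly `a`. It is enough to
ask this for the standard basis vectors. -/
def HasLead (T : Module.End K (M →₀ K)) (a : M) : Prop :=
  ∀ m, IsTop (T (Finsupp.single m 1)) (m + a)

lemma IsTop.ne_zero {f : M →₀ K} {m : M} (h : IsTop f m) : f ≠ 0 := by
  rintro rfl
  exact h.1 rfl

lemma IsTop.map {f : M →₀ K} {m a : M} (hf : IsTop f m) {T : Module.End K (M →₀ K)}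
    (hT : HasLead T a) : IsTop (T f) (m + a) := by
  have key : ∀ m', T f m' = ∑ k ∈ f.support, f k * T (Finsupp.single k 1) m' := by
    intro m'
    conv_lhs => rw [← Finsupp.sum_single f]
    rw [Finsupp.sum, map_sum, Finsupp.finsetSum_apply]
    refine Finset.sum_congr rfl fun k _ => ?_
    rw [← mul_one (f k), ← smul_eq_mul, ← Finsupp.smul_single, map_smul]
    simp
  have hle : ∀ k ∈ f.support, k ≤ m := fun k hk => by
    by_contra! h
    exact Finsupp.mem_support_iff.1 hk (hf.2 k h)
  constructor
  · rw [key, Finset.sum_eq_single m]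
    · exact mul_ne_zero hf.1 (hT m).1
    · intro k hk hkm
      rw [(hT k).2 _ (by simpa using lt_of_le_of_ne (hle k hk) hkm), mul_zero]
    · intro h
      simp [Finsupp.notMem_support_iff.1 h]
  · intro m' hm'
    rw [key]
    refine Finset.sum_eq_zero fun k hk => ?_
    rw [(hT k).2 _ (lt_of_le_of_lt (by simpa using hle k hk) hm'), mul_zero]

lemma HasLead.mul {S T : Module.End K (M →₀ K)} {a b : M} (hS : HasLead S a) (hT : HasLead T b) :
    HasLead (S * T) (a + b) := fun m => by
  rw [add_comm a b, ← add_assoc]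
  exact (hT m).map hS

lemma HasLead.one : HasLead (1 : Module.End K (M →₀ K)) 0 := fun m => by
  constructor
  · simp
  · intro m' h
    simp only [add_zero] at h
    simp [h.ne]

lemma HasLead.smul {T : Module.End K (M →₀ K)} {a : M} (hT : HasLead T a) {c : K} (hc : c ≠ 0) :
    HasLead (c • T) a := fun m => by
  constructor
  · simpa [hc] using (hT m).1
  · intro m' h
    simp [(hT m).2 m' h]

lemma HasLead.add {S T : Module.End K (M →₀ K)} {a b : M} (hS : HasLead S a) (hT : HasLead T b)
    (h : b < a) : HasLead (S + T) a := fun m => by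
  have hlt : m + b < m + a := by simpa using h
  constructor
  · simpa [(hT m).2 _ hlt] using (hS m).1
  · intro m' h'
    simp [(hT m).2 _ (hlt.trans h'), (hS m).2 _ h']

lemma HasLead.pow {T : Module.End K (M →₀ K)} {a : M} (hT : HasLead T a) (k : ℕ) :
    HasLead (T ^ k) (k • a) := by
  induction k with
  | zero => simpa using HasLead.one
  | succ k ih => rw [pow_succ, succ_nsmul]; exact ih.mul hT

lemma HasLead.listProd : ∀ {N : ℕ} {T : Fin N → Module.End K (M →₀ K)} {a : Fin N → M},
    (∀ i, HasLead (T i) (a i)) → HasLead (List.ofFn T).prod (∑ i, a i)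
  | 0, _, _, _ => by simpa using HasLead.one
  | N + 1, T, a, h => by
    rw [List.ofFn_succ, List.prod_cons, Fin.sum_univ_succ]
    exact (h 0).mul (HasLead.listProd fun i => h i.succ)

/-- A nontrivial combination of operators with distinct leading exponents has a leading
exponent. -/
lemma HasLead.exists_of_sum {ι : Type} {s : Finset ι} (hs : s.Nonempty)
    {T : ι → Module.End K (M →₀ K)} {a : ι → M} (ha : Function.Injective a)
    (hT : ∀ i, HasLead (T i) (a i)) {c : ι → K} (hc : ∀ i ∈ s, c i ≠ 0) :
    ∃ b, HasLead (∑ i ∈ s, c i • T i) b := by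
  obtain ⟨i₀, hi₀, hmax⟩ := s.exists_max_image a hs
  refine ⟨a i₀, fun m => ⟨?_, ?_⟩⟩
  · rw [LinearMap.sum_apply, Finsupp.finsetSum_apply, Finset.sum_eq_single i₀]
    · simpa [hc i₀ hi₀] using (hT i₀ m).1
    · intro i hi hne
      have : a i < a i₀ := lt_of_le_of_ne (hmax i hi) (ha.ne hne)
      simp [(hT i m).2 (m + a i₀) (by simpa using this)]
    · exact fun h => absurd hi₀ h
  · intro m' hm'
    rw [LinearMap.sum_apply, Finsupp.finsetSum_apply]
    refine Finset.sum_eq_zero fun i hi => ?_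
    have : a i ≤ a i₀ := hmax i hi
    simp [(hT i m).2 m' (lt_of_le_of_lt (by simpa using this) hm')]

lemma HasLead.apply_ne_zero {T : Module.End K (M →₀ K)} {a : M} (hT : HasLead T a) :
    T (Finsupp.single 0 1) ≠ 0 := (hT 0).ne_zero

lemma HasLead.ne_zero {T : Module.End K (M →₀ K)} {a : M} (hT : HasLead T a) : T ≠ 0 := by
  rintro rfl
  exact hT.apply_ne_zero rfl

end Leading

/-! ### PBW bases from leading exponents -/

section Criterion

variable {K M : Type} [Field K] [AddCommGroup M] [LinearOrder M] [IsOrderedAddMonoid M]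
  {R R' : Type} [Ring R] [Algebra K R] [Ring R'] [Algebra K R']

lemma orderedMonomial_succ {A : Type} [Monoid A] {N : ℕ} (x : Fin (N + 1) → A)
    (a : Fin (N + 1) → ℕ) :
    orderedMonomial x a = x 0 ^ a 0 * orderedMonomial (Fin.tail x) (Fin.tail a) := by
  simp [orderedMonomial, List.ofFn_succ, Fin.tail]

lemma map_orderedMonomial {A A' F : Type} [Monoid A] [Monoid A'] [FunLike F A A']
    [MonoidHomClass F A A'] (f : F) {N : ℕ} (x : Fin N → A) (a : Fin N → ℕ) :
    f (orderedMonomial x a) = orderedMonomial (fun i => f (x i)) a := by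
  simp [orderedMonomial, map_list_prod, List.map_ofFn, Function.comp_def]

lemma orderedMonomial_zero {A : Type} [Monoid A] {N : ℕ} (x : Fin N → A) :
    orderedMonomial x 0 = 1 := by
  simp [orderedMonomial]

lemma orderedMonomial_add_of_lt {A : Type} [Monoid A] : ∀ {N : ℕ} (x : Fin N → A) (i : Fin N)
    (k : ℕ) (a : Fin N → ℕ), (∀ l, l ≤ i → a l = 0) →
    orderedMonomial x (Pi.single i k + a) = x i ^ k * orderedMonomial x a
  | 0, _, i, _, _, _ => i.elim0
  | N + 1, x, i, k, a, h => by
    rw [orderedMonomial_succ, orderedMonomial_succ x a]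
    have h0 : a 0 = 0 := h 0 (Fin.zero_le _)
    induction i using Fin.cases with
    | zero =>
      have : Fin.tail (Pi.single (0 : Fin (N + 1)) k + a) = Fin.tail a := by
        funext j; simp [Fin.tail]
      rw [this]; simp [h0]
    | succ i =>
      have : Fin.tail (Pi.single i.succ k + a) = Pi.single i k + Fin.tail a := by
        funext j
        simp [Fin.tail, Pi.single_apply, Fin.succ_inj]
      rw [this, orderedMonomial_add_of_lt (Fin.tail x) i k (Fin.tail a) fun l hl => h l.succ (by simpa using hl)]
      simp [h0, Fin.tail]

lemma orderedMonomial_single {A : Type} [Monoid A] {N : ℕ} (x : Fin N → A) (i : Fin N) (k : ℕ) :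
    orderedMonomial x (Pi.single i k) = x i ^ k := by
  simpa [orderedMonomial_zero] using orderedMonomial_add_of_lt x i k 0 (fun _ _ => rfl)

lemma orderedMonomial_single_add_single {A : Type} [Monoid A] {N : ℕ} (x : Fin N → A)
    {i j : Fin N} (hij : i < j) :
    orderedMonomial x (Pi.single i 1 + Pi.single j 1) = x i * x j := by
  rw [orderedMonomial_add_of_lt, orderedMonomial_single, pow_one, pow_one]
  intro l hl
  simp [(lt_of_le_of_lt hl hij).ne]

lemma HasLead.orderedMonomial {N : ℕ} {T : Fin N → Module.End K (M →₀ K)} {f : Fin N → M}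
    (hT : ∀ i, HasLead (T i) (f i)) (a : Fin N → ℕ) :
    HasLead (orderedMonomial T a) (∑ i, a i • f i) :=
  HasLead.listProd fun i => (hT i).pow (a i)

/-- Ordered monomials with distinct leading exponents are linearly independent. -/
lemma linearIndependent_of_hasLead (ρ : R →ₐ[K] Module.End K (M →₀ K)) {N : ℕ} {x : Fin N → R}
    {f : Fin N → M} (hlead : ∀ i, HasLead (ρ (x i)) (f i))
    (hinj : Function.Injective fun a : Fin N → ℕ => ∑ i, a i • f i) :
    LinearIndependent K (orderedMonomial x) := by
  classical
  rw [linearIndependent_iff]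
  intro l hl
  by_contra hne
  obtain ⟨b, hb⟩ := HasLead.exists_of_sum (s := l.support) (Finsupp.support_nonempty_iff.2 hne)
    (T := fun a => orderedMonomial (fun i => ρ (x i)) a) hinj (HasLead.orderedMonomial hlead)
    (c := l) (fun i hi => Finsupp.mem_support_iff.1 hi)
  apply hb.ne_zero
  have := congrArg ρ hl
  rw [Finsupp.linearCombination_apply, Finsupp.sum, map_sum, map_zero] at this
  simpa [map_orderedMonomial] using this

lemma IsPBW.exists_hasLead {N : ℕ} {x : Fin N → R} (h : IsPBW K x)
    (ρ : R →ₐ[K] Module.End K (M →₀ K)) {f : Fin N → M} (hlead : ∀ i, HasLead (ρ (x i)) (f i))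
    (hinj : Function.Injective fun a : Fin N → ℕ => ∑ i, a i • f i) {b : R} (hb : b ≠ 0) :
    ∃ m, HasLead (ρ b) m := by
  have hsum := h.basis.linearCombination_repr b
  obtain ⟨m, hm⟩ := HasLead.exists_of_sum (s := (h.basis.repr b).support)
    (Finsupp.support_nonempty_iff.2 (by simpa using hb))
    (T := fun a => QuantumFolding.orderedMonomial (fun i => ρ (x i)) a) hinj
    (HasLead.orderedMonomial hlead)
    (c := h.basis.repr b) (fun i hi => Finsupp.mem_support_iff.1 hi)
  refine ⟨m, ?_⟩
  rw [← hsum, Finsupp.linearCombination_apply, Finsupp.sum, map_sum]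
  convert hm using 3 with a
  simp [IsPBW.basis, map_orderedMonomial]

/-- The existence of leading exponents rules out zero divisors. -/
lemma isDomain_of_hasLead [Nontrivial R] (ρ : R →ₐ[K] Module.End K (M →₀ K))
    (h : ∀ b : R, b ≠ 0 → ∃ m, HasLead (ρ b) m) : IsDomain R := by
  have : NoZeroDivisors R := ⟨fun {a b} hab => by
    by_contra! hne
    obtain ⟨m, hm⟩ := h a hne.1
    obtain ⟨m', hm'⟩ := h b hne.2
    have := (hm.mul hm').ne_zero
    rw [← map_mul, hab, map_zero] at this
    exact this rfl⟩
  exact NoZeroDivisors.to_isDomain R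

end Criterion

/-! ### Straightening -/

section Straightening

variable {K : Type} [Field K] {R : Type} [Ring R] [Algebra K R]

lemma orderedMonomial_mem_adjoin {N : ℕ} (w : Fin N → R) (a : Fin N → ℕ) :
    orderedMonomial w a ∈ Algebra.adjoin K (Set.range w) := by
  refine Subalgebra.list_prod_mem _ fun y hy => ?_
  obtain ⟨i, rfl⟩ := (List.mem_ofFn' _ _).1 hy
  exact pow_mem (Algebra.subset_adjoin (Set.mem_range_self i)) _

/-- If, for `i < j`, the product `w j * w i` is a multiple of `w i * w j` up to a linear combination
of later generators, then the ordered monomials span the subalgebra generated by `w`: this is the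
iterated Ore extension argument, adding the generators from the last to the first. -/
theorem span_orderedMonomial_eq_adjoin : ∀ {N : ℕ} (w : Fin N → R),
    (∀ i j, i < j → ∃ c : K, w j * w i - c • (w i * w j) ∈ Submodule.span K (w '' Set.Ioi i)) →
    Submodule.span K (Set.range (orderedMonomial w)) =
      Subalgebra.toSubmodule (Algebra.adjoin K (Set.range w))
  | 0, w, _ => by
    have : Set.range (orderedMonomial w) = {1} := by
      ext; simp [orderedMonomial, eq_comm]
    rw [this]
    simp [Algebra.toSubmodule_bot, Submodule.one_eq_span]
  | N + 1, w, h => by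
    have htail : ∀ i : Fin N, w '' Set.Ioi i.succ = Fin.tail w '' Set.Ioi i := by
      intro i; ext r; constructor
      · rintro ⟨l, hl, rfl⟩
        refine Fin.cases (fun hl => absurd hl (by simp)) (fun l hl => ?_) l hl
        exact ⟨l, by simpa using hl, rfl⟩
      · rintro ⟨l, hl, rfl⟩
        exact ⟨l.succ, by simpa using hl, rfl⟩
    have htail0 : w '' Set.Ioi 0 ⊆ Set.range (Fin.tail w) := by
      rintro _ ⟨l, hl, rfl⟩
      refine Fin.cases (fun hl => absurd hl (by simp)) (fun l _ => ?_) l hl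
      exact ⟨l, rfl⟩
    have ih := span_orderedMonomial_eq_adjoin (Fin.tail w) fun i j hij => by
      obtain ⟨c, hc⟩ := h i.succ j.succ (by simpa using hij)
      rw [htail] at hc
      exact ⟨c, hc⟩
    set S := Algebra.adjoin K (Set.range (Fin.tail w)) with hS
    set W := Submodule.span K (Set.range (orderedMonomial w)) with hW
    -- `W` is spanned by the products `w 0 ^ k * f` with `f ∈ S`
    have hpowW : ∀ (k : ℕ), ∀ f ∈ S, w 0 ^ k * f ∈ W := by
      intro k f hf
      have hf' : f ∈ Submodule.span K (Set.range (orderedMonomial (Fin.tail w))) := by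
        rw [ih]; exact hf
      clear hf
      induction hf' using Submodule.span_induction with
      | mem f hf' =>
        obtain ⟨a, rfl⟩ := hf'
        refine Submodule.subset_span ⟨Fin.cons k a, ?_⟩
        rw [orderedMonomial_succ]; simp
      | zero => simp
      | add f g hf hg ihf ihg =>
        rw [mul_add]
        exact W.add_mem ihf ihg
      | smul c f hf ihf =>
        rw [mul_smul_comm]
        exact W.smul_mem _ ihf
    have hWind : ∀ (V : Submodule K R), (∀ k : ℕ, ∀ f ∈ S, w 0 ^ k * f ∈ V) → W ≤ V := by
      intro V hV
      refine Submodule.span_le.2 ?_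
      rintro _ ⟨a, rfl⟩
      rw [orderedMonomial_succ]
      exact hV _ _ (orderedMonomial_mem_adjoin _ _)
    have h0W : ∀ t ∈ W, w 0 * t ∈ W := by
      intro t ht
      have : W ≤ W.comap (LinearMap.mulLeft K (w 0)) := hWind _ fun k f hf => by
        simp only [Submodule.mem_comap, LinearMap.mulLeft_apply]
        rw [← mul_assoc, ← pow_succ']
        exact hpowW _ _ hf
      exact this ht
    -- moving `w 0` to the left of an element of `S`, by the hypothesis on `w 0`
    have hcomm : ∀ m ∈ S, ∃ f ∈ S, ∃ g ∈ S, m * w 0 = w 0 * f + g := by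
      intro m hm
      induction hm using Algebra.adjoin_induction with
      | mem m hm =>
        obtain ⟨j, rfl⟩ := hm
        obtain ⟨c, hc⟩ := h 0 j.succ (Fin.succ_pos j)
        refine ⟨c • w j.succ, S.smul_mem (Algebra.subset_adjoin ⟨j, rfl⟩) c, _,
          (Submodule.span_le.2 (htail0.trans Algebra.subset_adjoin) :
            _ ≤ Subalgebra.toSubmodule S) hc, ?_⟩
        simp [Fin.tail]
      | algebraMap r =>
        exact ⟨algebraMap K R r, S.algebraMap_mem r, 0, S.zero_mem, by
          rw [add_zero, Algebra.commutes]⟩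
      | add a b _ _ iha ihb =>
        obtain ⟨f, hf, g, hg, e⟩ := iha
        obtain ⟨f', hf', g', hg', e'⟩ := ihb
        exact ⟨f + f', S.add_mem hf hf', g + g', S.add_mem hg hg', by
          rw [add_mul, e, e', mul_add]; abel⟩
      | mul a b ha hb iha ihb =>
        obtain ⟨f, hf, g, hg, e⟩ := iha
        obtain ⟨f', hf', g', hg', e'⟩ := ihb
        exact ⟨f * f', S.mul_mem hf hf', g * f' + a * g', S.add_mem (S.mul_mem hg hf')
          (S.mul_mem ha hg'), by
            rw [mul_assoc, e', mul_add, ← mul_assoc, e, add_mul]; noncomm_ring⟩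
    have hSW : ∀ m ∈ S, ∀ t ∈ W, m * t ∈ W := by
      have key : ∀ k : ℕ, ∀ f ∈ S, ∀ m ∈ S, m * (w 0 ^ k * f) ∈ W := by
        intro k f hf
        induction k with
        | zero =>
          intro m hm
          simpa using hpowW 0 _ (S.mul_mem hm hf)
        | succ k ihk =>
          intro m hm
          obtain ⟨f', hf', g', hg', e⟩ := hcomm m hm
          have : m * (w 0 ^ (k + 1) * f) = w 0 * (f' * (w 0 ^ k * f)) + g' * (w 0 ^ k * f) := by
            rw [pow_succ', mul_assoc (w 0), ← mul_assoc m, e]; noncomm_ring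
          rw [this]
          exact W.add_mem (h0W _ (ihk _ hf')) (ihk _ hg')
      intro m hm t ht
      have : W ≤ W.comap (LinearMap.mulLeft K m) := hWind _ fun k f hf => by
        simpa using key k f hf m hm
      exact this ht
    refine le_antisymm (Submodule.span_le.2 ?_) fun s hs => ?_
    · rintro _ ⟨a, rfl⟩
      exact orderedMonomial_mem_adjoin _ _
    · have h1 : (1 : R) ∈ W := by simpa using hpowW 0 1 S.one_mem
      suffices ∀ t ∈ W, s * t ∈ W by simpa using this 1 h1
      change s ∈ Algebra.adjoin K (Set.range w) at hs
      induction hs using Algebra.adjoin_induction with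
      | mem m hm =>
        obtain ⟨j, rfl⟩ := hm
        refine Fin.cases h0W (fun j => ?_) j
        exact hSW _ (Algebra.subset_adjoin ⟨j, rfl⟩)
      | algebraMap r =>
        intro t ht
        rw [← Algebra.smul_def]
        exact W.smul_mem _ ht
      | add a b _ _ iha ihb =>
        intro t ht
        rw [add_mul]
        exact W.add_mem (iha t ht) (ihb t ht)
      | mul a b _ _ iha ihb =>
        intro t ht
        rw [mul_assoc]
        exact iha _ (ihb t ht)

end Straightening

/-! ### The Ore condition and skew fractions -/

section Ore

variable {K : Type} [Field K] {R : Type} [Ring R] [Algebra K R]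

lemma exists_pow_lt_two_pow (d D : ℕ) : ∃ k : ℕ, (2 * (k * d) + 1) ^ D < 2 ^ k := by
  have h := tendsto_pow_const_div_const_pow_of_one_lt D (one_lt_two (α := ℝ))
  have hC : (0 : ℝ) < ((2 * d + 1 : ℕ) : ℝ) ^ D := by positivity
  have h' := (h.eventually (gt_mem_nhds (inv_pos.2 hC))).and (Filter.eventually_ge_atTop 1)
  obtain ⟨k, hk, hk1⟩ := h'.exists
  refine ⟨k, ?_⟩
  have h1 : (2 * (k * d) + 1) ^ D ≤ (2 * d + 1) ^ D * k ^ D := by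
    rw [← mul_pow]
    refine Nat.pow_le_pow_left ?_ _
    nlinarith
  have h2 : ((2 * d + 1 : ℕ) : ℝ) ^ D * (k : ℝ) ^ D < 2 ^ k := by
    rw [div_lt_iff₀ (by positivity)] at hk
    calc _ < ((2 * d + 1 : ℕ) : ℝ) ^ D * ((((2 * d + 1 : ℕ) : ℝ) ^ D)⁻¹ * 2 ^ k) :=
          mul_lt_mul_of_pos_left hk hC
      _ = 2 ^ k := by field_simp
  exact lt_of_le_of_lt h1 (by exact_mod_cast h2)

/-- A domain of polynomial growth satisfies the Ore condition: if `R r ∩ R s = 0`, then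
`G ^ m * r` and `G ^ m * s` are independent in `G ^ (m + d)`, so the dimension of `G ^ (m * d)` would
grow exponentially in `m`. -/
theorem nonempty_oreSet_of_growth [IsDomain R] (G : Submodule K R) (h1 : 1 ∈ G)
    (hG : ∀ r, ∃ d, r ∈ G ^ d) [hfin : ∀ m : ℕ, FiniteDimensional K ↥(G ^ m)] {D : ℕ}
    (hdim : ∀ m : ℕ, Module.finrank K ↥(G ^ m) ≤ (2 * m + 1) ^ D) :
    Nonempty (OreLocalization.OreSet R⁰) := by
  rw [OreLocalization.nonempty_oreSet_iff_of_noZeroDivisors]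
  intro r s
  by_contra! hne
  have hmono : ∀ {a b : ℕ}, a ≤ b → G ^ a ≤ G ^ b := fun h =>
    pow_le_pow_right₀ (Submodule.one_le.2 h1) h
  obtain ⟨d₁, hr⟩ := hG r
  obtain ⟨d₂, hs⟩ := hG s
  obtain ⟨d, hrd, hsd⟩ : ∃ d, r ∈ G ^ d ∧ (s : R) ∈ G ^ d :=
    ⟨max d₁ d₂, hmono (le_max_left _ _) hr, hmono (le_max_right _ _) hs⟩
  -- `(a, b) ↦ a r - b s` is injective on `G ^ m × G ^ m`, with values in `G ^ (m + d)`
  have step : ∀ m : ℕ, 2 * Module.finrank K ↥(G ^ m) ≤ Module.finrank K ↥(G ^ (m + d)) := by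
    intro m
    let φ : (↥(G ^ m) × ↥(G ^ m)) →ₗ[K] R :=
      ((LinearMap.mulRight K r).comp (G ^ m).subtype).coprod
        (-(LinearMap.mulRight K (s : R)).comp (G ^ m).subtype)
    have hφ : ∀ p, φ p = p.1 * r - p.2 * s := fun p => by simp [φ, sub_eq_add_neg]
    have hmem : ∀ p, φ p ∈ G ^ (m + d) := fun p => by
      rw [hφ, pow_add]
      exact sub_mem (Submodule.mul_mem_mul p.1.2 hrd) (Submodule.mul_mem_mul p.2.2 hsd)
    have hinj : Function.Injective (φ.codRestrict _ hmem) := by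
      rw [← LinearMap.ker_eq_bot, LinearMap.ker_codRestrict, LinearMap.ker_eq_bot']
      rintro ⟨⟨a, ha⟩, ⟨b, hb⟩⟩ h
      rw [hφ] at h
      have hab : a * r = b * s := sub_eq_zero.1 h
      have ha0 : a = 0 := by
        by_contra ha0
        exact hne b ⟨a, mem_nonZeroDivisors_of_ne_zero ha0⟩ hab
      subst ha0
      have hb0 : b = 0 := by
        rw [zero_mul] at hab
        exact (mul_eq_zero.1 hab.symm).resolve_right (nonZeroDivisors.ne_zero s.2)
      subst hb0
      rfl
    have := LinearMap.finrank_le_finrank_of_injective hinj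
    rwa [Module.finrank_prod, ← two_mul] at this
  have hexp : ∀ k : ℕ, 2 ^ k ≤ Module.finrank K ↥(G ^ (k * d)) := by
    intro k
    induction k with
    | zero =>
      rw [zero_mul, pow_zero 2, Nat.one_le_iff_ne_zero]
      intro h0
      have : G ^ 0 = ⊥ := Submodule.finrank_eq_zero.1 h0
      have h1' : (1 : R) ∈ G ^ 0 := by rw [pow_zero]; exact Submodule.one_le.1 le_rfl
      rw [this] at h1'
      exact one_ne_zero h1'
    | succ k ih =>
      rw [pow_succ', add_mul, one_mul]
      exact (Nat.mul_le_mul_left 2 ih).trans (step _)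
  obtain ⟨k, hk⟩ := exists_pow_lt_two_pow d D
  exact absurd ((hexp k).trans (hdim _)) (not_le.2 hk)

/-- If a linear combination of eigenvectors of conjugation by `u`, with distinct eigenvalues, lies in
the skew-subfield generated by a subspace `V` containing `1` and `u`, so does each eigenvector. -/
theorem memSkewFractions_of_sum [IsDomain R] [ore : OreLocalization.OreSet R⁰] (V : Submodule K R)
    (h1 : 1 ∈ V) {u : R} (hu : u ∈ V) (hu0 : u ≠ 0) {ι : Type} {z : ι → R} {l : ι → K}
    (hl : Function.Injective l) (huz : ∀ i, u * z i = l i • (z i * u)) (hl0 : ∀ i, l i ≠ 0)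
    {t : R} (htV : ∀ D : Subring R, (V : Set R) ⊆ D → t ∈ D)
    {s : Finset ι} {c : ι → K} (hc : ∀ i ∈ s, c i ≠ 0) (ht : t = ∑ i ∈ s, c i • z i) :
    ∀ i ∈ s, MemSkewFractions (V : Set R) (z i) := by
  classical
  let num : R →+* OreLocalization R⁰ R := OreLocalization.numeratorRingHom
  let D : Subfield (OreLocalization R⁰ R) := Subfield.closure (num '' (V : Set R))
  let T : Subring R := D.toSubring.comap num
  have hVT : (V : Set R) ⊆ T := fun b hb => Subfield.subset_closure ⟨b, hb, rfl⟩
  have hsmul : ∀ (a : K), ∀ b ∈ T, a • b ∈ T := fun a b hb => by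
    rw [← one_mul b, ← smul_mul_assoc]
    exact T.mul_mem (hVT (V.smul_mem a h1)) hb
  have hnum0 : num u ≠ 0 := by
    intro h
    have h' : num u = num 0 := by rw [h, map_zero]
    exact hu0 (OreLocalization.numeratorHom_inj (S := R⁰) (fun x hx => hx.1) h')
  have hdiv : ∀ b, u * b ∈ T → b ∈ T := fun b hb => by
    have h2 : num u * num b ∈ D := by rw [← map_mul]; exact hb
    have h3 : (num u)⁻¹ * (num u * num b) ∈ D := D.mul_mem (D.inv_mem (hVT hu)) h2
    rwa [inv_mul_cancel_left₀ hnum0] at h3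
  suffices key : ∀ (s : Finset ι) (c : ι → K), (∀ i ∈ s, c i ≠ 0) →
      (∑ i ∈ s, c i • z i) ∈ T → ∀ i ∈ s, z i ∈ T by
    intro i hi
    exact ⟨inferInstance, inferInstance, ore, key s c hc (ht ▸ htV T hVT) i hi⟩
  intro s
  induction s using Finset.induction_on with
  | empty => simp
  | insert j s hj ih =>
    intro c hc hT
    -- `u t - l j t u`, for the sum `t`, is a combination without the term `j`; dividing by `u`
    -- shortens the sum
    have hstep : (∑ i ∈ s, (c i * (1 - l j / l i)) • z i) ∈ T := by
      apply hdiv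
      have : u * (∑ i ∈ s, (c i * (1 - l j / l i)) • z i)
          = u * (∑ i ∈ insert j s, c i • z i) - l j • ((∑ i ∈ insert j s, c i • z i) * u) := by
        rw [Finset.sum_insert hj, mul_add, add_mul, smul_add, Finset.mul_sum, Finset.mul_sum,
          Finset.sum_mul, Finset.smul_sum, mul_smul_comm, huz, smul_mul_assoc, smul_comm (c j),
          add_sub_add_left_eq_sub, ← Finset.sum_sub_distrib]
        refine Finset.sum_congr rfl fun i _ => ?_
        rw [mul_smul_comm, mul_smul_comm, huz, smul_mul_assoc, smul_smul, smul_smul, smul_smul,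
          ← sub_smul]
        congr 1
        have := hl0 i
        field_simp
      rw [this]
      exact T.sub_mem (T.mul_mem (hVT hu) hT) (hsmul _ _ (T.mul_mem hT (hVT hu)))
    have hs : ∀ i ∈ s, z i ∈ T := by
      refine ih _ (fun i hi => mul_ne_zero (hc i (Finset.mem_insert_of_mem hi)) ?_) hstep
      rw [sub_ne_zero, ne_comm, Ne, div_eq_one_iff_eq (hl0 i)]
      exact fun h => hj (hl h ▸ hi)
    intro i hi
    rcases Finset.mem_insert.1 hi with rfl | hi
    · rw [Finset.sum_insert hj] at hT
      have h4 := T.sub_mem hT (T.sum_mem fun k hk => hsmul (c k) _ (hs k hk))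
      rw [add_sub_cancel_right] at h4
      have h5 := hsmul (c i)⁻¹ _ h4
      rwa [smul_smul, inv_mul_cancel₀ (hc i hi), one_smul] at h5
    · exact hs i hi

end Ore

/-! ### The quantum Serre relations of type `A₂` -/

section SerreRelations

variable {K A : Type} [Field K] [Ring A] [Algebra K A]

/-- `(v - v⁻¹)⁻¹ (y x - v⁻¹ x y)`: for the Chevalley generators `x`, `y` of `U_v^+(sl_3)` this is the
middle modified root vector of the word starting with the index of `x`. -/
def rootVec (v : K) (x y : A) : A := (v - v⁻¹)⁻¹ • (y * x - v⁻¹ • (x * y))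

/-- The quantum Serre relation for `a = -1`. -/
def SerreRel (v : K) (x y : A) : Prop :=
  y * x ^ 2 - (v + v⁻¹) • (x * y * x) + x ^ 2 * y = 0

variable {v : K} {x y : A}

lemma sq_sub_one_ne_zero (hv0 : v ≠ 0) (hv : v - v⁻¹ ≠ 0) : v ^ 2 - 1 ≠ 0 := by
  intro h
  apply hv
  field_simp
  simpa using h

lemma mul_eq_rootVec (hv0 : v ≠ 0) (hv : v - v⁻¹ ≠ 0) (x y : A) :
    x * y = rootVec v x y + v • rootVec v y x := by
  have := sq_sub_one_ne_zero hv0 hv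
  simp only [rootVec, smul_sub, smul_smul]
  match_scalars <;> field_simp <;> ring

lemma rootVec_eq_iff (hv : v - v⁻¹ ≠ 0) :
    y * x - v⁻¹ • (x * y) = (v - v⁻¹) • rootVec v x y := by
  rw [rootVec, smul_smul, mul_inv_cancel₀ hv, one_smul]

lemma SerreRel.rootVec_mul (hv0 : v ≠ 0) (h : SerreRel v x y) :
    rootVec v x y * x = v • (x * rootVec v x y) := by
  unfold SerreRel at h
  simp only [rootVec]
  linear_combination (norm := skip) (v - v⁻¹)⁻¹ • h
  simp only [smul_mul_assoc, mul_smul_comm, sub_mul, mul_sub, mul_assoc, pow_two]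
  match_scalars <;> field_simp <;> ring

lemma SerreRel.mul_rootVec (hv0 : v ≠ 0) (h : SerreRel v y x) :
    y * rootVec v x y = v • (rootVec v x y * y) := by
  unfold SerreRel at h
  simp only [rootVec]
  linear_combination (norm := skip) (v - v⁻¹)⁻¹ • h
  simp only [smul_mul_assoc, mul_smul_comm, sub_mul, mul_sub, mul_assoc, pow_two]
  match_scalars <;> field_simp <;> ring

lemma commute_rootVec (hv0 : v ≠ 0) (h : SerreRel v x y) (h' : SerreRel v y x) :
    Commute (rootVec v x y) (rootVec v y x) := by
  have h1 := h.rootVec_mul hv0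
  have h2 := h'.mul_rootVec hv0
  rw [rootVec.eq_def v y x]
  generalize rootVec v x y = p at *
  have hyx : p * (y * x) = (y * x) * p := by
    linear_combination (norm := skip) (-v⁻¹) • (h2 * x) + v⁻¹ • (y * h1)
    simp only [smul_mul_assoc, mul_smul_comm, mul_assoc]
    match_scalars <;> field_simp <;> ring
  have hxy : p * (x * y) = (x * y) * p := by
    linear_combination (norm := skip) (h1 * y) - x * h2
    simp only [smul_mul_assoc, mul_smul_comm, mul_assoc]
    match_scalars <;> field_simp <;> ring
  simp only [Commute, SemiconjBy, mul_smul_comm, smul_mul_assoc, mul_sub, sub_mul, hxy, hyx]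

lemma rootVec_commute_right {z : A} (hx : Commute z x) (hy : Commute z y) :
    Commute z (rootVec v x y) := by
  unfold rootVec
  exact ((hy.mul_right hx).sub_right ((hx.mul_right hy).smul_right _)).smul_right _

lemma map_rootVec {A' : Type} [Ring A'] [Algebra K A'] (f : A →ₐ[K] A') :
    f (rootVec v x y) = rootVec v (f x) (f y) := by
  simp [rootVec]

end SerreRelations

/-! ### Homogeneous elementary symmetric elements -/

section Esym

variable {A : Type} [Ring A]

/-- The sum, over the `k`-element sets `S` of indices, of the ordered products of the `P' s` for
`s ∈ S` and the `P s` for `s ∉ S`; that is, the coefficient of `T ^ k` in `∏ (P s + T P' s)`. -/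
def esym : ∀ {N : ℕ}, (Fin N → A) → (Fin N → A) → ℕ → A
  | 0, _, _, 0 => 1
  | 0, _, _, _ + 1 => 0
  | _ + 1, P, P', 0 => P 0 * esym (Fin.tail P) (Fin.tail P') 0
  | _ + 1, P, P', k + 1 =>
    P 0 * esym (Fin.tail P) (Fin.tail P') (k + 1) + P' 0 * esym (Fin.tail P) (Fin.tail P') k

lemma esym_of_lt : ∀ {N : ℕ} (P P' : Fin N → A) {k : ℕ}, N < k → esym P P' k = 0
  | 0, _, _, 0, h => absurd h (lt_irrefl _)
  | 0, _, _, _ + 1, _ => rfl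
  | _ + 1, _, _, 0, h => absurd h (by simp)
  | N + 1, P, P', k + 1, h => by
    rw [esym, esym_of_lt _ _ (by omega : N < k + 1), esym_of_lt _ _ (by omega : N < k)]
    simp

lemma esym_zero : ∀ {N : ℕ} (P P' : Fin N → A), esym P P' 0 = (List.ofFn P).prod
  | 0, _, _ => by simp [esym]
  | N + 1, P, P' => by
    rw [esym, esym_zero, List.ofFn_succ, List.prod_cons]
    rfl

lemma esym_symm : ∀ {N : ℕ} (P P' : Fin N → A) {k l : ℕ}, k + l = N →
    esym P' P k = esym P P' l
  | 0, _, _, 0, 0, _ => rfl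
  | 0, _, _, 0, _ + 1, h => by omega
  | 0, _, _, _ + 1, _, h => by omega
  | N + 1, P, P', 0, l + 1, h => by
    have : l = N := by omega
    subst this
    rw [esym, esym, esym_of_lt _ _ (lt_add_one _), mul_zero, zero_add,
      esym_symm _ _ (zero_add _)]
  | N + 1, P, P', k + 1, 0, h => by
    have : k = N := by omega
    subst this
    rw [esym, esym, esym_of_lt _ _ (lt_add_one _), mul_zero, zero_add,
      esym_symm _ _ (add_zero _)]
  | N + 1, P, P', k + 1, l + 1, h => by
    rw [esym, esym, esym_symm _ _ (by omega : k + 1 + l = N),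
      esym_symm _ _ (by omega : k + (l + 1) = N), add_comm]

lemma map_esym {A' : Type} [Ring A'] (f : A →+* A') : ∀ {N : ℕ} (P P' : Fin N → A) (k : ℕ),
    f (esym P P' k) = esym (fun s => f (P s)) (fun s => f (P' s)) k
  | 0, _, _, 0 => by simp [esym]
  | 0, _, _, _ + 1 => by simp [esym]
  | N + 1, P, P', 0 => by
    rw [esym, esym, map_mul, map_esym]; rfl
  | N + 1, P, P', k + 1 => by
    rw [esym, esym, map_add, map_mul, map_mul, map_esym, map_esym]; rfl

lemma esym_commute {z : A} : ∀ {N : ℕ} {P P' : Fin N → A}, (∀ s, Commute z (P s)) →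
    (∀ s, Commute z (P' s)) → ∀ k, Commute z (esym P P' k)
  | 0, _, _, _, _, 0 => by simp [esym]
  | 0, _, _, _, _, _ + 1 => by simp [esym]
  | N + 1, P, P', h, h', 0 => by
    rw [esym]
    exact (h 0).mul_right (esym_commute (fun s => h s.succ) (fun s => h' s.succ) 0)
  | N + 1, P, P', h, h', k + 1 => by
    rw [esym]
    exact ((h 0).mul_right (esym_commute (fun s => h s.succ) (fun s => h' s.succ) _)).add_right
      ((h' 0).mul_right (esym_commute (fun s => h s.succ) (fun s => h' s.succ) _))

variable {K : Type} [Field K] [Algebra K A]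

lemma prod_add_smul (c : K) : ∀ {N : ℕ} (P P' : Fin N → A),
    (List.ofFn fun s => P s + c • P' s).prod = ∑ k ∈ Finset.range (N + 1), c ^ k • esym P P' k
  | 0, _, _ => by simp [esym]
  | N + 1, P, P' => by
    rw [List.ofFn_succ, List.prod_cons]
    have ih := prod_add_smul c (Fin.tail P) (Fin.tail P')
    simp only [Fin.tail] at ih
    rw [ih, add_mul]
    rw [Finset.sum_range_succ' _ (N + 1)]
    simp only [esym, smul_add, Finset.sum_add_distrib]
    rw [add_right_comm]
    congr 1
    · have h := Finset.sum_range_succ' (fun k => c ^ k • (P 0 * esym (Fin.tail P) (Fin.tail P') k))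
        (N + 1)
      rw [← h, Finset.sum_range_succ _ (N + 1), esym_of_lt _ _ (lt_add_one N), mul_zero, smul_zero, add_zero,
        Finset.mul_sum]
      exact Finset.sum_congr rfl fun k _ => by rw [mul_smul_comm]
    · rw [Finset.mul_sum]
      refine Finset.sum_congr rfl fun k _ => ?_
      rw [smul_mul_assoc, mul_smul_comm, smul_smul, ← pow_succ']

lemma mul_esym {u : A} {a b : K} : ∀ {N : ℕ} {P P' : Fin N → A},
    (∀ s, u * P s = a • (P s * u)) → (∀ s, u * P' s = b • (P' s * u)) → ∀ {k l : ℕ}, k + l = N →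
    u * esym P P' k = (a ^ l * b ^ k) • (esym P P' k * u)
  | 0, _, _, _, _, 0, 0, _ => by simp [esym]
  | 0, _, _, _, _, 0, _ + 1, h => by omega
  | 0, _, _, _, _, _ + 1, _, h => by omega
  | N + 1, P, P', h, h', 0, l + 1, hkl => by
    have ih := mul_esym (P := Fin.tail P) (P' := Fin.tail P') (fun s => h s.succ)
      (fun s => h' s.succ) (by omega : 0 + l = N)
    rw [esym, ← mul_assoc, h, smul_mul_assoc, mul_assoc, ih, mul_smul_comm, smul_smul, mul_assoc]
    congr 1; ring
  | N + 1, P, P', h, h', k + 1, 0, hkl => by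
    have ih := mul_esym (P := Fin.tail P) (P' := Fin.tail P') (fun s => h s.succ)
      (fun s => h' s.succ) (by omega : k + 0 = N)
    rw [esym, esym_of_lt _ _ (by omega : N < k + 1), mul_zero, zero_add, ← mul_assoc, h',
      smul_mul_assoc, mul_assoc, ih, mul_smul_comm, smul_smul, mul_assoc]
    congr 1; ring
  | N + 1, P, P', h, h', k + 1, l + 1, hkl => by
    have ih := mul_esym (P := Fin.tail P) (P' := Fin.tail P') (fun s => h s.succ)
      (fun s => h' s.succ) (by omega : (k + 1) + l = N)
    have ih' := mul_esym (P := Fin.tail P) (P' := Fin.tail P') (fun s => h s.succ)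
      (fun s => h' s.succ) (by omega : k + (l + 1) = N)
    rw [esym, mul_add, ← mul_assoc, ← mul_assoc, h, h', smul_mul_assoc, smul_mul_assoc, mul_assoc,
      mul_assoc, ih, ih', add_mul, smul_add, mul_smul_comm, mul_smul_comm, smul_smul, smul_smul,
      mul_assoc, mul_assoc]
    congr 2 <;> ring

variable {M : Type} [AddCommGroup M] [LinearOrder M] [IsOrderedAddMonoid M]

/-- If the differences of the leading exponents of `P' s` and `P s` decrease with `s`, the leading
term of an elementary symmetric element takes `P' s` for the first indices `s`. -/
lemma HasLead.esym : ∀ {N : ℕ} {P P' : Fin N → Module.End K (M →₀ K)} {α β : Fin N → M},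
    (∀ s, HasLead (P s) (α s)) → (∀ s, HasLead (P' s) (β s)) →
    (∀ s t, s < t → α s + β t < α t + β s) → ∀ {k : ℕ}, k ≤ N →
    HasLead (esym P P' k) (∑ s : Fin N, if (s : ℕ) < k then β s else α s)
  | 0, _, _, _, _, _, _, _, 0, _ => by simpa [QuantumFolding.esym] using HasLead.one
  | N + 1, P, P', α, β, h, h', hd, 0, _ => by
    have ih := HasLead.esym (P := Fin.tail P) (P' := Fin.tail P') (fun s => h s.succ)
      (fun s => h' s.succ) (fun s t hst => hd _ _ (by simpa using hst)) (Nat.zero_le N)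
    rw [QuantumFolding.esym, Fin.sum_univ_succ]
    simpa using (h 0).mul ih
  | N + 1, P, P', α, β, h, h', hd, k + 1, hk => by
    have ih := fun k hk => HasLead.esym (P := Fin.tail P) (P' := Fin.tail P') (fun s => h s.succ)
      (fun s => h' s.succ) (fun s t hst => hd _ _ (by simpa using hst)) (k := k) hk
    rw [QuantumFolding.esym, Fin.sum_univ_succ]
    have h2 := (h' 0).mul (ih k (by omega))
    rcases Nat.lt_or_ge N (k + 1) with hN | hN
    · rw [esym_of_lt _ _ hN, mul_zero, zero_add]
      simpa using h2
    · have h1 := (h 0).mul (ih (k + 1) hN)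
      rw [add_comm]
      have h12 := h2.add h1 ?_
      · simpa using h12
      · have hlt := hd 0 (Fin.succ ⟨k, hN⟩) (Fin.succ_pos _)
        have e1 := Finset.add_sum_erase Finset.univ
          (fun s : Fin N => if (s : ℕ) < k + 1 then β s.succ else α s.succ)
          (Finset.mem_univ (⟨k, hN⟩ : Fin N))
        have e2 := Finset.add_sum_erase Finset.univ
          (fun s : Fin N => if (s : ℕ) < k then β s.succ else α s.succ)
          (Finset.mem_univ (⟨k, hN⟩ : Fin N))
        have e3 : ∑ s ∈ Finset.univ.erase (⟨k, hN⟩ : Fin N),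
              (if (s : ℕ) < k + 1 then β s.succ else α s.succ) =
            ∑ s ∈ Finset.univ.erase (⟨k, hN⟩ : Fin N),
              (if (s : ℕ) < k then β s.succ else α s.succ) := by
          refine Finset.sum_congr rfl fun s hs => ?_
          have : (s : ℕ) ≠ k := fun h => (Finset.mem_erase.1 hs).1 (Fin.ext h)
          have : (s : ℕ) < k + 1 ↔ (s : ℕ) < k := by omega
          simp only [this]
        rw [← e1, ← e2, e3]
        simp only [lt_add_iff_pos_right, lt_irrefl, if_true, if_false, zero_lt_one]
        rw [← add_assoc, ← add_assoc]
        refine add_lt_add_left ?_ _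
        rwa [add_comm (β 0)]

end Esym

/-! ### Commuting copies of `U_v^+(sl_3)` -/

section Copies

variable {K A : Type} [Field K] [Ring A] [Algebra K A]

/-- The `x s`, `y s` satisfy the relations of the Chevalley generators of
`U_v^+(sl_3 × ⋯ × sl_3)`. -/
structure Copies (v : K) {N : ℕ} (x y : Fin N → A) : Prop where
  ne_zero : v ≠ 0
  sub_inv_ne_zero : v - v⁻¹ ≠ 0
  serre : ∀ s, SerreRel v (x s) (y s)
  serre' : ∀ s, SerreRel v (y s) (x s)
  comm_left : ∀ s t, Commute (x s) (x t)
  comm_right : ∀ s t, Commute (y s) (y t)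
  comm : ∀ s t, s ≠ t → Commute (x s) (y t)

lemma ofFn_prod_commute {N : ℕ} {x : Fin N → A} {z : A} (h : ∀ s, Commute z (x s)) :
    Commute z (List.ofFn x).prod :=
  Commute.list_prod_right _ _ fun y hy => by
    obtain ⟨i, rfl⟩ := (List.mem_ofFn' _ _).1 hy
    exact h i

lemma ofFn_prod_mul : ∀ {N : ℕ} (x y : Fin N → A), (∀ s t, s ≠ t → Commute (x s) (y t)) →
    (List.ofFn x).prod * (List.ofFn y).prod = (List.ofFn fun s => x s * y s).prod
  | 0, _, _, _ => by simp
  | N + 1, x, y, h => by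
    have ih := ofFn_prod_mul (fun s => x s.succ) (fun s => y s.succ)
      (fun s t hst => h _ _ (by simpa using hst))
    have hc : Commute (y 0) (List.ofFn fun s : Fin N => x s.succ).prod :=
      ofFn_prod_commute fun s => (h _ _ (by simp)).symm
    simp only [List.ofFn_succ, List.prod_cons]
    rw [← ih, mul_assoc, mul_assoc, ← mul_assoc _ (y 0), ← hc.eq, mul_assoc]

/-- Only one factor of the product fails to commute with `z`. -/
lemma ofFn_prod_mul_eq_smul {c : K} {z : A} : ∀ {N : ℕ} {x : Fin N → A} (s : Fin N),
    (x s * z = c • (z * x s)) → (∀ t, t ≠ s → Commute (x t) z) →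
    (List.ofFn x).prod * z = c • (z * (List.ofFn x).prod)
  | 0, _, s, _, _ => s.elim0
  | N + 1, x, s, h, h' => by
    simp only [List.ofFn_succ, List.prod_cons]
    induction s using Fin.cases with
    | zero =>
      have hc : Commute z (List.ofFn fun s : Fin N => x s.succ).prod :=
        ofFn_prod_commute fun s => (h' _ (by simp)).symm
      rw [mul_assoc, ← hc.eq, ← mul_assoc, h, smul_mul_assoc, mul_assoc]
    | succ s =>
      have ih := ofFn_prod_mul_eq_smul (x := fun s : Fin N => x s.succ) s h
        (fun t ht => h' _ (by simpa using ht))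
      have hc := h' 0 (Fin.succ_ne_zero s).symm
      rw [mul_assoc, ih, mul_smul_comm, ← mul_assoc, hc.eq, mul_assoc]

namespace Copies

variable {v : K} {N : ℕ} {x y : Fin N → A}

lemma symm (h : Copies v x y) : Copies v y x :=
  ⟨h.ne_zero, h.sub_inv_ne_zero, h.serre', h.serre, h.comm_right, h.comm_left,
    fun s t hst => (h.comm t s hst.symm).symm⟩

lemma comm_rootVec (h : Copies v x y) {s t : Fin N} (hst : s ≠ t) :
    Commute (x s) (rootVec v (x t) (y t)) :=
  rootVec_commute_right (h.comm_left s t) (h.comm s t hst)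

lemma comm_rootVec' (h : Copies v x y) {s t : Fin N} (hst : s ≠ t) :
    Commute (y s) (rootVec v (x t) (y t)) :=
  rootVec_commute_right (h.comm t s hst.symm).symm (h.comm_right s t)

lemma rootVec_comm (h : Copies v x y) (s t : Fin N) :
    Commute (rootVec v (x s) (y s)) (rootVec v (x t) (y t)) := by
  rcases eq_or_ne s t with rfl | hst
  · exact Commute.refl _
  · exact (rootVec_commute_right (h.comm_rootVec hst.symm).symm (h.comm_rootVec' hst.symm).symm)

lemma rootVec_comm' (h : Copies v x y) (s t : Fin N) :
    Commute (rootVec v (x s) (y s)) (rootVec v (y t) (x t)) := by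
  rcases eq_or_ne s t with rfl | hst
  · exact commute_rootVec h.ne_zero (h.serre s) (h.serre' s)
  · exact (rootVec_commute_right (h.comm_rootVec' hst.symm).symm (h.comm_rootVec hst.symm).symm)

lemma mul_rootVec_left (h : Copies v x y) (s : Fin N) :
    x s * rootVec v (x s) (y s) = v⁻¹ • (rootVec v (x s) (y s) * x s) := by
  rw [(h.serre s).rootVec_mul h.ne_zero, smul_smul, inv_mul_cancel₀ h.ne_zero, one_smul]

lemma prod_mul_rootVec (h : Copies v x y) (s : Fin N) :
    (List.ofFn x).prod * rootVec v (x s) (y s) =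
      v⁻¹ • (rootVec v (x s) (y s) * (List.ofFn x).prod) :=
  ofFn_prod_mul_eq_smul s (h.mul_rootVec_left s) fun _ ht => h.comm_rootVec ht

lemma prod_mul_rootVec' (h : Copies v x y) (s : Fin N) :
    (List.ofFn y).prod * rootVec v (x s) (y s) =
      v • (rootVec v (x s) (y s) * (List.ofFn y).prod) :=
  ofFn_prod_mul_eq_smul s ((h.serre' s).mul_rootVec h.ne_zero) fun _ ht => h.comm_rootVec' ht

/-- The elementary symmetric elements of the power of `sl_3`: the sum over the `k`-element sets of
copies of the products of the root vectors `rootVec v (y s) (x s)` for the copies in the set and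
`rootVec v (x s) (y s)` for the others. -/
def e (v : K) (x y : Fin N → A) (k : ℕ) : A :=
  esym (fun s => rootVec v (x s) (y s)) (fun s => rootVec v (y s) (x s)) k

lemma e_symm (v : K) (x y : Fin N → A) {k l : ℕ} (hkl : k + l = N) : e v y x k = e v x y l :=
  esym_symm _ _ hkl

lemma e_zero (v : K) (x y : Fin N → A) :
    e v x y 0 = (List.ofFn fun s => rootVec v (x s) (y s)).prod := esym_zero _ _

lemma e_comm (h : Copies v x y) (k l : ℕ) : Commute (e v x y k) (e v x y l) :=
  esym_commute
    (fun s => (esym_commute (fun t => h.rootVec_comm s t) (fun t => h.rootVec_comm' s t) k).symm)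
    (fun s => (esym_commute (fun t => (h.rootVec_comm' t s).symm)
      (fun t => h.symm.rootVec_comm s t) k).symm) l

lemma prod_mul_e (h : Copies v x y) {k l : ℕ} (hkl : k + l = N) :
    (List.ofFn x).prod * e v x y k = v ^ ((k : ℤ) - l) • (e v x y k * (List.ofFn x).prod) := by
  rw [e, mul_esym h.prod_mul_rootVec h.symm.prod_mul_rootVec' hkl, zpow_sub₀ h.ne_zero, inv_pow,
    div_eq_mul_inv, mul_comm, zpow_natCast, zpow_natCast]

lemma prod_mul_e' (h : Copies v x y) {k l : ℕ} (hkl : k + l = N) :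
    (List.ofFn y).prod * e v x y k = v ^ ((l : ℤ) - k) • (e v x y k * (List.ofFn y).prod) := by
  rw [← e_symm v x y (by omega : l + k = N)]
  exact h.symm.prod_mul_e (by omega)

lemma prod_mul_prod (h : Copies v x y) :
    (List.ofFn x).prod * (List.ofFn y).prod =
      ∑ k ∈ Finset.range (N + 1), v ^ k • e v x y k := by
  rw [ofFn_prod_mul _ _ h.comm]
  simp only [mul_eq_rootVec h.ne_zero h.sub_inv_ne_zero]
  rw [prod_add_smul]
  rfl

lemma prod_mul_prod' (h : Copies v x y) :
    (List.ofFn y).prod * (List.ofFn x).prod =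
      ∑ k ∈ Finset.range (N + 1), v ^ (N - k) • e v x y k := by
  rw [h.symm.prod_mul_prod, ← Finset.sum_range_reflect]
  refine Finset.sum_congr rfl fun k hk => ?_
  have : k ≤ N := by simpa [Nat.lt_succ_iff] using hk
  rw [show N + 1 - 1 - k = N - k by omega, e_symm v x y (by omega : N - k + k = N)]

/-- The `v ^ N`-commutator of the products over all copies. In one copy both products `x s * y s` and
`y s * x s` are combinations of the two root vectors, so both products over all copies are
combinations of the elements `e v x y k`; the `k = N` term cancels. -/
lemma commutator_prod (h : Copies v x y) :
    (List.ofFn y).prod * (List.ofFn x).prod -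
        (v ^ N)⁻¹ • ((List.ofFn x).prod * (List.ofFn y).prod) =
      ∑ k ∈ Finset.range N, (v ^ (N - k) - (v ^ (N - k))⁻¹) • e v x y k := by
  rw [h.prod_mul_prod, h.prod_mul_prod', Finset.smul_sum, ← Finset.sum_sub_distrib,
    Finset.sum_range_succ]
  have hv := h.ne_zero
  simp only [Nat.sub_self, pow_zero, smul_smul, ← sub_smul]
  rw [inv_mul_cancel₀ (pow_ne_zero _ hv), sub_self, zero_smul, add_zero]
  refine Finset.sum_congr rfl fun k hk => ?_
  have hk : k ≤ N := (Finset.mem_range.1 hk).le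
  congr 2
  rw [pow_sub₀ _ hv hk, mul_inv, inv_inv]

lemma map_e {A' : Type} [Ring A'] [Algebra K A'] (f : A →ₐ[K] A') (k : ℕ) :
    f (e v x y k) = e v (fun s => f (x s)) (fun s => f (y s)) k := by
  have := map_esym (f : A →+* A') (fun s => rootVec v (x s) (y s))
    (fun s => rootVec v (y s) (x s)) k
  simpa [e, map_rootVec] using this

/-- The PBW generators: the `x s`, then the root vectors `rootVec v (x s) (y s)`, then the `y s`. -/
def pbw (v : K) (x y : Fin N → A) : Fin (N + N + N) → A :=
  Fin.append (Fin.append x fun s => rootVec v (x s) (y s)) y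

lemma pbw_left (s : Fin N) : pbw v x y (Fin.castAdd N (Fin.castAdd N s)) = x s := by
  rw [pbw, Fin.append_left, Fin.append_left]

lemma pbw_mid (s : Fin N) :
    pbw v x y (Fin.castAdd N (Fin.natAdd N s)) = rootVec v (x s) (y s) := by
  rw [pbw, Fin.append_left, Fin.append_right]

lemma pbw_right (s : Fin N) : pbw v x y (Fin.natAdd (N + N) s) = y s := by
  rw [pbw, Fin.append_right]

/-- The hypothesis of `span_orderedMonomial_eq_adjoin` for the PBW generators. -/
lemma pbw_straighten (h : Copies v x y) (i j : Fin (N + N + N)) (hij : i < j) :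
    ∃ c : K, pbw v x y j * pbw v x y i - c • (pbw v x y i * pbw v x y j) ∈
      Submodule.span K (pbw v x y '' Set.Ioi i) := by
  have of_eq : ∀ c : K, pbw v x y j * pbw v x y i = c • (pbw v x y i * pbw v x y j) →
      ∃ c : K, pbw v x y j * pbw v x y i - c • (pbw v x y i * pbw v x y j) ∈
        Submodule.span K (pbw v x y '' Set.Ioi i) := fun c hc => ⟨c, by simp [hc]⟩
  have of_comm : Commute (pbw v x y j) (pbw v x y i) →
      ∃ c : K, pbw v x y j * pbw v x y i - c • (pbw v x y i * pbw v x y j) ∈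
        Submodule.span K (pbw v x y '' Set.Ioi i) := fun hc => of_eq 1 (by rw [one_smul, hc.eq])
  have hv := h.ne_zero
  induction i using Fin.addCases with
  | left i =>
    induction i using Fin.addCases with
    | left s =>
      induction j using Fin.addCases with
      | left j =>
        induction j using Fin.addCases with
        | left t => exact of_comm (by simpa only [pbw_left, pbw_mid, pbw_right] using h.comm_left t s)
        | right t =>
          rcases eq_or_ne s t with rfl | hst
          · exact of_eq v (by simpa only [pbw_left, pbw_mid, pbw_right] using (h.serre s).rootVec_mul hv)
          · exact of_comm (by simpa only [pbw_left, pbw_mid, pbw_right] using (h.comm_rootVec hst).symm)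
      | right t =>
        rcases eq_or_ne s t with rfl | hst
        · refine ⟨v⁻¹, ?_⟩
          have := rootVec_eq_iff h.sub_inv_ne_zero (x := x s) (y := y s)
          simp only [pbw_left, pbw_right]
          rw [this]
          refine Submodule.smul_mem _ _ (Submodule.subset_span
            ⟨Fin.castAdd N (Fin.natAdd N s), ?_, pbw_mid s⟩)
          simp [Fin.lt_def]
          omega
        · exact of_comm (by simpa only [pbw_left, pbw_mid, pbw_right] using (h.comm s t hst).symm)
    | right s =>
      induction j using Fin.addCases with
      | left j =>
        induction j using Fin.addCases with
        | left t =>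
          simp [Fin.lt_def] at hij
          omega
        | right t => exact of_comm (by simpa only [pbw_left, pbw_mid, pbw_right] using h.rootVec_comm t s)
      | right t =>
        rcases eq_or_ne s t with rfl | hst
        · exact of_eq v (by simpa only [pbw_left, pbw_mid, pbw_right] using (h.serre' s).mul_rootVec hv)
        · exact of_comm (by simpa only [pbw_left, pbw_mid, pbw_right] using h.comm_rootVec' hst.symm)
  | right s =>
    induction j using Fin.addCases with
    | left j =>
      simp [Fin.lt_def] at hij
      omega
    | right t => exact of_comm (by simpa only [pbw_left, pbw_mid, pbw_right] using h.comm_right t s)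

lemma span_pbw (h : Copies v x y)
    (htop : Algebra.adjoin K (Set.range x ∪ Set.range y) = ⊤) :
    Submodule.span K (Set.range (orderedMonomial (pbw v x y))) = ⊤ := by
  rw [span_orderedMonomial_eq_adjoin _ h.pbw_straighten, Algebra.toSubmodule_eq_top, eq_top_iff,
    ← htop]
  refine Algebra.adjoin_mono ?_
  rintro _ (⟨s, rfl⟩ | ⟨s, rfl⟩)
  · exact ⟨Fin.castAdd N (Fin.castAdd N s), pbw_left s⟩
  · exact ⟨Fin.natAdd (N + N) s, pbw_right s⟩

end Copies

end Copies

/-! ### A representation by weighted shift operators -/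

section ShiftOperators

variable {K : Type} [Field K]

/-- The exponents of a quantum torus with generators `y s`, `p s`, `p' s`; the coordinates of `p' s`,
`p s` and `y s` are indexed by `(0, s)`, `(1, s)` and `(2, s)`. In the lexicographic order the
exponents of the `p'` dominate. -/
def Expo (N : ℕ) : Type := Lex ((Fin 3 ×ₗ Fin N) → ℤ)

instance (N : ℕ) : AddCommGroup (Expo N) := inferInstanceAs (AddCommGroup (Lex _))

instance (N : ℕ) : LinearOrder (Expo N) := inferInstanceAs (LinearOrder (Lex (_ → _)))

instance (N : ℕ) : IsOrderedAddMonoid (Expo N) :=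
  inferInstanceAs (IsOrderedAddMonoid (Lex ((Fin 3 ×ₗ Fin N) → ℤ)))

/-- The exponent of a generator of the quantum torus. -/
def expo {N : ℕ} (c : Fin 3) (s : Fin N) : Expo N := toLex (Pi.single (toLex (c, s)) 1)

/-- The coordinate of an exponent. -/
def coord {N : ℕ} (c : Fin 3) (s : Fin N) : Expo N →+ ℤ where
  toFun m := (m : Lex ((Fin 3 ×ₗ Fin N) → ℤ)) (toLex (c, s))
  map_zero' := rfl
  map_add' _ _ := rfl

lemma coord_expo {N : ℕ} (c d : Fin 3) (s t : Fin N) :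
    coord c s (expo d t) = if c = d ∧ s = t then 1 else 0 := by
  change (Pi.single (toLex (d, t)) 1 : (Fin 3 ×ₗ Fin N) → ℤ) (toLex (c, s)) = _
  rw [Pi.single_apply]
  simp [Prod.ext_iff]

lemma Expo.lt_of_coord {N : ℕ} {m m' : Expo N} (s : Fin N)
    (h : ∀ t < s, coord 0 t m = coord 0 t m') (hs : coord 0 s m < coord 0 s m') : m < m' := by
  refine ⟨toLex (0, s), fun j hj => ?_, hs⟩
  obtain ⟨⟨c, t⟩, rfl⟩ := toLex.surjective j
  rcases (Prod.Lex.toLex_lt_toLex.1 hj) with h' | ⟨h', ht⟩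
  · exact absurd h' (by simp)
  · simp only at h'
    subst h'
    exact h t ht

/-- The operator mapping the basis vector of exponent `m` to `φ m` times that of exponent
`m + a`. -/
def shiftOp {N : ℕ} (a : Expo N) (φ : Expo N → K) : Module.End K (Expo N →₀ K) :=
  Finsupp.linearCombination K fun m => Finsupp.single (m + a) (φ m)

variable {N : ℕ}

lemma shiftOp_single (a : Expo N) (φ : Expo N → K) (m : Expo N) :
    shiftOp a φ (Finsupp.single m 1) = Finsupp.single (m + a) (φ m) := by
  simp [shiftOp]

lemma shiftOp_mul (a b : Expo N) (φ ψ : Expo N → K) :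
    shiftOp a φ * shiftOp b ψ = shiftOp (a + b) fun m => ψ m * φ (m + b) := by
  refine Finsupp.lhom_ext' fun m => LinearMap.ext_ring ?_
  simp only [LinearMap.comp_apply, Finsupp.lsingle_apply, Module.End.mul_apply, shiftOp_single]
  rw [← mul_one (ψ m), ← smul_eq_mul, ← Finsupp.smul_single, map_smul, shiftOp_single,
    Finsupp.smul_single, smul_eq_mul, smul_eq_mul, mul_one, add_comm a b, add_assoc]

lemma shiftOp_smul (c : K) (a : Expo N) (φ : Expo N → K) :
    c • shiftOp a φ = shiftOp a fun m => c * φ m := by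
  refine Finsupp.lhom_ext' fun m => LinearMap.ext_ring ?_
  simp [shiftOp_single]

lemma shiftOp_mul_eq_smul {a b : Expo N} {φ ψ : Expo N → K} {c : K}
    (h : ∀ m, ψ m * φ (m + b) = c * (φ m * ψ (m + a))) :
    shiftOp a φ * shiftOp b ψ = c • (shiftOp b ψ * shiftOp a φ) := by
  rw [shiftOp_mul, shiftOp_mul, shiftOp_smul, add_comm b a]
  exact congrArg _ (funext h)

lemma shiftOp_commute {a b : Expo N} {φ ψ : Expo N → K} (h : ∀ m, φ (m + b) = φ m)
    (h' : ∀ m, ψ (m + a) = ψ m) : Commute (shiftOp a φ) (shiftOp b ψ) := by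
  have := shiftOp_mul_eq_smul (a := a) (b := b) (φ := φ) (ψ := ψ) (c := 1)
    (fun m => by rw [h, h', one_mul, mul_comm])
  rwa [one_smul] at this

lemma hasLead_shiftOp (a : Expo N) {φ : Expo N → K} (hφ : ∀ m, φ m ≠ 0) :
    HasLead (shiftOp a φ) a := fun m => by
  rw [shiftOp_single]
  exact ⟨by simpa using hφ m, fun m' h => by simp [h.ne]⟩

/-- The image of `y s`. -/
def repY (K : Type) [Field K] {N : ℕ} (s : Fin N) : Module.End K (Expo N →₀ K) :=
  shiftOp (expo 2 s) fun _ => 1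

/-- The image of the root vector `p s`. -/
def repP (v : K) (s : Fin N) : Module.End K (Expo N →₀ K) :=
  shiftOp (expo 1 s) fun m => v ^ (-coord 2 s m)

/-- The image of the root vector `p' s`. -/
def repP' (v : K) (s : Fin N) : Module.End K (Expo N →₀ K) :=
  shiftOp (expo 0 s) fun m => v ^ coord 2 s m

/-- The image of `x s`, equal to `(p s + v p' s) (y s)⁻¹`. -/
def repX (v : K) (s : Fin N) : Module.End K (Expo N →₀ K) :=
  shiftOp (expo 0 s - expo 2 s) (fun m => v ^ coord 2 s m) +
    shiftOp (expo 1 s - expo 2 s) fun m => v ^ (1 - coord 2 s m)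

variable {v : K}

lemma repY_mul_repX (hv0 : v ≠ 0) (s : Fin N) :
    repY K s * repX v s = repP' v s + v • repP v s := by
  simp only [repX, repY, repP, repP', mul_add, shiftOp_mul, shiftOp_smul, add_sub_cancel]
  congr 1
  · simp
  · refine congrArg _ (funext fun m => ?_)
    rw [mul_one, sub_eq_add_neg, zpow_add₀ hv0, zpow_one]

lemma repX_mul_repY (hv0 : v ≠ 0) (s : Fin N) :
    repX v s * repY K s = v • repP' v s + repP v s := by
  simp only [repX, repY, repP, repP', add_mul, shiftOp_mul, shiftOp_smul, sub_add_cancel]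
  congr 1
  · refine congrArg _ (funext fun m => ?_)
    rw [one_mul, map_add, coord_expo, if_pos ⟨rfl, rfl⟩, zpow_add₀ hv0, zpow_one, mul_comm]
  · refine congrArg _ (funext fun m => ?_)
    rw [one_mul, map_add, coord_expo, if_pos ⟨rfl, rfl⟩]
    congr 1
    ring

lemma rootVec_rep (hv0 : v ≠ 0) (hv : v - v⁻¹ ≠ 0) (s : Fin N) :
    rootVec v (repX v s) (repY K s) = repP v s := by
  have := sq_sub_one_ne_zero hv0 hv
  rw [rootVec, repY_mul_repX hv0, repX_mul_repY hv0]
  match_scalars <;> field_simp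
  ring

lemma rootVec_rep' (hv0 : v ≠ 0) (hv : v - v⁻¹ ≠ 0) (s : Fin N) :
    rootVec v (repY K s) (repX v s) = repP' v s := by
  have := sq_sub_one_ne_zero hv0 hv
  rw [rootVec, repY_mul_repX hv0, repX_mul_repY hv0]
  match_scalars <;> field_simp
  ring

lemma repP_mul_repX (hv0 : v ≠ 0) (s : Fin N) :
    repP v s * repX v s = v • (repX v s * repP v s) := by
  rw [repX, mul_add, add_mul, smul_add]
  congr 1 <;> refine shiftOp_mul_eq_smul fun m => ?_
  all_goals
    simp only [map_add, map_sub, coord_expo, Fin.reduceEq, false_and, true_and, if_true, if_false]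
    simp only [zpow_add₀ hv0, zpow_sub₀ hv0, zpow_neg, zpow_one, add_zero, neg_add,
      zero_sub, inv_inv]
    have := zpow_ne_zero (coord 2 s m) hv0
    field_simp

lemma repY_mul_repP (hv0 : v ≠ 0) (s : Fin N) :
    repY K s * repP v s = v • (repP v s * repY K s) := by
  refine shiftOp_mul_eq_smul fun m => ?_
  simp only [map_add, coord_expo, true_and, if_true]
  simp only [zpow_add₀ hv0, zpow_neg, zpow_one, neg_add]
  field_simp

lemma serreRel_of_rootVec_mul {A : Type} [Ring A] [Algebra K A] {x y : A} (hv0 : v ≠ 0)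
    (hv : v - v⁻¹ ≠ 0) (h : rootVec v x y * x = v • (x * rootVec v x y)) : SerreRel v x y := by
  have := sq_sub_one_ne_zero hv0 hv
  unfold SerreRel
  simp only [rootVec] at h
  linear_combination (norm := skip) (v - v⁻¹) • h
  simp only [smul_mul_assoc, mul_smul_comm, sub_mul, mul_sub, mul_assoc, pow_two]
  match_scalars <;> field_simp <;> ring

lemma serreRel_of_mul_rootVec {A : Type} [Ring A] [Algebra K A] {x y : A} (hv0 : v ≠ 0)
    (hv : v - v⁻¹ ≠ 0) (h : y * rootVec v x y = v • (rootVec v x y * y)) : SerreRel v y x := by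
  have := sq_sub_one_ne_zero hv0 hv
  unfold SerreRel
  simp only [rootVec] at h
  linear_combination (norm := skip) (v - v⁻¹) • h
  simp only [smul_mul_assoc, mul_smul_comm, sub_mul, mul_sub, mul_assoc, pow_two]
  match_scalars <;> field_simp <;> ring

/-- The operators satisfy the relations of the Chevalley generators. -/
lemma copies_rep (hv0 : v ≠ 0) (hv : v - v⁻¹ ≠ 0) : Copies v (repX (N := N) v) (repY K) where
  ne_zero := hv0
  sub_inv_ne_zero := hv
  serre s := serreRel_of_rootVec_mul hv0 hv (by
    rw [rootVec_rep hv0 hv]; exact repP_mul_repX hv0 s)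
  serre' s := serreRel_of_mul_rootVec hv0 hv (by
    rw [rootVec_rep hv0 hv]; exact repY_mul_repP hv0 s)
  comm_left s t := by
    rcases eq_or_ne s t with rfl | hst
    · exact Commute.refl _
    · unfold repX
      refine ((shiftOp_commute ?_ ?_).add_right (shiftOp_commute ?_ ?_)).add_left
        ((shiftOp_commute ?_ ?_).add_right (shiftOp_commute ?_ ?_)) <;>
      simp [coord_expo, hst, hst.symm]
  comm_right s t := shiftOp_commute (fun _ => rfl) (fun _ => rfl)
  comm s t hst := by
    unfold repX repY
    refine (shiftOp_commute ?_ ?_).add_left (shiftOp_commute ?_ ?_) <;> simp [coord_expo, hst]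

lemma hasLead_repY (s : Fin N) : HasLead (repY K s) (expo 2 s) :=
  hasLead_shiftOp _ fun _ => one_ne_zero

lemma hasLead_repP (hv0 : v ≠ 0) (s : Fin N) : HasLead (repP v s) (expo 1 s) :=
  hasLead_shiftOp _ fun _ => zpow_ne_zero _ hv0

lemma hasLead_repP' (hv0 : v ≠ 0) (s : Fin N) : HasLead (repP' v s) (expo 0 s) :=
  hasLead_shiftOp _ fun _ => zpow_ne_zero _ hv0

lemma hasLead_repX (hv0 : v ≠ 0) (s : Fin N) : HasLead (repX v s) (expo 0 s - expo 2 s) := by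
  refine (hasLead_shiftOp _ fun _ => zpow_ne_zero _ hv0).add
    (hasLead_shiftOp _ fun _ => zpow_ne_zero _ hv0) (Expo.lt_of_coord s (fun t ht => ?_) ?_)
  · simp [coord_expo, ht.ne]
  · simp [coord_expo]

lemma hasLead_rep_e (hv0 : v ≠ 0) (hv : v - v⁻¹ ≠ 0) {k : ℕ} (hk : k ≤ N) :
    HasLead (Copies.e v (repX (N := N) v) (repY K) k)
      (∑ s : Fin N, if (s : ℕ) < k then expo 0 s else expo 1 s) := by
  refine HasLead.esym (fun s => ?_) (fun s => ?_) (fun s t hst => ?_) hk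
  · rw [rootVec_rep hv0 hv]; exact hasLead_repP hv0 s
  · rw [rootVec_rep' hv0 hv]; exact hasLead_repP' hv0 s
  · refine Expo.lt_of_coord s (fun u hu => ?_) ?_
    · simp [coord_expo, hu.ne, (hu.trans hst).ne]
    · simp [coord_expo, hst.ne]

/-- The leading exponents of the generators of PBW type. -/
def pbwLead (N : ℕ) : Fin (N + N + N) → Expo N :=
  Fin.append (Fin.append (fun s => expo 0 s - expo 2 s) (expo 1)) (expo 2)

lemma hasLead_rep_pbw (hv0 : v ≠ 0) (hv : v - v⁻¹ ≠ 0) (i : Fin (N + N + N)) :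
    HasLead (Copies.pbw v (repX v) (repY K) i) (pbwLead N i) := by
  induction i using Fin.addCases with
  | left i =>
    induction i using Fin.addCases with
    | left s => simpa only [Copies.pbw_left, pbwLead, Fin.append_left] using hasLead_repX hv0 s
    | right s =>
      simpa only [Copies.pbw_mid, pbwLead, Fin.append_left, Fin.append_right,
        rootVec_rep hv0 hv] using hasLead_repP hv0 s
  | right s => simpa only [Copies.pbw_right, pbwLead, Fin.append_right] using hasLead_repY s

lemma pbwLead_injective (N : ℕ) :
    Function.Injective fun a : Fin (N + N + N) → ℕ => ∑ i, a i • pbwLead N i := by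
  intro a b hab
  have hc : ∀ c t, coord c t (∑ i, a i • pbwLead N i) = coord c t (∑ i, b i • pbwLead N i) :=
    fun c t => congrArg (coord c t) hab
  simp only [map_sum, map_add, map_nsmul, Fin.sum_univ_add, pbwLead, Fin.append_left, Fin.append_right,
    map_sub, coord_expo] at hc
  have h0 : ∀ s : Fin N, a (Fin.castAdd N (Fin.castAdd N s)) = b (Fin.castAdd N (Fin.castAdd N s)) :=
    fun s => by simpa using hc 0 s
  have h1 : ∀ s : Fin N, a (Fin.castAdd N (Fin.natAdd N s)) = b (Fin.castAdd N (Fin.natAdd N s)) :=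
    fun s => by simpa [h0] using hc 1 s
  have h2 : ∀ s : Fin N, a (Fin.natAdd (N + N) s) = b (Fin.natAdd (N + N) s) :=
    fun s => by simpa [h0] using hc 2 s
  funext i
  induction i using Fin.addCases with
  | left i => induction i using Fin.addCases with
    | left s => exact h0 s
    | right s => exact h1 s
  | right s => exact h2 s

end ShiftOperators

/-! ### `U_v^+` of a power of `sl_3` -/

section A2Power

variable {I : Type} {C : Matrix I I ℤ} {v : Kq} {N : ℕ} {nd : Fin 2 × Fin N ≃ I}

/-- `C` is a symmetrized Cartan matrix of `N` copies of `sl_3`, with `q_i = v` for all nodes `i`; the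
node `nd (r, s)` is the node `r` of the copy `s`. -/
structure IsA2Power (C : Matrix I I ℤ) (v : Kq) {N : ℕ} (nd : Fin 2 × Fin N ≃ I) : Prop where
  ne_zero : v ≠ 0
  sub_inv_ne_zero : v - v⁻¹ ≠ 0
  add_inv_ne_zero : v + v⁻¹ ≠ 0
  qi_eq : ∀ i, qi C i = v
  cartan_eq : ∀ a b, cartan C (nd a) (nd b) = if a.2 = b.2 then if a.1 = b.1 then 2 else -1 else 0

lemma qInt_one {v : Kq} (hv : v - v⁻¹ ≠ 0) : qInt v 1 = 1 := by
  simp [qInt, div_self hv]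

lemma qInt_two {v : Kq} (hv : v - v⁻¹ ≠ 0) : qInt v 2 = v + v⁻¹ := by
  rw [qInt, div_eq_iff hv]
  ring

lemma qFact_zero {v : Kq} : qFact v 0 = 1 := by simp [qFact]

lemma qFact_one {v : Kq} (hv : v - v⁻¹ ≠ 0) : qFact v 1 = 1 := by simp [qFact, qInt_one hv]

lemma qFact_two {v : Kq} (hv : v - v⁻¹ ≠ 0) : qFact v 2 = v + v⁻¹ := by
  simp [qFact, Finset.prod_range_succ, qInt_one hv, qInt_two hv]

lemma serre_of_cartan_eq_zero {A : Type} [Ring A] [Algebra Kq A] {x : I → A} {i j : I}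
    (hv : qi C i - (qi C i)⁻¹ ≠ 0) (h : cartan C i j = 0) :
    serre C x i j = x j * x i - x i * x j := by
  simp [serre, h, Finset.sum_range_succ, qBinom, qFact_one hv, qFact_zero, sub_eq_add_neg]

lemma serre_of_cartan_eq_neg_one {A : Type} [Ring A] [Algebra Kq A] {x : I → A} {i j : I}
    (hv : qi C i - (qi C i)⁻¹ ≠ 0) (hv' : qi C i + (qi C i)⁻¹ ≠ 0) (h : cartan C i j = -1) :
    serre C x i j = x j * x i ^ 2 - (qi C i + (qi C i)⁻¹) • (x i * x j * x i) + x i ^ 2 * x j := by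
  have h2 : (1 - cartan C i j).toNat = 2 := by rw [h]; rfl
  rw [serre, h2]
  simp [Finset.sum_range_succ, qBinom, qFact_one hv, qFact_zero, qFact_two hv, hv',
    sub_eq_add_neg]
  rw [← neg_smul, neg_add, add_comm]

namespace IsA2Power

/-- The quantum Serre relations for `C` are the relations of `N` commuting copies of
`U_v^+(sl_3)`. -/
lemma serre_eq_zero_iff (hC : IsA2Power C v nd) {A : Type} [Ring A] [Algebra Kq A] {x : I → A}
    (r : Fin 2) : (∀ i j, i ≠ j → serre C x i j = 0) ↔
      Copies v (fun s => x (nd (r, s))) (fun s => x (nd (r.rev, s))) := by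
  have hv := hC.sub_inv_ne_zero
  have hv' := hC.add_inv_ne_zero
  have hrev : r ≠ r.rev := by fin_cases r <;> decide
  have h0 : ∀ a b, a.2 ≠ b.2 → (serre C x (nd a) (nd b) = 0 ↔ Commute (x (nd a)) (x (nd b))) := by
    intro a b hab
    rw [serre_of_cartan_eq_zero (by rwa [hC.qi_eq]) (by rw [hC.cartan_eq, if_neg hab]), sub_eq_zero]
    exact ⟨fun h => h.symm, fun h => h.eq.symm⟩
  have h1 : ∀ a b, a.2 = b.2 → a.1 ≠ b.1 →
      (serre C x (nd a) (nd b) = 0 ↔ SerreRel v (x (nd a)) (x (nd b))) := by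
    intro a b hab hab'
    rw [serre_of_cartan_eq_neg_one (by rwa [hC.qi_eq]) (by rwa [hC.qi_eq])
      (by rw [hC.cartan_eq, if_pos hab, if_neg hab']), hC.qi_eq, SerreRel]
  constructor
  · intro h
    have hc : ∀ a b, a.2 ≠ b.2 → Commute (x (nd a)) (x (nd b)) := fun a b hab =>
      (h0 a b hab).1 (h _ _ fun e => hab (by rw [nd.injective e]))
    refine ⟨hC.ne_zero, hv, fun s => ?_, fun s => ?_, fun s t => ?_, fun s t => ?_,
      fun s t hst => hc (r, s) (r.rev, t) hst⟩
    · have h2 := h (nd (r, s)) (nd (r.rev, s)) (by simpa using hrev)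
      exact (h1 (r, s) (r.rev, s) rfl hrev).1 h2
    · have h2 := h (nd (r.rev, s)) (nd (r, s)) (by simpa using hrev.symm)
      exact (h1 (r.rev, s) (r, s) rfl hrev.symm).1 h2
    · rcases eq_or_ne s t with rfl | hst
      · exact Commute.refl _
      · exact hc (r, s) (r, t) hst
    · rcases eq_or_ne s t with rfl | hst
      · exact Commute.refl _
      · exact hc (r.rev, s) (r.rev, t) hst
  · intro h i j hij
    obtain ⟨⟨a, s⟩, rfl⟩ := nd.surjective i
    obtain ⟨⟨b, t⟩, rfl⟩ := nd.surjective j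
    have hr : ∀ a : Fin 2, a = r ∨ a = r.rev := fun a => by
      fin_cases a <;> fin_cases r <;> decide
    rcases eq_or_ne s t with rfl | hst
    · have hab : a ≠ b := by rintro rfl; exact hij rfl
      rw [h1 (a, s) (b, s) rfl hab]
      rcases hr a with rfl | rfl <;> rcases hr b with rfl | rfl
      · exact absurd rfl hab
      · exact h.serre s
      · exact h.serre' s
      · exact absurd rfl hab
    · rw [h0 (a, s) (b, t) hst]
      rcases hr a with rfl | rfl <;> rcases hr b with rfl | rfl
      · exact h.comm_left s t
      · exact h.comm s t hst
      · exact (h.comm t s hst.symm).symm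
      · exact h.comm_right s t

/-- The Chevalley generators of `U_v^+`, in the order given by `r`. -/
lemma copies (hC : IsA2Power C v nd) (r : Fin 2) :
    Copies v (fun s => Uplus.E C (nd (r, s))) (fun s => Uplus.E C (nd (r.rev, s))) :=
  (hC.serre_eq_zero_iff r).1 (Uplus.serre_E C)

/-- The homomorphism from `U_v^+` given by copies of the generators of `U_v^+(sl_3)`. -/
lemma exists_lift (hC : IsA2Power C v nd) (r : Fin 2) {A : Type} [Ring A] [Algebra Kq A]
    {x y : Fin N → A} (h : Copies v x y) :
    ∃ f : Uplus C →ₐ[Kq] A, (∀ s, f (Uplus.E C (nd (r, s))) = x s) ∧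
      ∀ s, f (Uplus.E C (nd (r.rev, s))) = y s := by
  have hrev : r.rev ≠ r := by fin_cases r <;> decide
  let z : I → A := fun i => if (nd.symm i).1 = r then x (nd.symm i).2 else y (nd.symm i).2
  have hx : (fun s => z (nd (r, s))) = x := by funext s; simp [z]
  have hy : (fun s => z (nd (r.rev, s))) = y := by funext s; simp [z, hrev]
  have hz : ∀ i j, i ≠ j → serre C z i j = 0 :=
    (hC.serre_eq_zero_iff r).2 (by rwa [hx, hy])
  exact ⟨Uplus.lift C z hz, fun s => by rw [Uplus.lift_E]; exact congrFun hx s,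
    fun s => by rw [Uplus.lift_E]; exact congrFun hy s⟩

end IsA2Power

lemma Uplus.adjoin_E (C : Matrix I I ℤ) : Algebra.adjoin Kq (Set.range (Uplus.E C)) = ⊤ := by
  have hsurj : Function.Surjective (RingQuot.mkAlgHom Kq (UplusRel C)) :=
    RingQuot.mkAlgHom_surjective _ _
  have : Set.range (Uplus.E C) = RingQuot.mkAlgHom Kq (UplusRel C) '' Set.range (FreeAlgebra.ι Kq) := by
    rw [← Set.range_comp]; rfl
  rw [this]
  refine (AlgHom.map_adjoin (RingQuot.mkAlgHom Kq (UplusRel C)) _).symm.trans ?_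
  rw [FreeAlgebra.adjoin_range_ι, Algebra.map_top]
  exact (AlgHom.range_eq_top _).2 hsurj

namespace IsA2Power

lemma adjoin_copies (_hC : IsA2Power C v nd) (r : Fin 2) :
    Algebra.adjoin Kq (Set.range (fun s => Uplus.E C (nd (r, s))) ∪
      Set.range fun s => Uplus.E C (nd (r.rev, s))) = ⊤ := by
  rw [eq_top_iff, ← Uplus.adjoin_E C]
  refine Algebra.adjoin_mono ?_
  rintro _ ⟨i, rfl⟩
  obtain ⟨⟨a, s⟩, rfl⟩ := nd.surjective i
  have hr : a = r ∨ a = r.rev := by fin_cases a <;> fin_cases r <;> decide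
  rcases hr with rfl | rfl
  · exact Or.inl ⟨s, rfl⟩
  · exact Or.inr ⟨s, rfl⟩

/-- The representation of `U_v^+` by shift operators. -/
lemma exists_rep (hC : IsA2Power C v nd) (r : Fin 2) :
    ∃ ρ : Uplus C →ₐ[Kq] Module.End Kq (Expo N →₀ Kq),
      (fun s => ρ (Uplus.E C (nd (r, s)))) = repX v ∧
      (fun s => ρ (Uplus.E C (nd (r.rev, s)))) = repY Kq := by
  obtain ⟨ρ, h, h'⟩ := hC.exists_lift r (copies_rep (N := N) hC.ne_zero hC.sub_inv_ne_zero)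
  exact ⟨ρ, funext h, funext h'⟩

/-- The PBW generators of `U_v^+`, for the word starting with `r` in each copy. -/
def pbw (C : Matrix I I ℤ) (v : Kq) (nd : Fin 2 × Fin N ≃ I) (r : Fin 2) :
    Fin (N + N + N) → Uplus C :=
  Copies.pbw v (fun s => Uplus.E C (nd (r, s))) (fun s => Uplus.E C (nd (r.rev, s)))

lemma map_pbw {A : Type} [Ring A] [Algebra Kq A] (f : Uplus C →ₐ[Kq] A) (r : Fin 2)
    (i : Fin (N + N + N)) : f (pbw C v nd r i) =
      Copies.pbw v (fun s => f (Uplus.E C (nd (r, s)))) (fun s => f (Uplus.E C (nd (r.rev, s)))) i := by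
  induction i using Fin.addCases with
  | left i => induction i using Fin.addCases with
    | left s => simp only [pbw, Copies.pbw_left]
    | right s => simp only [pbw, Copies.pbw_mid, map_rootVec]
  | right s => simp only [pbw, Copies.pbw_right]

lemma hasLead_pbw {ρ : Uplus C →ₐ[Kq] Module.End Kq (Expo N →₀ Kq)} {r : Fin 2}
    (hC : IsA2Power C v nd) (hx : (fun s => ρ (Uplus.E C (nd (r, s)))) = repX v)
    (hy : (fun s => ρ (Uplus.E C (nd (r.rev, s)))) = repY Kq) (i : Fin (N + N + N)) :
    HasLead (ρ (pbw C v nd r i)) (pbwLead N i) := by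
  have h := map_pbw (A := Module.End Kq (Expo N →₀ Kq)) (v := v) (nd := nd) ρ r i
  rw [h, hx, hy]
  exact hasLead_rep_pbw hC.ne_zero hC.sub_inv_ne_zero i

/-- The PBW theorem for `U_v^+`: independence from the leading exponents, spanning by
straightening. -/
theorem isPBW (hC : IsA2Power C v nd) (r : Fin 2) : IsPBW Kq (pbw C v nd r) := by
  obtain ⟨ρ, hx, hy⟩ := hC.exists_rep r
  exact ⟨linearIndependent_of_hasLead ρ (hC.hasLead_pbw hx hy) (pbwLead_injective N),
    (hC.copies r).span_pbw (hC.adjoin_copies r)⟩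

lemma exists_hasLead (hC : IsA2Power C v nd) {r : Fin 2}
    {ρ : Uplus C →ₐ[Kq] Module.End Kq (Expo N →₀ Kq)}
    (hx : (fun s => ρ (Uplus.E C (nd (r, s)))) = repX v)
    (hy : (fun s => ρ (Uplus.E C (nd (r.rev, s)))) = repY Kq) {b : Uplus C} (hb : b ≠ 0) :
    ∃ m, HasLead (ρ b) m :=
  (hC.isPBW r).exists_hasLead ρ (hC.hasLead_pbw hx hy) (pbwLead_injective N) hb

/-- Every nonzero element acts by an operator with a leading exponent. -/
theorem isDomain (hC : IsA2Power C v nd) : IsDomain (Uplus C) := by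
  obtain ⟨ρ, hx, hy⟩ := hC.exists_rep 0
  have : Nontrivial (Uplus C) := ρ.toRingHom.domain_nontrivial
  exact isDomain_of_hasLead ρ fun b hb => hC.exists_hasLead hx hy hb

end IsA2Power

/-! ### The growth of `U_v^+` -/

/-- An exponent is determined by its coordinates. -/
def expoEquiv (N : ℕ) : ((Fin 3 ×ₗ Fin N) → ℤ) ≃ Expo N := toLex

/-- The exponents all of whose coordinates have absolute value at most `k`. -/
def expoBox (N k : ℕ) : Finset (Expo N) :=
  (Fintype.piFinset fun _ : Fin 3 ×ₗ Fin N => Finset.Icc (-(k : ℤ)) k).map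
    (expoEquiv N).toEmbedding

lemma mem_expoBox {k : ℕ} {m : Expo N} :
    m ∈ expoBox N k ↔ ∀ c s, |coord c s m| ≤ k := by
  rw [expoBox, Finset.mem_map_equiv, Fintype.mem_piFinset]
  simp only [Finset.mem_Icc, ← abs_le]
  exact ⟨fun h c s => h (toLex (c, s)), fun h j => h (ofLex j).1 (ofLex j).2⟩

lemma card_expoBox (k : ℕ) : (expoBox N k).card = (2 * k + 1) ^ (3 * N) := by
  rw [expoBox, Finset.card_map, Fintype.card_piFinset, Finset.prod_const, Int.card_Icc,
    Finset.card_univ]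
  congr 1
  · omega
  · change Fintype.card (Fin 3 × Fin N) = _
    simp

/-- `T` moves exponents by at most `d` in each coordinate. -/
def BoundedShift {K : Type} [Field K] (N d : ℕ) : Submodule K (Module.End K (Expo N →₀ K)) where
  carrier := {T | ∀ k, ∀ f ∈ Finsupp.supported K K (expoBox N k : Set (Expo N)),
    T f ∈ Finsupp.supported K K (expoBox N (k + d) : Set (Expo N))}
  zero_mem' _ _ _ := Submodule.zero_mem _
  add_mem' hS hT k f hf := Submodule.add_mem _ (hS k f hf) (hT k f hf)
  smul_mem' c _ hT k f hf := Submodule.smul_mem _ c (hT k f hf)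

lemma shiftOp_mem_boundedShift {K : Type} [Field K] {a : Expo N} (ha : ∀ c s, |coord c s a| ≤ 1)
    (φ : Expo N → K) : shiftOp a φ ∈ BoundedShift N 1 := by
  intro k f hf
  rw [shiftOp, Finsupp.linearCombination_apply]
  refine Submodule.sum_mem _ fun m hm => Submodule.smul_mem _ _ ?_
  refine Finsupp.single_mem_supported _ _ ?_
  have hm' := mem_expoBox.1 ((Finsupp.mem_supported _ _).1 hf hm)
  refine mem_expoBox.2 fun c s => ?_
  rw [map_add]
  push_cast
  exact (abs_add_le _ _).trans (add_le_add (hm' c s) (ha c s))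

namespace IsA2Power

/-- `U_v^+` has polynomial growth: a product of `d` generators moves exponents by at most `d`, and an
element is determined by its action on the basis vector of exponent `0`, so the products of at most
`d` generators span a space of dimension at most `(2 d + 1) ^ (3 N)`. -/
theorem nonempty_oreSet (hC : IsA2Power C v nd) :
    Nonempty (OreLocalization.OreSet (Uplus C)⁰) := by
  classical
  obtain ⟨ρ, hx, hy⟩ := hC.exists_rep 0
  have := hC.isDomain
  let G : Submodule Kq (Uplus C) := Submodule.span Kq (insert 1 (Set.range (Uplus.E C)))
  have h1 : (1 : Uplus C) ∈ G := Submodule.subset_span (Set.mem_insert _ _)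
  have hmono : ∀ {a b : ℕ}, a ≤ b → G ^ a ≤ G ^ b := fun h =>
    pow_le_pow_right₀ (Submodule.one_le.2 h1) h
  have hG : ∀ b, ∃ d, b ∈ G ^ d := by
    intro b
    have hb : b ∈ Algebra.adjoin Kq (Set.range (Uplus.E C)) := by rw [Uplus.adjoin_E]; trivial
    induction hb using Algebra.adjoin_induction with
    | mem b hb =>
      exact ⟨1, by rw [pow_one]; exact Submodule.subset_span (Set.mem_insert_of_mem _ hb)⟩
    | algebraMap c =>
      exact ⟨0, by rw [pow_zero]; exact Submodule.algebraMap_mem c⟩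
    | add a b _ _ iha ihb =>
      obtain ⟨d, hd⟩ := iha
      obtain ⟨d', hd'⟩ := ihb
      exact ⟨max d d', add_mem (hmono (le_max_left _ _) hd) (hmono (le_max_right _ _) hd')⟩
    | mul a b _ _ iha ihb =>
      obtain ⟨d, hd⟩ := iha
      obtain ⟨d', hd'⟩ := ihb
      exact ⟨d + d', by rw [pow_add]; exact Submodule.mul_mem_mul hd hd'⟩
  have hX : ∀ s, repX v s ∈ BoundedShift (K := Kq) N 1 := fun s => by
    refine add_mem (shiftOp_mem_boundedShift (fun c t => ?_) _)
      (shiftOp_mem_boundedShift (fun c t => ?_) _) <;>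
    · rw [map_sub, coord_expo, coord_expo]
      split_ifs <;> simp
  have hY : ∀ s, repY Kq s ∈ BoundedShift (K := Kq) N 1 := fun s => by
    refine shiftOp_mem_boundedShift (fun c t => ?_) _
    rw [coord_expo]
    split_ifs <;> simp
  have hGle : G ≤ (BoundedShift N 1).comap ρ.toLinearMap := by
    refine Submodule.span_le.2 ?_
    rintro _ (rfl | ⟨i, rfl⟩)
    · change ρ 1 ∈ BoundedShift N 1
      rw [map_one]
      intro k f hf
      refine Finsupp.supported_mono (fun m hm => ?_) hf
      exact mem_expoBox.2 fun c s => (mem_expoBox.1 hm c s).trans (by push_cast; linarith)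
    · obtain ⟨⟨a, s⟩, rfl⟩ := nd.surjective i
      change ρ _ ∈ BoundedShift N 1
      have hr : a = 0 ∨ a = Fin.rev 0 := by fin_cases a <;> decide
      rcases hr with rfl | rfl
      · rw [show ρ (Uplus.E C (nd (0, s))) = repX v s from congrFun hx s]
        exact hX s
      · rw [show ρ (Uplus.E C (nd (Fin.rev 0, s))) = repY Kq s from congrFun hy s]
        exact hY s
  have hpow : ∀ d : ℕ, G ^ d ≤ (BoundedShift N d).comap ρ.toLinearMap := by
    intro d
    induction d with
    | zero =>
      rw [pow_zero, Submodule.one_le]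
      change ρ 1 ∈ BoundedShift N 0
      rw [map_one]
      exact fun k f hf => hf
    | succ d ih =>
      rw [pow_succ, Submodule.mul_le]
      intro a ha b hb
      change ρ (a * b) ∈ BoundedShift N (d + 1)
      rw [map_mul]
      intro k f hf
      have := ih ha _ _ (hGle hb k f hf)
      rwa [add_assoc, add_comm 1 d] at this
  let ev : Uplus C →ₗ[Kq] (Expo N →₀ Kq) :=
    (LinearMap.applyₗ (Finsupp.single 0 1)).comp ρ.toLinearMap
  have hev : Function.Injective ev := by
    rw [← LinearMap.ker_eq_bot, LinearMap.ker_eq_bot']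
    intro b hb
    by_contra hb0
    obtain ⟨m, hm⟩ := hC.exists_hasLead hx hy hb0
    exact hm.apply_ne_zero hb
  have hmem : ∀ d : ℕ, ∀ b : ↥(G ^ d),
      ev.domRestrict (G ^ d) b ∈ Finsupp.supported Kq Kq (expoBox N d : Set (Expo N)) := by
    intro d b
    have h0 : Finsupp.single (0 : Expo N) (1 : Kq) ∈
        Finsupp.supported Kq Kq (expoBox N 0 : Set (Expo N)) :=
      Finsupp.single_mem_supported _ _ (mem_expoBox.2 fun c s => by simp)
    have := hpow d b.2 0 _ h0
    rwa [zero_add] at this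
  have hinj : ∀ d : ℕ, Function.Injective ((ev.domRestrict (G ^ d)).codRestrict _ (hmem d)) := by
    intro d a b hab
    exact Subtype.ext (hev (congrArg Subtype.val hab))
  have hsupp : ∀ d : ℕ, Finsupp.supported Kq Kq (expoBox N d : Set (Expo N)) =
      Submodule.span Kq ((expoBox N d).image fun m => Finsupp.single m (1 : Kq) : Finset _) := by
    intro d
    rw [Finsupp.supported_eq_span_single, Finset.coe_image]
  have hfin : ∀ d : ℕ, FiniteDimensional Kq
      ↥(Finsupp.supported Kq Kq (expoBox N d : Set (Expo N))) := by
    intro d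
    rw [hsupp]
    exact FiniteDimensional.span_finset _ _
  have : ∀ d : ℕ, FiniteDimensional Kq ↥(G ^ d) := fun d =>
    FiniteDimensional.of_injective _ (hinj d)
  refine nonempty_oreSet_of_growth G h1 hG (D := 3 * N) fun d => ?_
  refine (LinearMap.finrank_le_finrank_of_injective (hinj d)).trans ?_
  rw [hsupp, ← card_expoBox]
  exact (finrank_span_finset_le_card _).trans Finset.card_image_le

end IsA2Power

end A2Power

/-! ### Powers of `q` -/

lemma q_ne_zero : q ≠ 0 := RatFunc.X_ne_zero

lemma q_pow_ne_one {m : ℕ} (hm : m ≠ 0) : q ^ m ≠ 1 := by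
  intro h
  have h' : algebraMap (Polynomial ℂ) (RatFunc ℂ) (Polynomial.X ^ m) = algebraMap _ _ 1 := by
    rw [map_pow, RatFunc.algebraMap_X, map_one]; exact h
  have h'' := congrArg Polynomial.natDegree (RatFunc.algebraMap_injective ℂ h')
  simp [hm] at h''

lemma q_pow_sub_inv_ne_zero {m : ℕ} (hm : m ≠ 0) : q ^ m - (q ^ m)⁻¹ ≠ 0 := by
  intro h
  have hq := pow_ne_zero m q_ne_zero
  refine q_pow_ne_one (m := m + m) (by omega) ?_
  rw [sub_eq_zero] at h
  rw [pow_add]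
  nth_rewrite 1 [h]
  exact inv_mul_cancel₀ hq

lemma q_sub_inv_ne_zero : q - q⁻¹ ≠ 0 := by
  simpa using q_pow_sub_inv_ne_zero one_ne_zero

lemma q_pow_add_inv_ne_zero {m : ℕ} (hm : m ≠ 0) : q ^ m + (q ^ m)⁻¹ ≠ 0 := by
  intro h
  have hq := pow_ne_zero m q_ne_zero
  refine q_pow_ne_one (m := (m + m) + (m + m)) (by omega) ?_
  have h2 : q ^ (m + m) = -1 := by
    rw [pow_add]
    nth_rewrite 1 [eq_neg_of_add_eq_zero_left h]
    rw [neg_mul, inv_mul_cancel₀ hq]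
  rw [pow_add, h2]
  ring

/-! ### Serre-like relations and straightening -/

section SerreLike

variable {K A : Type} [Field K] [Ring A] [Algebra K A]

/-- The Serre-like relation between `a` and `b` says that the `Q`-commutator of `a` and `b`, corrected
by `D`, `Q`-commutes with `a`. -/
lemma mul_commutator_iff {a b D F : A} {Q : K} (hQ : Q ≠ 0)
    (h : a * D - Q • (D * a) = a * F) :
    a * (a * b - Q⁻¹ • (b * a) - D) = Q • ((a * b - Q⁻¹ • (b * a) - D) * a) ↔
      a ^ 2 * b - (Q + Q⁻¹) • (a * b * a) + b * a ^ 2 = a * F := by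
  have key : a * (a * b - Q⁻¹ • (b * a) - D) - Q • ((a * b - Q⁻¹ • (b * a) - D) * a) =
      (a ^ 2 * b - (Q + Q⁻¹) • (a * b * a) + b * a ^ 2) - (a * D - Q • (D * a)) := by
    simp only [smul_mul_assoc, mul_smul_comm, sub_mul, mul_sub, mul_assoc, pow_two]
    match_scalars <;> field_simp
    ring
  rw [← sub_eq_zero, key, h, sub_eq_zero]

lemma mul_commutator_iff' {a b D G : A} {Q : K} (hQ : Q ≠ 0)
    (h : b * D - Q⁻¹ • (D * b) = -(Q⁻¹ • (b * G))) :
    b * (a * b - Q⁻¹ • (b * a) - D) = Q⁻¹ • ((a * b - Q⁻¹ • (b * a) - D) * b) ↔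
      b ^ 2 * a - (Q + Q⁻¹) • (b * a * b) + a * b ^ 2 = b * G := by
  have key : b * (a * b - Q⁻¹ • (b * a) - D) - Q⁻¹ • ((a * b - Q⁻¹ • (b * a) - D) * b) =
      -(Q⁻¹ • (b ^ 2 * a - (Q + Q⁻¹) • (b * a * b) + a * b ^ 2))
        - (b * D - Q⁻¹ • (D * b)) := by
    simp only [smul_mul_assoc, mul_smul_comm, sub_mul, mul_sub, mul_assoc, pow_two]
    match_scalars <;> field_simp
    ring
  rw [← sub_eq_zero, key, h, sub_neg_eq_add, ← smul_neg, ← smul_add, smul_eq_zero_iff_right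
    (inv_ne_zero hQ), neg_add_eq_zero]

lemma commute_commutator {a b D z : A} {Q l : K} (hl : l ≠ 0) (ha : a * z = l • (z * a))
    (hb : b * z = l⁻¹ • (z * b)) (hD : Commute D z) :
    Commute (a * b - Q⁻¹ • (b * a) - D) z := by
  have h1 : a * b * z = z * (a * b) := by
    rw [mul_assoc, hb, mul_smul_comm, ← mul_assoc, ha, smul_mul_assoc, smul_smul,
      inv_mul_cancel₀ hl, one_smul, mul_assoc]
  have h2 : b * a * z = z * (b * a) := by
    rw [mul_assoc, ha, mul_smul_comm, ← mul_assoc, hb, smul_mul_assoc, smul_smul,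
      mul_inv_cancel₀ hl, one_smul, mul_assoc]
  refine Commute.sub_left (Commute.sub_left h1 ?_) hD
  exact Commute.smul_left h2 _

end SerreLike

lemma zIndex_zIndex {n : ℕ} (k : Fin (n - 1)) (i : Fin 2) : zIndex (zIndex k i) i = k := by
  unfold zIndex
  split_ifs <;> simp

lemma zIndex_rev {n : ℕ} (k : Fin (n - 1)) (i : Fin 2) : zIndex k.rev i = zIndex k i.rev := by
  fin_cases i
  · rfl
  · exact Fin.rev_rev k

lemma val_rev_add_one {n : ℕ} (k : Fin (n - 1)) : (k.rev : ℕ) + 1 = n - ((k : ℕ) + 1) := by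
  have := k.2
  rw [Fin.val_rev]
  omega

section ZFamily

variable {A : Type} [Ring A] [Algebra Kq A] {n : ℕ}

/-- The correction term `∑ [k]⁻¹ z_{k,i}` of the commutator of `u_i` and `u_j`. -/
def zCorr (z : Fin (n - 1) → A) (i : Fin 2) : A :=
  ∑ k : Fin (n - 1), (qInt q ((k : ℕ) + 1))⁻¹ • z (zIndex k i)

/-- The sum `∑ q ^ k z_{k,i}` on the right-hand side of the Serre-like relation. -/
def zSerre (z : Fin (n - 1) → A) (i : Fin 2) : A :=
  ∑ k : Fin (n - 1), q ^ ((k : ℕ) + 1) • z (zIndex k i)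

/-- The relations of `AAlg` for a pair of generators `u` and a family `z`, except for the
Serre-like ones. -/
structure ZFamily (u : Fin 2 → A) (z : Fin (n - 1) → A) : Prop where
  z_z : ∀ k l, Commute (z k) (z l)
  u_z : ∀ i k, u i * z (zIndex k i) = q ^ ((n : ℤ) - 2 * ((k : ℤ) + 1)) • (z (zIndex k i) * u i)

/-- `u_i u_j - q^{-n} u_j u_i - ∑ [k]⁻¹ z_{k,i}`. -/
def uComm (u : Fin 2 → A) (z : Fin (n - 1) → A) (i : Fin 2) : A :=
  u i * u i.rev - (q ^ n)⁻¹ • (u i.rev * u i) - zCorr z i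

variable {u : Fin 2 → A} {z : Fin (n - 1) → A}

namespace ZFamily

lemma u_z' (h : ZFamily u z) (i : Fin 2) (k : Fin (n - 1)) :
    u i.rev * z (zIndex k i) =
      (q ^ ((n : ℤ) - 2 * ((k : ℤ) + 1)))⁻¹ • (z (zIndex k i) * u i.rev) := by
  have hk := h.u_z i.rev k.rev
  rw [zIndex_rev, Fin.rev_rev] at hk
  rw [hk, ← zpow_neg]
  congr 2
  have h1 := val_rev_add_one k
  have h2 := k.2
  omega

lemma mul_zCorr (h : ZFamily u z) (i : Fin 2) :
    u i * zCorr z i - q ^ n • (zCorr z i * u i) = u i * ((q⁻¹ - q) • zSerre z i) := by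
  have hq := q_ne_zero
  rw [zCorr, zSerre, Finset.smul_sum, Finset.mul_sum, Finset.mul_sum, Finset.sum_mul,
    Finset.smul_sum, ← Finset.sum_sub_distrib]
  refine Finset.sum_congr rfl fun k _ => ?_
  have h1 := q_pow_sub_inv_ne_zero (m := (k : ℕ) + 1) (by omega)
  rw [mul_smul_comm, mul_smul_comm, mul_smul_comm, smul_mul_assoc, h.u_z, smul_smul, smul_smul,
    smul_smul, smul_smul, ← sub_smul]
  congr 1
  rw [qInt, inv_div]
  have e : q ^ ((n : ℤ) - 2 * ((k : ℤ) + 1)) = q ^ n * ((q ^ ((k : ℕ) + 1)) ^ 2)⁻¹ := by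
    rw [zpow_sub₀ hq, zpow_natCast, ← pow_mul, ← zpow_natCast q (((k : ℕ) + 1) * 2), div_eq_mul_inv]
    congr 3
    push_cast; ring
  rw [e]
  have hK := pow_ne_zero ((k : ℕ) + 1) hq
  generalize q ^ ((k : ℕ) + 1) = x at *
  have h1' := sq_sub_one_ne_zero hK h1
  field_simp
  ring

lemma mul_zCorr' (h : ZFamily u z) (i : Fin 2) :
    u i.rev * zCorr z i - (q ^ n)⁻¹ • (zCorr z i * u i.rev) =
      -((q ^ n)⁻¹ • (u i.rev * ((q⁻¹ - q) • zSerre z i.rev))) := by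
  have hq := q_ne_zero
  have hs : zSerre z i.rev = ∑ k : Fin (n - 1), q ^ (n - ((k : ℕ) + 1)) • z (zIndex k i) := by
    rw [zSerre, ← Equiv.sum_comp Fin.revPerm]
    refine Finset.sum_congr rfl fun k _ => ?_
    rw [Fin.revPerm_apply, val_rev_add_one, zIndex_rev, Fin.rev_rev]
  rw [hs, zCorr, Finset.smul_sum, Finset.mul_sum, Finset.mul_sum, Finset.sum_mul,
    Finset.smul_sum, Finset.smul_sum, ← Finset.sum_sub_distrib, ← Finset.sum_neg_distrib]
  refine Finset.sum_congr rfl fun k _ => ?_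
  have h1 := q_pow_sub_inv_ne_zero (m := (k : ℕ) + 1) (by omega)
  rw [mul_smul_comm, mul_smul_comm, mul_smul_comm, smul_mul_assoc, h.u_z', smul_smul, smul_smul,
    smul_smul, smul_smul, smul_smul, ← sub_smul, ← neg_smul]
  congr 1
  rw [qInt, inv_div]
  have e : q ^ ((n : ℤ) - 2 * ((k : ℤ) + 1)) = q ^ n * ((q ^ ((k : ℕ) + 1)) ^ 2)⁻¹ := by
    rw [zpow_sub₀ hq, zpow_natCast, ← pow_mul, ← zpow_natCast q (((k : ℕ) + 1) * 2), div_eq_mul_inv]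
    congr 3
    push_cast; ring
  have hk : (k : ℕ) + 1 ≤ n := by have := k.2; omega
  rw [e, pow_sub₀ _ hq hk]
  have hK := pow_ne_zero ((k : ℕ) + 1) hq
  have hN := pow_ne_zero n hq
  generalize q ^ ((k : ℕ) + 1) = x at *
  generalize q ^ n = y at *
  have h1' := sq_sub_one_ne_zero hK h1
  field_simp
  ring

lemma serre_iff (h : ZFamily u z) (i : Fin 2) :
    u i * uComm u z i = q ^ n • (uComm u z i * u i) ↔
      u i ^ 2 * u i.rev - (q ^ n + (q ^ n)⁻¹) • (u i * u i.rev * u i) + u i.rev * u i ^ 2 =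
        (q⁻¹ - q) • (u i * zSerre z i) := by
  rw [← mul_smul_comm (q⁻¹ - q)]
  exact mul_commutator_iff (pow_ne_zero _ q_ne_zero) (h.mul_zCorr i)

lemma serre_iff' (h : ZFamily u z) (i : Fin 2) :
    u i.rev * uComm u z i = (q ^ n)⁻¹ • (uComm u z i * u i.rev) ↔
      u i.rev ^ 2 * u i - (q ^ n + (q ^ n)⁻¹) • (u i.rev * u i * u i.rev) + u i * u i.rev ^ 2 =
        (q⁻¹ - q) • (u i.rev * zSerre z i.rev) := by
  rw [← mul_smul_comm (q⁻¹ - q)]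
  exact mul_commutator_iff' (pow_ne_zero _ q_ne_zero) (h.mul_zCorr' i)

lemma commute_uComm (h : ZFamily u z) (i : Fin 2) (k : Fin (n - 1)) :
    Commute (uComm u z i) (z k) := by
  rw [← zIndex_zIndex k i]
  refine commute_commutator (zpow_ne_zero _ q_ne_zero) (h.u_z i _) (h.u_z' i _) ?_
  exact Commute.sum_left _ _ _ fun l _ => (h.z_z _ _).smul_left _

end ZFamily

end ZFamily

/-! ### The two presentations of the algebra -/

namespace AAlg

variable (n : ℕ)

lemma zFamily : ZFamily (AAlg.u n) (AAlg.z n) where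
  z_z k l := by
    have h := RingQuot.mkAlgHom_rel Kq (ARel.z_z (n := n) k l)
    simp only [map_mul] at h
    exact h
  u_z i k := by
    have h := RingQuot.mkAlgHom_rel Kq (ARel.u_z (n := n) i k)
    simp only [map_mul, map_smul] at h
    exact h

lemma uu_eq (i : Fin 2) : AAlg.uu n i = uComm (AAlg.u n) (AAlg.z n) i := rfl

lemma serre (i : Fin 2) :
    u n i ^ 2 * u n i.rev - (q ^ n + (q ^ n)⁻¹) • (u n i * u n i.rev * u n i)
      + u n i.rev * u n i ^ 2 = (q⁻¹ - q) • (u n i * zSerre (z n) i) := by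
  have h := RingQuot.mkAlgHom_rel Kq (ARel.serre (n := n) i i.rev (by fin_cases i <;> decide))
  simp only [map_add, map_sub, map_mul, map_smul, map_pow, map_sum] at h
  exact h

lemma u_mul_uu (i : Fin 2) : u n i * uu n i = q ^ n • (uu n i * u n i) :=
  ((zFamily n).serre_iff i).2 (serre n i)

lemma u_rev_mul_uu (i : Fin 2) : u n i.rev * uu n i = (q ^ n)⁻¹ • (uu n i * u n i.rev) :=
  ((zFamily n).serre_iff' i).2 (by simpa using serre n i.rev)

lemma commute_uu_z (i : Fin 2) (k : Fin (n - 1)) : Commute (uu n i) (z n k) :=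
  (zFamily n).commute_uComm i k

variable {n}

/-- The universal property. -/
lemma exists_lift {A : Type} [Ring A] [Algebra Kq A] {u : Fin 2 → A} {z : Fin (n - 1) → A}
    (h : ZFamily u z) (hs : ∀ i, u i * uComm u z i = q ^ n • (uComm u z i * u i)) :
    ∃ f : AAlg n →ₐ[Kq] A, (∀ i, f (AAlg.u n i) = u i) ∧ ∀ k, f (AAlg.z n k) = z k := by
  let g : AGen n → A := fun x => match x with
    | .u i => u i
    | .z k => z k
  have hg : ∀ ⦃a b⦄, ARel n a b → FreeAlgebra.lift Kq g a = FreeAlgebra.lift Kq g b := by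
    intro a b hab
    induction hab with
    | z_z k l => simpa [fz, g] using (h.z_z k l).eq
    | u_z i k => simpa [fz, fu, g] using h.u_z i k
    | serre i j hij =>
      obtain rfl : j = i.rev := by
        revert hij
        fin_cases i <;> fin_cases j <;> decide
      have := (h.serre_iff i).1 (hs i)
      simp only [map_add, map_sub, map_mul, map_smul, map_pow, map_sum, fu, fz,
        FreeAlgebra.lift_ι_apply]
      exact this
  refine ⟨RingQuot.liftAlgHom Kq ⟨FreeAlgebra.lift Kq g, hg⟩, fun i => ?_, fun k => ?_⟩
  · exact (RingQuot.liftAlgHom_mkAlgHom_apply (S := Kq) (s := ARel n) _ hg (fu n i)).trans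
      (by rw [fu, FreeAlgebra.lift_ι_apply])
  · exact (RingQuot.liftAlgHom_mkAlgHom_apply (S := Kq) (s := ARel n) _ hg (fz n k)).trans
      (by rw [fz, FreeAlgebra.lift_ι_apply])

lemma algHom_ext {A : Type} [Ring A] [Algebra Kq A] {f g : AAlg n →ₐ[Kq] A}
    (hu : ∀ i, f (u n i) = g (u n i)) (hz : ∀ k, f (z n k) = g (z n k)) : f = g := by
  refine RingQuot.ringQuot_ext' (S := Kq) (s := ARel n) f g (FreeAlgebra.hom_ext (funext fun x => ?_))
  cases x with
  | u i => exact hu i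
  | z k => exact hz k

end AAlg

namespace PAlg

variable {n : ℕ}

lemma algHom_ext {A : Type} [Ring A] [Algebra Kq A] {f g : PAlg n →ₐ[Kq] A}
    (h : ∀ x, f (gen n x) = g (gen n x)) : f = g :=
  RingQuot.ringQuot_ext' (S := Kq) (s := PRel n) f g (FreeAlgebra.hom_ext (funext h))

lemma exists_lift {A : Type} [Ring A] [Algebra Kq A] {u : Fin 2 → A} {z : Fin (n - 1) → A}
    (h : ZFamily u z) (hs : ∀ i, u i * uComm u z i = q ^ n • (uComm u z i * u i)) :
    ∃ f : PAlg n →ₐ[Kq] A, f (gen n .u2) = u 1 ∧ f (gen n .u21) = uComm u z 0 ∧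
      f (gen n .u1) = u 0 ∧ ∀ k, f (gen n (.z k)) = z k := by
  let g : PGen n → A := fun x => match x with
    | .u2 => u 1
    | .u21 => uComm u z 0
    | .u1 => u 0
    | .z k => z k
  have hg : ∀ ⦃a b⦄, PRel n a b → FreeAlgebra.lift Kq g a = FreeAlgebra.lift Kq g b := by
    intro a b hab
    induction hab with
    | z_z k l => simpa [fp, g] using (h.z_z k l).eq
    | u1_u21 => simpa [fp, g] using hs 0
    | u2_u21 =>
      have h2 := (h.serre_iff' 0).2 ((h.serre_iff 1).1 (hs 1))
      simpa [fp, g] using h2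
    | u1_z k => simpa [fp, g, zIndex] using h.u_z 0 k
    | u2_z k =>
      have h2 := h.u_z' 0 k
      rw [← zpow_neg, neg_sub] at h2
      simpa [fp, g, zIndex] using h2
    | u21_z k => simpa [fp, g] using (h.commute_uComm 0 k).eq
    | u1_u2 =>
      simp only [map_add, map_mul, map_smul, map_sum, fp, FreeAlgebra.lift_ι_apply, g, uComm, zCorr,
        qInt, inv_div]
      have : ∀ k : Fin (n - 1), zIndex k 0 = k := fun k => rfl
      simp only [this, show Fin.rev (0 : Fin 2) = 1 from rfl]
      abel
  refine ⟨RingQuot.liftAlgHom Kq ⟨FreeAlgebra.lift Kq g, hg⟩, ?_, ?_, ?_, fun k => ?_⟩ <;>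
  · refine (RingQuot.liftAlgHom_mkAlgHom_apply (S := Kq) (s := PRel n) _ hg (fp n _)).trans ?_
    rw [fp, FreeAlgebra.lift_ι_apply]

variable (n) in
/-- The generators `u_1`, `u_2` of `AAlg`, in `PAlg`. -/
def uFun : Fin 2 → PAlg n := ![gen n .u1, gen n .u2]

variable (n) in
lemma zFamily : ZFamily (uFun n) (fun k => gen n (.z k)) where
  z_z k l := by
    have h := RingQuot.mkAlgHom_rel Kq (PRel.z_z (n := n) k l)
    simp only [map_mul] at h
    exact h
  u_z i k := by
    fin_cases i
    · have h := RingQuot.mkAlgHom_rel Kq (PRel.u1_z (n := n) k)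
      simp only [map_mul, map_smul] at h
      exact h
    · have h := RingQuot.mkAlgHom_rel Kq (PRel.u2_z (n := n) k.rev)
      simp only [map_mul, map_smul] at h
      have e : 2 * (((k.rev : Fin (n - 1)) : ℤ) + 1) - (n : ℤ) = (n : ℤ) - 2 * ((k : ℤ) + 1) := by
        have h1 := val_rev_add_one k
        have h2 := k.2
        omega
      rw [e] at h
      exact h

variable (n) in
lemma uComm_zero : uComm (uFun n) (fun k => gen n (.z k)) 0 = gen n .u21 := by
  have h := RingQuot.mkAlgHom_rel Kq (PRel.u1_u2 (n := n))
  simp only [map_mul, map_smul, map_add, map_sum] at h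
  have h' : gen n .u1 * gen n .u2 = (q ^ n)⁻¹ • (gen n .u2 * gen n .u1) + gen n .u21 +
      ∑ k : Fin (n - 1), ((q - q⁻¹) / (q ^ ((k : ℕ) + 1) - (q ^ ((k : ℕ) + 1))⁻¹)) •
        gen n (.z k) := h
  have e : zCorr (fun k => gen n (.z k)) 0 = ∑ k : Fin (n - 1),
      ((q - q⁻¹) / (q ^ ((k : ℕ) + 1) - (q ^ ((k : ℕ) + 1))⁻¹)) • gen n (.z k) := by
    simp only [zCorr, qInt, inv_div]
    rfl
  rw [uComm, e]
  change gen n .u1 * gen n .u2 - (q ^ n)⁻¹ • (gen n .u2 * gen n .u1) - _ = _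
  rw [h']
  abel

variable (n) in
lemma uFun_mul_uComm (i : Fin 2) : uFun n i * uComm (uFun n) (fun k => gen n (.z k)) i =
    q ^ n • (uComm (uFun n) (fun k => gen n (.z k)) i * uFun n i) := by
  fin_cases i
  · have h := RingQuot.mkAlgHom_rel Kq (PRel.u1_u21 (n := n))
    simp only [map_mul, map_smul] at h
    change uFun n 0 * uComm _ _ 0 = q ^ n • (uComm _ _ 0 * uFun n 0)
    rw [uComm_zero]
    exact h
  · have h := RingQuot.mkAlgHom_rel Kq (PRel.u2_u21 (n := n))
    simp only [map_mul, map_smul] at h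
    refine ((zFamily n).serre_iff 1).2 (((zFamily n).serre_iff' 0).1 ?_)
    rw [uComm_zero]
    exact h

end PAlg

/-- The isomorphism between the Serre-like and the PBW-type presentation. -/
theorem exists_presentation_equiv (n : ℕ) :
    ∃ f : PAlg n ≃ₐ[Kq] AAlg n,
      f (PAlg.gen n .u2) = AAlg.u n 1 ∧ f (PAlg.gen n .u21) = AAlg.uu n 0 ∧
      f (PAlg.gen n .u1) = AAlg.u n 0 ∧ ∀ k, f (PAlg.gen n (.z k)) = AAlg.z n k := by
  obtain ⟨f, f2, f21, f1, fz⟩ := PAlg.exists_lift (AAlg.zFamily n) (AAlg.u_mul_uu n)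
  obtain ⟨g, gu, gz⟩ := AAlg.exists_lift (PAlg.zFamily n) (PAlg.uFun_mul_uComm n)
  have gu0 : g (AAlg.u n 0) = PAlg.gen n .u1 := gu 0
  have gu1 : g (AAlg.u n 1) = PAlg.gen n .u2 := gu 1
  have guu : g (uComm (AAlg.u n) (AAlg.z n) 0) = PAlg.gen n .u21 := by
    rw [← PAlg.uComm_zero]
    simp [uComm, zCorr, gu, gz]
  refine ⟨AlgEquiv.ofAlgHom f g ?_ ?_, f2, f21, f1, fz⟩
  · refine AAlg.algHom_ext (fun i => ?_) fun k => ?_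
    · fin_cases i
      · simp [gu0, f1]
      · simp [gu1, f2]
    · simp [gz, fz]
  · refine PAlg.algHom_ext fun x => ?_
    cases x <;> simp [f1, f2, f21, fz, gu0, gu1, gz, guu]

/-! ### The realization in `n` copies of `U_q^+(sl_3)` -/

section Realization

variable (n : ℕ)

lemma isA2Power_sl3Pow : IsA2Power (sl3Pow n) q (Equiv.refl (Fin 2 × Fin n)) where
  ne_zero := q_ne_zero
  sub_inv_ne_zero := q_sub_inv_ne_zero
  add_inv_ne_zero := by simpa using q_pow_add_inv_ne_zero one_ne_zero
  qi_eq i := by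
    obtain ⟨r, s⟩ := i
    have : sl3Pow n (r, s) (r, s) = 2 := by
      fin_cases r <;> simp [sl3Pow, CartanMatrix.A]
    simp [qi, this]
  cartan_eq a b := by
    obtain ⟨r, s⟩ := a
    obtain ⟨r', s'⟩ := b
    rcases eq_or_ne s s' with rfl | hs
    · fin_cases r <;> fin_cases r' <;>
        simp [cartan, sl3Pow, CartanMatrix.A]
    · simp [cartan, sl3Pow, Matrix.blockDiagonal_apply, hs]

lemma foldedMatrix_sl3Pow (r s : Fin 2) :
    foldedMatrix (sl3Pow n) (orbit n) r s = if r = s then 2 * (n : ℤ) else -(n : ℤ) := by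
  have h : ∀ i j : Fin n, sl3Pow n (r, i) (s, j) = if i = j then (if r = s then 2 else -1) else 0 := by
    intro i j
    rw [sl3Pow, Matrix.blockDiagonal_apply]
    refine if_congr Iff.rfl ?_ rfl
    fin_cases r <;> fin_cases s <;> simp [CartanMatrix.A]
  simp only [foldedMatrix, orbit, List.map_ofFn, List.sum_ofFn, Function.comp_apply, h,
    Finset.sum_ite_eq, Finset.mem_univ, if_true, Finset.sum_const, Finset.card_univ,
    Fintype.card_fin, nsmul_eq_mul]
  split_ifs <;> ring

lemma isA2Power_folded (hn : 0 < n) :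
    IsA2Power (foldedMatrix (sl3Pow n) (orbit n)) (q ^ n) (Equiv.prodUnique (Fin 2) (Fin 1)) where
  ne_zero := pow_ne_zero _ q_ne_zero
  sub_inv_ne_zero := q_pow_sub_inv_ne_zero hn.ne'
  add_inv_ne_zero := q_pow_add_inv_ne_zero hn.ne'
  qi_eq i := by
    rw [qi, foldedMatrix_sl3Pow, if_pos rfl, Int.mul_ediv_cancel_left _ two_ne_zero, zpow_natCast]
  cartan_eq a b := by
    rw [if_pos (Subsingleton.elim _ _)]
    simp only [cartan, foldedMatrix_sl3Pow, Equiv.prodUnique_apply, if_true]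
    have hn' : (2 * (n : ℤ)) ≠ 0 := by positivity
    split_ifs
    · exact Int.mul_ediv_cancel _ hn'
    · rw [mul_neg, ← mul_neg_one, mul_comm (2 * (n : ℤ)), Int.mul_ediv_cancel _ hn']

/-- The generators `E_{(i, s)}`. -/
def bigE (i : Fin 2) (s : Fin n) : UplusBig n := Uplus.E (sl3Pow n) (i, s)

lemma copies_bigE (i : Fin 2) : Copies q (bigE n i) (bigE n i.rev) :=
  (isA2Power_sl3Pow n).copies i

lemma copies_bigE' (i : Fin 2) : Copies q (bigE n i.rev) (bigE n i) :=
  (copies_bigE n i).symm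

/-- The image of `u_i`: the product of the `E_{(i, s)}` over all copies. -/
def uBig (i : Fin 2) : UplusBig n := (List.ofFn (bigE n i)).prod

/-- The ratio between `z_k` and the elementary symmetric element of degree `k`; as everywhere for the
family `z`, the index `k` of `zCoef` stands for `k + 1`. -/
def zCoef (k : Fin (n - 1)) : Kq :=
  (q ^ ((k : ℕ) + 1) - (q ^ ((k : ℕ) + 1))⁻¹) *
    (q ^ (n - ((k : ℕ) + 1)) - (q ^ (n - ((k : ℕ) + 1)))⁻¹) / (q - q⁻¹)

/-- The image of `z_k`, a multiple of an elementary symmetric element in the root vectors. -/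
def zBig (k : Fin (n - 1)) : UplusBig n :=
  zCoef n k • Copies.e q (bigE n 1) (bigE n 0) ((k : ℕ) + 1)

variable {n}

lemma zCoef_ne_zero (k : Fin (n - 1)) : zCoef n k ≠ 0 := by
  have := k.2
  exact div_ne_zero (mul_ne_zero (q_pow_sub_inv_ne_zero (by omega))
    (q_pow_sub_inv_ne_zero (by omega))) q_sub_inv_ne_zero

lemma zCoef_rev (k : Fin (n - 1)) : zCoef n k.rev = zCoef n k := by
  have h := k.2
  rw [zCoef, zCoef, val_rev_add_one, Nat.sub_sub_self (by omega), mul_comm (q ^ (n - _) - _)]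

/-- The symmetry `k ↦ n - k` of the family `z` corresponds to the exchange of the two words. -/
lemma zBig_zIndex (k : Fin (n - 1)) (i : Fin 2) :
    zBig n (zIndex k i) = zCoef n k • Copies.e q (bigE n i.rev) (bigE n i) ((k : ℕ) + 1) := by
  have h := k.2
  fin_cases i
  · rfl
  · change zBig n k.rev = zCoef n k • Copies.e q (bigE n 0) (bigE n 1) _
    rw [zBig, zCoef_rev, Copies.e_symm q (bigE n 0) (bigE n 1)]
    have := val_rev_add_one k
    omega

variable (n) in
lemma zFamily_big : ZFamily (uBig n) (zBig n) where
  z_z k l := ((copies_bigE n 1).e_comm _ _).smul_left _ |>.smul_right _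
  u_z i k := by
    have h := k.2
    rw [zBig_zIndex, mul_smul_comm, smul_mul_assoc, smul_comm (q ^ _), uBig,
      (copies_bigE' n i).prod_mul_e' (by omega : ((k : ℕ) + 1) + (n - ((k : ℕ) + 1)) = n)]
    congr 3
    push_cast [Nat.cast_sub (by omega : (k : ℕ) + 1 ≤ n)]
    ring

variable (n) in
/-- The corrected commutator is a product of root vectors. -/
lemma uComm_big (hn : 0 < n) (i : Fin 2) : uComm (uBig n) (zBig n) i =
    (q ^ n - (q ^ n)⁻¹) • Copies.e q (bigE n i.rev) (bigE n i) 0 := by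
  have h := (copies_bigE' n i).commutator_prod
  obtain ⟨m, rfl⟩ : ∃ m, n = m + 1 := ⟨n - 1, by omega⟩
  rw [Finset.sum_range_succ'] at h
  rw [uComm, uBig, uBig, h, Nat.sub_zero, zCorr, add_sub_right_comm, add_eq_right, sub_eq_zero,
    Finset.sum_range]
  refine Finset.sum_congr rfl fun k _ => ?_
  have hk := q_pow_sub_inv_ne_zero (m := (k : ℕ) + 1) (by omega)
  have hq := q_sub_inv_ne_zero
  rw [zBig_zIndex, smul_smul, qInt, zCoef, inv_div]
  congr 1
  generalize q ^ ((k : ℕ) + 1) - (q ^ ((k : ℕ) + 1))⁻¹ = a at *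
  generalize q - q⁻¹ = b at *
  field_simp

/-- The Serre-like relations hold for the products `uBig n i`. -/
lemma uBig_mul_uComm (hn : 0 < n) (i : Fin 2) :
    uBig n i * uComm (uBig n) (zBig n) i = q ^ n • (uComm (uBig n) (zBig n) i * uBig n i) := by
  rw [uComm_big n hn, mul_smul_comm, smul_mul_assoc, smul_comm (q ^ n), uBig,
    (copies_bigE' n i).prod_mul_e' (zero_add n)]
  simp

variable (n) in
/-- The realization of `AAlg n` in `n` copies of `U_q^+(sl_3)`. -/
lemma exists_toBig (hn : 0 < n) : ∃ φ : AAlg n →ₐ[Kq] UplusBig n,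
    (∀ i, φ (AAlg.u n i) = uBig n i) ∧ (∀ k, φ (AAlg.z n k) = zBig n k) ∧
    ∀ i, φ (AAlg.uu n i) = (q ^ n - (q ^ n)⁻¹) • Copies.e q (bigE n i.rev) (bigE n i) 0 := by
  obtain ⟨φ, hu, hz⟩ := AAlg.exists_lift (zFamily_big n) (uBig_mul_uComm hn)
  refine ⟨φ, hu, hz, fun i => ?_⟩
  rw [← uComm_big n hn, AAlg.uu_eq]
  simp [uComm, zCorr, hu, hz]

end Realization

/-! ### The PBW property of the algebra -/

section AAlgPBW

variable (n : ℕ)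

/-- The PBW generators `u_r`, `c • (u_j u_r - q^{-n} u_r u_j - ∑ [k]⁻¹ z_{k,j})`, `u_j`, `z_k`, where
`{r, j} = {1, 2}`. The scalar `c` is `(q^n - q^{-n})⁻¹` for the generators of the enhanced uberalgebra,
and `1` for those of the PBW presentation. -/
def AAlg.scaledGen (c : Kq) (r : Fin 2) : Fin (3 + (n - 1)) → AAlg n :=
  Fin.append ![AAlg.u n r, c • AAlg.uu n r.rev, AAlg.u n r.rev] (AAlg.z n)

/-- The linear part of the commutation relations: only `u_j u_r` has one. -/
def AAlg.linCoef (c : Kq) (r : Fin 2) (i j l : Fin (3 + (n - 1))) : Kq :=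
  if i = Fin.castAdd (n - 1) 0 ∧ j = Fin.castAdd (n - 1) 2 then
    Fin.append ![0, c⁻¹, 0] (fun k : Fin (n - 1) => (qInt q ((zIndex k r.rev : ℕ) + 1))⁻¹) l
  else 0

variable {n} {c : Kq} {r : Fin 2}

lemma AAlg.linCoef_eq_zero {i j l : Fin (3 + (n - 1))} (hl : ¬ i < l) :
    AAlg.linCoef n c r i j l = 0 := by
  rw [AAlg.linCoef]
  split_ifs with h
  · obtain ⟨rfl, -⟩ := h
    have : l = Fin.castAdd (n - 1) 0 := by
      rw [Fin.lt_def] at hl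
      ext
      simpa using hl
    rw [this, Fin.append_left]
    rfl
  · rfl

lemma AAlg.z_mul_u (i : Fin 2) (k : Fin (n - 1)) :
    ∃ m : ℤ, AAlg.z n k * AAlg.u n i = q ^ m • (AAlg.u n i * AAlg.z n k) := by
  have h := (AAlg.zFamily n).u_z i (zIndex k i)
  rw [zIndex_zIndex] at h
  exact ⟨_, by rw [h, smul_smul, ← zpow_add₀ q_ne_zero, neg_add_cancel, zpow_zero, one_smul]⟩

/-- The commutation relations between the generators of PBW type. -/
lemma AAlg.scaledGen_mul (hc : c ≠ 0) (i j : Fin (3 + (n - 1))) (hij : i < j) :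
    ∃ m : ℤ, scaledGen n c r j * scaledGen n c r i =
      q ^ m • (scaledGen n c r i * scaledGen n c r j) +
        ∑ l, linCoef n c r i j l • scaledGen n c r l := by
  have hQ := pow_ne_zero n q_ne_zero
  have of_eq : ∀ m : ℤ, ¬ (i = Fin.castAdd (n - 1) 0 ∧ j = Fin.castAdd (n - 1) 2) →
      scaledGen n c r j * scaledGen n c r i = q ^ m • (scaledGen n c r i * scaledGen n c r j) →
      ∃ m : ℤ, scaledGen n c r j * scaledGen n c r i =
      q ^ m • (scaledGen n c r i * scaledGen n c r j) +
        ∑ l, linCoef n c r i j l • scaledGen n c r l := fun m h h' => by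
    refine ⟨m, ?_⟩
    simp [linCoef, if_neg h, h']
  have hz : ∀ k, scaledGen n c r (Fin.natAdd 3 k) = AAlg.z n k := fun k => by
    rw [scaledGen, Fin.append_right]
  have h0 : scaledGen n c r (Fin.castAdd (n - 1) 0) = AAlg.u n r := by
    rw [scaledGen, Fin.append_left]; rfl
  have h1 : scaledGen n c r (Fin.castAdd (n - 1) 1) = c • AAlg.uu n r.rev := by
    rw [scaledGen, Fin.append_left]; rfl
  have h2 : scaledGen n c r (Fin.castAdd (n - 1) 2) = AAlg.u n r.rev := by
    rw [scaledGen, Fin.append_left]; rfl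
  induction i using Fin.addCases with
  | left i =>
    induction j using Fin.addCases with
    | left j =>
      have hij' : i < j := hij
      have : (i = 0 ∧ j = 1) ∨ (i = 0 ∧ j = 2) ∨ (i = 1 ∧ j = 2) := by
        clear of_eq hij
        revert hij'
        fin_cases i <;> fin_cases j <;> decide
      rcases this with ⟨rfl, rfl⟩ | ⟨rfl, rfl⟩ | ⟨rfl, rfl⟩
      · refine of_eq n (by simp) ?_
        have h := AAlg.u_rev_mul_uu n r.rev
        rw [Fin.rev_rev] at h
        rw [h0, h1, mul_smul_comm, smul_mul_assoc, h, smul_comm c (q ^ n)⁻¹, smul_smul,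
          zpow_natCast, mul_inv_cancel₀ hQ, one_smul]
      · refine ⟨-n, ?_⟩
        rw [Fin.sum_univ_add, Fin.sum_univ_three, h0, h1, h2]
        simp only [hz, linCoef, and_self, if_true, Fin.append_left, Fin.append_right]
        have e : ∑ k : Fin (n - 1), (qInt q ((zIndex k r.rev : ℕ) + 1))⁻¹ • AAlg.z n k =
            zCorr (AAlg.z n) r.rev := by
          rw [zCorr]
          exact Fintype.sum_equiv ⟨fun k => zIndex k r.rev, fun k => zIndex k r.rev,
            fun k => zIndex_zIndex k _, fun k => zIndex_zIndex k _⟩ _ _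
            fun k => by simp [zIndex_zIndex]
        rw [e, AAlg.uu_eq, uComm, Fin.rev_rev, zpow_neg, zpow_natCast]
        simp [smul_smul, inv_mul_cancel₀ hc]
      · refine of_eq n (by simp) ?_
        have h := AAlg.u_mul_uu n r.rev
        rw [h1, h2, mul_smul_comm, smul_mul_assoc, h, smul_comm c (q ^ n), zpow_natCast]
    | right k =>
      have hne : ¬ (Fin.castAdd (n - 1) i = Fin.castAdd (n - 1) 0 ∧
          Fin.natAdd 3 k = Fin.castAdd (n - 1) 2) := fun h => by
        have := congrArg Fin.val h.2
        simp at this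
        omega
      have : i = 0 ∨ i = 1 ∨ i = 2 := by
        clear of_eq hij hne
        fin_cases i <;> decide
      rcases this with rfl | rfl | rfl
      · obtain ⟨m, hm⟩ := AAlg.z_mul_u r k
        exact of_eq m hne (by rw [hz, h0, hm])
      · refine of_eq 0 hne ?_
        rw [hz, h1, mul_smul_comm, smul_mul_assoc, zpow_zero, one_smul,
          (AAlg.commute_uu_z n _ k).eq]
      · obtain ⟨m, hm⟩ := AAlg.z_mul_u r.rev k
        exact of_eq m hne (by rw [hz, h2, hm])
  | right k =>
    induction j using Fin.addCases with
    | left j =>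
      have := Fin.lt_def.1 hij
      simp at this
      omega
    | right l =>
      refine of_eq 0 (fun h => ?_) ?_
      · have := congrArg Fin.val h.1
        simp at this
      · rw [hz, hz, zpow_zero, one_smul, ((AAlg.zFamily n).z_z l k).eq]

lemma AAlg.adjoin_scaledGen :
    Algebra.adjoin Kq (Set.range (scaledGen n c r)) = ⊤ := by
  have hsurj : Function.Surjective (RingQuot.mkAlgHom Kq (ARel n)) :=
    RingQuot.mkAlgHom_surjective _ _
  have htop : Algebra.adjoin Kq (RingQuot.mkAlgHom Kq (ARel n) '' Set.range (FreeAlgebra.ι Kq)) =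
      ⊤ := by
    refine (AlgHom.map_adjoin (RingQuot.mkAlgHom Kq (ARel n)) _).symm.trans ?_
    rw [FreeAlgebra.adjoin_range_ι, Algebra.map_top]
    exact (AlgHom.range_eq_top _).2 hsurj
  refine eq_top_iff.2 (htop.symm.le.trans (Algebra.adjoin_mono ?_))
  rintro _ ⟨_, ⟨x, rfl⟩, rfl⟩
  cases x with
  | u i =>
    have : i = r ∨ i = r.rev := by fin_cases i <;> fin_cases r <;> decide
    rcases this with rfl | rfl
    · exact ⟨Fin.castAdd (n - 1) 0, by rw [scaledGen, Fin.append_left]; rfl⟩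
    · exact ⟨Fin.castAdd (n - 1) 2, by rw [scaledGen, Fin.append_left]; rfl⟩
  | z k => exact ⟨Fin.natAdd 3 k, by rw [scaledGen, Fin.append_right]; rfl⟩

lemma AAlg.span_scaledGen (hc : c ≠ 0) :
    Submodule.span Kq (Set.range (orderedMonomial (scaledGen n c r))) = ⊤ := by
  rw [span_orderedMonomial_eq_adjoin, adjoin_scaledGen, Algebra.top_toSubmodule]
  intro i j hij
  obtain ⟨m, hm⟩ := scaledGen_mul (r := r) hc i j hij
  refine ⟨q ^ m, ?_⟩
  rw [hm, add_sub_cancel_left]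
  refine Submodule.sum_mem _ fun l _ => ?_
  by_cases hl : i < l
  · exact Submodule.smul_mem _ _ (Submodule.subset_span ⟨l, hl, rfl⟩)
  · rw [linCoef_eq_zero hl, zero_smul]
    exact Submodule.zero_mem _

variable (n r) in
/-- The leading exponents of the images of the generators, for the word starting with `r`. -/
def uberLead : Fin (3 + (n - 1)) → Expo n :=
  Fin.append ![∑ s, (expo 0 s - expo 2 s), ∑ s, expo 1 s, ∑ s, expo 2 s] fun k =>
    ∑ s : Fin n, if (s : ℕ) < (zIndex k r.rev : ℕ) + 1 then expo 0 s else expo 1 s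

lemma coord_sum_expo {n : ℕ} (c d : Fin 3) (t : Fin n) :
    coord c t (∑ s : Fin n, expo d s) = if c = d then 1 else 0 := by
  simp only [map_sum, coord_expo]
  split_ifs with h <;> simp [h]

lemma coord_sum_ite_expo {n : ℕ} (c : Fin 3) (t : Fin n) (k : ℕ) :
    coord c t (∑ s : Fin n, if (s : ℕ) < k then expo 0 s else expo 1 s) =
      if (t : ℕ) < k then (if c = 0 then 1 else 0) else (if c = 1 then 1 else 0) := by
  rw [map_sum, Finset.sum_eq_single t]
  · rw [apply_ite (coord c t), coord_expo, coord_expo]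
    simp
  · intro s _ hs
    rw [apply_ite (coord c t), coord_expo, coord_expo]
    simp [hs.symm]
  · simp

lemma uberLead_injective (hn : 0 < n) :
    Function.Injective fun a : Fin (3 + (n - 1)) → ℕ => ∑ i, a i • uberLead n r i := by
  intro a b hab
  have hc : ∀ c t, coord c t (∑ i, a i • uberLead n r i) = coord c t (∑ i, b i • uberLead n r i) :=
    fun c t => congrArg (coord c t) hab
  rw [Fin.sum_univ_add, Fin.sum_univ_add, Fin.sum_univ_three, Fin.sum_univ_three] at hc
  simp only [uberLead, Fin.append_left, Fin.append_right, Matrix.cons_val_zero,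
    Matrix.cons_val_one, Matrix.cons_val, Finset.sum_sub_distrib] at hc
  simp only [map_add, map_nsmul, map_sub, coord_sum_expo, map_sum (coord _ _) (fun k => _ • _),
    coord_sum_ite_expo] at hc
  have hc0 : ∀ t : Fin n,
      (a (Fin.castAdd _ 0) : ℤ) + ∑ k : Fin (n - 1),
        (if (t : ℕ) < (zIndex k r.rev : ℕ) + 1 then (a (Fin.natAdd 3 k) : ℤ) else 0) =
      (b (Fin.castAdd _ 0) : ℤ) + ∑ k : Fin (n - 1),
        (if (t : ℕ) < (zIndex k r.rev : ℕ) + 1 then (b (Fin.natAdd 3 k) : ℤ) else 0) :=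
    fun t => by simpa using hc 0 t
  have hc1 : ∀ t : Fin n,
      (a (Fin.castAdd _ 1) : ℤ) + ∑ k : Fin (n - 1),
        (if (t : ℕ) < (zIndex k r.rev : ℕ) + 1 then 0 else (a (Fin.natAdd 3 k) : ℤ)) =
      (b (Fin.castAdd _ 1) : ℤ) + ∑ k : Fin (n - 1),
        (if (t : ℕ) < (zIndex k r.rev : ℕ) + 1 then 0 else (b (Fin.natAdd 3 k) : ℤ)) :=
    fun t => by simpa using hc 1 t
  have hc2 : ∀ t : Fin n, -(a (Fin.castAdd _ 0) : ℤ) + a (Fin.castAdd _ 2) =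
      -(b (Fin.castAdd _ 0) : ℤ) + b (Fin.castAdd _ 2) := fun t => by
    simpa using hc 2 t
  have h0 : a (Fin.castAdd _ 0) = b (Fin.castAdd _ 0) := by
    have h := hc0 ⟨n - 1, by omega⟩
    rw [Finset.sum_eq_zero fun k _ => if_neg (by have := (zIndex k r.rev).2; simp only; omega),
      Finset.sum_eq_zero fun k _ => if_neg (by have := (zIndex k r.rev).2; simp only; omega)] at h
    simpa using h
  have h1 : a (Fin.castAdd _ 1) = b (Fin.castAdd _ 1) := by
    simpa using hc1 ⟨0, hn⟩
  have h2 : a (Fin.castAdd _ 2) = b (Fin.castAdd _ 2) := by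
    have h := hc2 ⟨0, hn⟩
    rw [h0] at h
    simpa using h
  have h3 : ∀ k, a (Fin.natAdd 3 k) = b (Fin.natAdd 3 k) := by
    intro k
    have hk := (zIndex k r.rev).2
    have e : ∀ (l : Fin (n - 1)) (x : ℤ),
        (if (zIndex k r.rev : ℕ) < (zIndex l r.rev : ℕ) + 1 then x else 0) =
        (if (zIndex k r.rev : ℕ) + 1 < (zIndex l r.rev : ℕ) + 1 then x else 0) +
          if k = l then x else 0 := by
      intro l x
      rcases eq_or_ne k l with rfl | hkl
      · simp
      · have : (zIndex k r.rev : ℕ) ≠ zIndex l r.rev := fun h => hkl (by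
          rw [← zIndex_zIndex k r.rev, Fin.ext h, zIndex_zIndex])
        simp only [hkl, if_false, add_zero]
        exact if_congr (by omega) rfl rfl
    have h := hc0 ⟨zIndex k r.rev, by omega⟩
    have h' := hc0 ⟨(zIndex k r.rev : ℕ) + 1, by omega⟩
    simp only [e, Finset.sum_add_distrib, Finset.sum_ite_eq, Finset.mem_univ, if_true] at h
    rw [← add_assoc, ← add_assoc, h'] at h
    simpa using h
  funext i
  induction i using Fin.addCases with
  | left i =>
    fin_cases i
    · exact h0
    · exact h1
    · exact h2
  | right k => exact h3 k

end AAlgPBW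

/-! ### Linear independence of the ordered monomials -/

section OrderedMonomials

variable {n : ℕ} {c : Kq} {r : Fin 2}

lemma map_scaledGen {A : Type} [Ring A] [Algebra Kq A] (f : AAlg n →ₐ[Kq] A) (c : Kq) (r : Fin 2) :
    (fun j => f (AAlg.scaledGen n c r j)) =
      Fin.append ![f (AAlg.u n r), c • f (AAlg.uu n r.rev), f (AAlg.u n r.rev)]
        (fun k => f (AAlg.z n k)) := by
  funext j
  induction j using Fin.addCases with
  | left j =>
    simp only [AAlg.scaledGen, Fin.append_left]
    fin_cases j
    · rfl
    · exact map_smul f _ _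
    · rfl
  | right k => simp only [AAlg.scaledGen, Fin.append_right]

/-- The images of the ordered monomials in the generators of `AAlg n` are linearly independent in
`n` copies of `U_q^+(sl_3)`, since their leading exponents `uberLead` are. -/
theorem linearIndependent_scaledGen (hn : 0 < n) (hc : c ≠ 0) {φ : AAlg n →ₐ[Kq] UplusBig n}
    (hu : ∀ i, φ (AAlg.u n i) = uBig n i) (hz : ∀ k, φ (AAlg.z n k) = zBig n k)
    (huu : ∀ i, φ (AAlg.uu n i) =
      (q ^ n - (q ^ n)⁻¹) • Copies.e q (bigE n i.rev) (bigE n i) 0) :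
    LinearIndependent Kq (orderedMonomial fun j => φ (AAlg.scaledGen n c r j)) := by
  obtain ⟨ρ, hx, hy⟩ := (isA2Power_sl3Pow n).exists_rep r
  have hx' : (fun s => ρ (bigE n r s)) = repX q := hx
  have hy' : (fun s => ρ (bigE n r.rev s)) = repY Kq := hy
  refine linearIndependent_of_hasLead ρ (f := uberLead n r) (fun j => ?_) (uberLead_injective hn)
  have hj := congrFun (map_scaledGen φ c r) j
  rw [hj]
  have he : ∀ k, ρ (Copies.e q (bigE n r) (bigE n r.rev) k) = Copies.e q (repX q) (repY Kq) k :=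
    fun k => by
      have h := Copies.map_e (A' := Module.End Kq (Expo n →₀ Kq)) (v := q) (x := bigE n r)
        (y := bigE n r.rev) ρ k
      rwa [hx', hy'] at h
  have hU : ∀ i, ρ (uBig n i) = (List.ofFn fun s => ρ (bigE n i s)).prod := fun i => by
    rw [uBig, map_list_prod, List.map_ofFn]; rfl
  induction j using Fin.addCases with
  | left j =>
    rw [Fin.append_left, uberLead, Fin.append_left]
    fin_cases j
    · change HasLead (ρ (φ (AAlg.u n r))) (∑ s, (expo 0 s - expo 2 s))
      rw [hu, hU, hx']
      exact HasLead.listProd fun s => hasLead_repX q_ne_zero s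
    · change HasLead (ρ (c • φ (AAlg.uu n r.rev))) (∑ s, expo 1 s)
      rw [huu, Fin.rev_rev, map_smul, map_smul, he]
      have h := hasLead_rep_e (N := n) q_ne_zero q_sub_inv_ne_zero (Nat.zero_le n)
      simp only [not_lt_zero, if_false] at h
      exact (h.smul (q_pow_sub_inv_ne_zero hn.ne')).smul hc
    · change HasLead (ρ (φ (AAlg.u n r.rev))) (∑ s, expo 2 s)
      rw [hu, hU, hy']
      exact HasLead.listProd fun s => hasLead_repY s
  | right k =>
    rw [Fin.append_right, uberLead, Fin.append_right, hz]
    have h := zBig_zIndex (zIndex k r.rev) r.rev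
    rw [zIndex_zIndex, Fin.rev_rev] at h
    rw [h, map_smul, he]
    have hk := (zIndex k r.rev).2
    exact (hasLead_rep_e q_ne_zero q_sub_inv_ne_zero (by omega)).smul (zCoef_ne_zero _)

theorem AAlg.isPBW_scaledGen (hn : 0 < n) (hc : c ≠ 0) : IsPBW Kq (AAlg.scaledGen n c r) := by
  obtain ⟨φ, hu, hz, huu⟩ := exists_toBig n hn
  refine ⟨?_, AAlg.span_scaledGen hc⟩
  have h := linearIndependent_scaledGen (r := r) hn hc hu hz huu
  have e : (orderedMonomial fun j => φ (AAlg.scaledGen n c r j)) =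
      φ.toLinearMap ∘ orderedMonomial (AAlg.scaledGen n c r) :=
    funext fun a => (map_orderedMonomial φ _ a).symm
  rw [e] at h
  exact LinearIndependent.of_comp φ.toLinearMap h

/-- A homomorphism from a PBW algebra is injective if the ordered monomials in the images of the
generators are linearly independent. -/
lemma IsPBW.injective_of_linearIndependent {U B : Type} [Ring U] [Algebra Kq U] [Ring B]
    [Algebra Kq B] {N : ℕ} {v : Fin N → U} (h : IsPBW Kq v) (f : U →ₐ[Kq] B)
    (hf : LinearIndependent Kq (orderedMonomial fun i => f (v i))) : Function.Injective f := by
  have e : h.basis.constr ℕ (orderedMonomial fun i => f (v i)) = f.toLinearMap :=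
    h.basis.constr_eq ℕ fun a => by
      rw [← map_orderedMonomial f]
      simp [IsPBW.basis]
  have hinj := h.basis.injective_constr_of_linearIndependent (R₂ := ℕ) hf
  rw [e] at hinj
  exact hinj

end OrderedMonomials

/-! ### The quantum folding -/

section Projection

variable {n : ℕ}

/-- The generators of the folded algebra. -/
def smallE (n : ℕ) (i : Fin 2) : UplusSmall n := Uplus.E (foldedMatrix (sl3Pow n) (orbit n)) i

lemma copies_smallE (hn : 0 < n) (i : Fin 2) :
    Copies (q ^ n) (fun _ : Fin 1 => smallE n i) (fun _ : Fin 1 => smallE n i.rev) :=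
  (isA2Power_folded n hn).copies i

/-- The projection killing the `z_k`. -/
theorem exists_proj_small (hn : 0 < n) : ∃ μ : AAlg n →ₐ[Kq] UplusSmall n,
    Function.Surjective μ ∧ (∀ i, μ (AAlg.u n i) = smallE n i) ∧ ∀ k, μ (AAlg.z n k) = 0 := by
  have hz : ZFamily (smallE n) (fun _ : Fin (n - 1) => (0 : UplusSmall n)) :=
    ⟨fun _ _ => Commute.refl _, fun _ _ => by simp⟩
  obtain ⟨μ, hu, hz⟩ := AAlg.exists_lift hz fun i => by
    have h := ((copies_smallE hn i).serre 0)
    unfold SerreRel at h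
    rw [hz.serre_iff]
    have e : (zSerre (fun _ : Fin (n - 1) => (0 : UplusSmall n)) i) = 0 := by simp [zSerre]
    rw [e, mul_zero, smul_zero, ← h]
    abel
  refine ⟨μ, ?_, hu, hz⟩
  rw [← AlgHom.range_eq_top, eq_top_iff, ← Uplus.adjoin_E]
  refine Algebra.adjoin_le ?_
  rintro _ ⟨i, rfl⟩
  exact ⟨_, hu i⟩

end Projection

section Folding

variable (n : ℕ) (r : Fin 2)

/-- The modified root vectors of the word starting with `r`. -/
def rootSmall : Fin 3 → UplusSmall n :=
  ![smallE n r, rootVec (q ^ n) (smallE n r) (smallE n r.rev), smallE n r.rev]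

/-- The modified root vectors of the folded word. -/
def rootBig : Fin 3 → UplusBig n :=
  ![uBig n r, (List.ofFn fun s => rootVec q (bigE n r s) (bigE n r.rev s)).prod, uBig n r.rev]

variable {n}

lemma isPBW_rootSmall (hn : 0 < n) : IsPBW Kq (rootSmall n r) := by
  have h := (isA2Power_folded n hn).isPBW r
  have e : (rootSmall n r : Fin (1 + 1 + 1) → UplusSmall n) =
      IsA2Power.pbw _ (q ^ n) (Equiv.prodUnique (Fin 2) (Fin 1)) r := by
    funext i
    fin_cases i <;> rfl
  rw [← e] at h
  exact h

/-- The quantum folding. -/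
def foldingMap (hn : 0 < n) : UplusSmall n →ₗ[Kq] UplusBig n :=
  (isPBW_rootSmall r hn).basis.constr Kq fun a => orderedMonomial (rootBig n r) a

lemma foldingMap_orderedMonomial (hn : 0 < n) (a : Fin 3 → ℕ) :
    foldingMap r hn (orderedMonomial (rootSmall n r) a) = orderedMonomial (rootBig n r) a := by
  have h := (isPBW_rootSmall r hn).basis.constr_basis Kq
    (fun a => orderedMonomial (rootBig n r) a) a
  rwa [IsPBW.basis, Module.Basis.mk_apply] at h

lemma foldingMap_rootSmall (hn : 0 < n) (i : Fin 3) :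
    foldingMap r hn (rootSmall n r i) = rootBig n r i := by
  have h := foldingMap_orderedMonomial r hn (Pi.single i 1)
  rwa [orderedMonomial_single, orderedMonomial_single, pow_one, pow_one] at h

lemma foldingMap_range (hn : 0 < n) : LinearMap.range (foldingMap r hn) =
    Submodule.span Kq (Set.range (orderedMonomial (rootBig n r))) :=
  (isPBW_rootSmall r hn).basis.constr_range Kq

lemma uberGen_eq : AAlg.uberGen n r = AAlg.scaledGen n (q ^ n - (q ^ n)⁻¹)⁻¹ r := rfl

lemma map_uberGen (hn : 0 < n) {φ : AAlg n →ₐ[Kq] UplusBig n}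
    (hu : ∀ i, φ (AAlg.u n i) = uBig n i) (hz : ∀ k, φ (AAlg.z n k) = zBig n k)
    (huu : ∀ i, φ (AAlg.uu n i) =
      (q ^ n - (q ^ n)⁻¹) • Copies.e q (bigE n i.rev) (bigE n i) 0) :
    (fun j => φ (AAlg.uberGen n r j)) = Fin.append (rootBig n r) (zBig n) := by
  rw [uberGen_eq, map_scaledGen, hu, hu, huu, smul_smul,
    inv_mul_cancel₀ (q_pow_sub_inv_ne_zero hn.ne'), one_smul, Copies.e_zero, Fin.rev_rev]
  congr 1
  exact funext hz

lemma linearIndependent_append (hn : 0 < n) :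
    LinearIndependent Kq (orderedMonomial (Fin.append (rootBig n r) (zBig n))) := by
  obtain ⟨φ, hu, hz, huu⟩ := exists_toBig n hn
  rw [← map_uberGen r hn hu hz huu]
  exact linearIndependent_scaledGen hn (inv_ne_zero (q_pow_sub_inv_ne_zero hn.ne')) hu hz huu

lemma orderedMonomial_append {A : Type} [Monoid A] {N M : ℕ} (x : Fin N → A) (y : Fin M → A)
    (a : Fin N → ℕ) (b : Fin M → ℕ) :
    orderedMonomial (Fin.append x y) (Fin.append a b) =
      orderedMonomial x a * orderedMonomial y b := by
  have : (fun i => Fin.append x y i ^ Fin.append a b i) =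
      Fin.append (fun i => x i ^ a i) (fun i => y i ^ b i) := by
    funext i
    induction i using Fin.addCases <;> simp only [Fin.append_left, Fin.append_right]
  rw [orderedMonomial, this, List.ofFn_fin_append, List.prod_append]
  rfl

lemma linearIndependent_rootBig (hn : 0 < n) :
    LinearIndependent Kq (orderedMonomial (rootBig n r)) := by
  have h := (linearIndependent_append r hn).comp (fun a : Fin 3 → ℕ => Fin.append a 0)
    (fun a b hab => by
      funext i
      have := congrFun hab (Fin.castAdd _ i)
      simpa only [Fin.append_left] using this)
  convert h using 1
  funext a
  rw [Function.comp_apply, orderedMonomial_append, orderedMonomial_zero, mul_one]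

lemma foldingMap_injective (hn : 0 < n) : Function.Injective (foldingMap r hn) := by
  have h := linearIndependent_rootBig r hn
  exact (isPBW_rootSmall r hn).basis.injective_constr_of_linearIndependent (R₂ := Kq) h

end Folding

/-! ### The enhanced uberalgebra of the folding -/

section Uberalgebra

variable {n : ℕ} (r : Fin 2)

lemma fin_notMem_range_castAdd {j : Fin (3 + (n - 1))}
    (hj : j ∉ Set.range (Fin.castAddOrderEmb (n - 1) : Fin 3 ↪o Fin (3 + (n - 1)))) :
    ∃ k, j = Fin.natAdd 3 k := by
  induction j using Fin.addCases with
  | left j => exact absurd ⟨j, rfl⟩ hj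
  | right k => exact ⟨k, rfl⟩

lemma q_zpow_injective : Function.Injective fun m : ℤ => q ^ m := by
  intro a b hab
  wlog h : a ≤ b generalizing a b
  · exact (this hab.symm (le_of_not_ge h)).symm
  obtain ⟨d, rfl⟩ := Int.le.dest h
  simp only [zpow_add₀ q_ne_zero, zpow_natCast] at hab
  have h1 := mul_left_cancel₀ (zpow_ne_zero a q_ne_zero)
    ((mul_one (q ^ a)).trans hab)
  by_cases hd : d = 0
  · simp [hd]
  · exact absurd h1.symm (q_pow_ne_one hd)

/-- The `z_k` are separated by conjugation with `u_j`, and a combination of all of them is a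
polynomial in the images of the root vectors. -/
lemma zBig_memSkewFractions (hn : 0 < n) (k : Fin (n - 1)) :
    MemSkewFractions (Set.range (foldingMap r hn)) (zBig n k) := by
  have hdom := (isA2Power_sl3Pow n).isDomain
  obtain ⟨ore⟩ := (isA2Power_sl3Pow n).nonempty_oreSet
  have hV : ∀ i, rootBig n r i ∈ LinearMap.range (foldingMap r hn) := fun i =>
    ⟨_, foldingMap_rootSmall r hn i⟩
  have h1 : (1 : UplusBig n) ∈ LinearMap.range (foldingMap r hn) :=
    ⟨_, by rw [foldingMap_orderedMonomial r hn 0, orderedMonomial_zero]⟩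
  have hne : uBig n r.rev ≠ 0 := by
    have h := (linearIndependent_rootBig r hn).ne_zero (Pi.single 2 1)
    rwa [orderedMonomial_single, pow_one] at h
  have hcomm := uComm_big n hn r.rev
  rw [uComm, sub_eq_iff_eq_add, ← sub_eq_iff_eq_add', Fin.rev_rev, Copies.e_zero] at hcomm
  have key := memSkewFractions_of_sum (LinearMap.range (foldingMap r hn)) h1 (hV 2) hne
    (z := fun k : Fin (n - 1) => zBig n (zIndex k r.rev))
    (l := fun k : Fin (n - 1) => q ^ ((n : ℤ) - 2 * ((k : ℤ) + 1)))
    (fun k l hkl => by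
      have := q_zpow_injective hkl
      ext; omega)
    (fun k => (zFamily_big n).u_z r.rev k) (fun k => zpow_ne_zero _ q_ne_zero)
    (t := zCorr (zBig n) r.rev) (fun D hD => by
      have hs : ∀ (a : Kq), ∀ b ∈ D, a • b ∈ D := fun a b hb => by
        rw [← one_mul b, ← smul_mul_assoc]
        exact D.mul_mem (hD (Submodule.smul_mem _ a h1)) hb
      rw [← hcomm]
      have h0 := hD (hV 0)
      have h2 := hD (hV 2)
      exact D.sub_mem (D.sub_mem (D.mul_mem h2 h0) (hs _ _ (D.mul_mem h0 h2)))
        (hs _ _ (hD (hV 1))))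
    (s := Finset.univ) (c := fun k => (qInt q ((k : ℕ) + 1))⁻¹)
    (fun k _ => inv_ne_zero (div_ne_zero (q_pow_sub_inv_ne_zero (by omega)) q_sub_inv_ne_zero))
    rfl (zIndex k r.rev) (Finset.mem_univ _)
  simp only [zIndex_zIndex] at key
  exact key

/-- The image of the folding is spanned by monomials in the root vectors. -/
lemma adjoin_range_union (hn : 0 < n) :
    Algebra.adjoin Kq (Set.range (foldingMap r hn) ∪
        Set.range (Fin.append (rootBig n r) (zBig n))) =
      Algebra.adjoin Kq (Set.range (Fin.append (rootBig n r) (zBig n))) := by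
  refine le_antisymm (Algebra.adjoin_le (Set.union_subset ?_ Algebra.subset_adjoin))
    (Algebra.adjoin_mono Set.subset_union_right)
  have h : LinearMap.range (foldingMap r hn) ≤ Subalgebra.toSubmodule
      (Algebra.adjoin Kq (Set.range (Fin.append (rootBig n r) (zBig n)))) := by
    rw [foldingMap_range, Submodule.span_le]
    rintro _ ⟨a, rfl⟩
    refine Algebra.adjoin_mono ?_ (orderedMonomial_mem_adjoin (rootBig n r) a)
    rintro _ ⟨i, rfl⟩
    exact ⟨Fin.castAdd _ i, Fin.append_left _ _ _⟩
  exact h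

lemma range_eq_adjoin {U : Type} [Ring U] [Algebra Kq U] {B : Type} [Ring B] [Algebra Kq B]
    {N : ℕ} {v : Fin N → U} (h : IsPBW Kq v) (f : U →ₐ[Kq] B) :
    f.range = Algebra.adjoin Kq (Set.range fun j => f (v j)) := by
  have htop : Algebra.adjoin Kq (Set.range v) = ⊤ := by
    rw [← Algebra.toSubmodule_eq_top, eq_top_iff, ← h.span_eq_top, Submodule.span_le]
    rintro _ ⟨a, rfl⟩
    exact orderedMonomial_mem_adjoin v a
  rw [← Algebra.map_top, ← htop, AlgHom.map_adjoin, ← Set.range_comp]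
  rfl

lemma isPBW_uberGen (hn : 0 < n) : IsPBW Kq (AAlg.uberGen n r) :=
  AAlg.isPBW_scaledGen hn (inv_ne_zero (q_pow_sub_inv_ne_zero hn.ne'))

lemma IsPBW.isUberalgebra {U : Type} [Ring U] [Algebra Kq U] {B : Type} [Ring B] [Algebra Kq B]
    {N : ℕ} {v : Fin N → U} (h : IsPBW Kq v) (f : U →ₐ[Kq] B) {w : Fin N → B}
    (hw : (fun j => f (v j)) = w) : IsUberalgebra (Algebra.adjoin Kq (Set.range w)) w v := by
  subst hw
  refine ⟨?_, h, f, range_eq_adjoin h f, fun _ => rfl⟩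
  rw [IsSubPBW, ← range_eq_adjoin h f]
  have e : Set.range (orderedMonomial fun j => f (v j)) = f.toLinearMap '' Set.range (orderedMonomial v) := by
    rw [← Set.range_comp]
    congr 1
    funext a
    exact (map_orderedMonomial f v a).symm
  rw [e, ← Submodule.map_span, h.span_eq_top]
  ext b
  simp

/-- `AAlg n` is an enhanced uberalgebra of the folding, by its realization in the target. -/
theorem isEnhancedUberalgebra (hn : 0 < n) :
    IsEnhancedUberalgebra (rootSmall n r) (foldingMap r hn) (Fin.castAddOrderEmb (n - 1))
      (Fin.append (rootBig n r) (zBig n)) (AAlg.uberGen n r) where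
  source_isPBW := isPBW_rootSmall r hn
  target_isPBW := ⟨_, _, (isA2Power_sl3Pow n).isPBW r⟩
  target_isDomain := (isA2Power_sl3Pow n).isDomain
  injective := foldingMap_injective r hn
  multiplicative a := by
    rw [foldingMap_orderedMonomial]
    simp only [foldingMap_rootSmall]
  w_injective i j hij := by
    have h := (linearIndependent_append r hn).injective (a₁ := Pi.single i 1) (a₂ := Pi.single j 1)
      (by rw [orderedMonomial_single, orderedMonomial_single, hij])
    by_contra hne
    have := congrFun h i
    simp [hne] at this
  w_apply i := by
    rw [foldingMap_rootSmall]
    exact Fin.append_left _ _ _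
  mem_fractions j hj := by
    obtain ⟨k, rfl⟩ := fin_notMem_range_castAdd hj
    rw [Fin.append_right]
    exact zBig_memSkewFractions r hn k
  isUberalgebra := by
    rw [adjoin_range_union]
    obtain ⟨φ, hu, hz, huu⟩ := exists_toBig n hn
    exact (isPBW_uberGen r hn).isUberalgebra φ (map_uberGen r hn hu hz huu)
  exists_proj := by
    obtain ⟨μ, hsurj, hu, hz⟩ := exists_proj_small hn
    have hμ := map_scaledGen μ (q ^ n - (q ^ n)⁻¹)⁻¹ r
    have e : μ (AAlg.uu n r.rev) =
        smallE n r.rev * smallE n r - (q ^ n)⁻¹ • (smallE n r * smallE n r.rev) := by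
      rw [AAlg.uu_eq, uComm, zCorr, Fin.rev_rev]
      simp [hu, hz]
    refine ⟨μ, hsurj, fun i => ?_, fun j hj => ?_⟩
    · refine (congrFun hμ (Fin.castAdd (n - 1) i)).trans ?_
      rw [Fin.append_left, hu, hu, e]
      rfl
    · obtain ⟨k, rfl⟩ := fin_notMem_range_castAdd hj
      refine (congrFun hμ (Fin.natAdd 3 k)).trans ?_
      rw [Fin.append_right, hz]

/-- The ordered monomials in the root vectors and the `z_k` are linearly independent in the target.
Hence any enhanced uberalgebra embeds in the target and is determined by its image. -/
theorem enhancedUberalgebra_unique (hn : 0 < n) {U : Type} [Ring U] [Algebra Kq U]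
    {v : Fin (3 + (n - 1)) → U}
    (h : IsEnhancedUberalgebra (rootSmall n r) (foldingMap r hn) (Fin.castAddOrderEmb (n - 1))
      (Fin.append (rootBig n r) (zBig n)) v) :
    ∃ f : AAlg n ≃ₐ[Kq] U, ∀ j, f (AAlg.uberGen n r j) = v j := by
  have key : ∀ {U : Type} [Ring U] [Algebra Kq U] {v : Fin (3 + (n - 1)) → U},
      IsEnhancedUberalgebra (rootSmall n r) (foldingMap r hn) (Fin.castAddOrderEmb (n - 1))
        (Fin.append (rootBig n r) (zBig n)) v →
      ∃ f : U →ₐ[Kq] UplusBig n, Function.Injective f ∧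
        f.range = Algebra.adjoin Kq (Set.range (foldingMap r hn) ∪
          Set.range (Fin.append (rootBig n r) (zBig n))) ∧
        ∀ j, f (v j) = Fin.append (rootBig n r) (zBig n) j := by
    intro U _ _ v h
    obtain ⟨f, hrange, hf⟩ := h.isUberalgebra.exists_hom
    refine ⟨f, h.isUberalgebra.isPBW.injective_of_linearIndependent f ?_, hrange, hf⟩
    rw [show (fun i => f (v i)) = _ from funext hf]
    exact linearIndependent_append r hn
  obtain ⟨f, hfi, hfr, hf⟩ := key (isEnhancedUberalgebra r hn)
  obtain ⟨g, hgi, hgr, hg⟩ := key h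
  let F := (AlgEquiv.ofInjective f hfi).trans
    ((Subalgebra.equivOfEq _ _ (hfr.trans hgr.symm)).trans (AlgEquiv.ofInjective g hgi).symm)
  refine ⟨F, fun j => hgi ?_⟩
  have e : g (F (AAlg.uberGen n r j)) = f (AAlg.uberGen n r j) := by
    exact congrArg Subtype.val ((AlgEquiv.ofInjective g hgi).apply_symm_apply
      (Subalgebra.equivOfEq _ _ (hfr.trans hgr.symm)
        (AlgEquiv.ofInjective f hfi (AAlg.uberGen n r j))))
  rw [e, hf, hg]

lemma ofFn_prod_comp_perm {A : Type} [Ring A] (σ : Equiv.Perm (Fin n)) (x : Fin n → A)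
    (hx : ∀ s t, Commute (x s) (x t)) :
    (List.ofFn fun s => x (σ s)).prod = (List.ofFn x).prod := by
  have hp : (List.ofFn fun s => x (σ s)).Perm (List.ofFn x) := σ.ofFn_comp_perm x
  refine List.Perm.prod_eq' hp (List.pairwise_of_forall_mem_list ?_)
  rintro a ha b hb
  obtain ⟨s, rfl⟩ := (List.mem_ofFn' _ _).1 ha
  obtain ⟨t, rfl⟩ := (List.mem_ofFn' _ _).1 hb
  exact hx _ _

/-- The image of the folding consists of invariants. -/
theorem diagramHom_foldingMap (hn : 0 < n) (σ : Equiv.Perm (Fin n)) (a : UplusSmall n) :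
    diagramHom (sl3Pow n) (factorPerm n σ) (sl3Pow_factorPerm n σ) (foldingMap r hn a) =
      foldingMap r hn a := by
  set f := diagramHom (sl3Pow n) (factorPerm n σ) (sl3Pow_factorPerm n σ) with hf
  have hE : ∀ i s, f (bigE n i s) = bigE n i (σ s) := fun i s => by
    rw [hf, diagramHom, bigE, Uplus.lift_E]; rfl
  have hu : ∀ i, f (uBig n i) = uBig n i := fun i => by
    rw [uBig, map_list_prod, List.map_ofFn]
    have : (⇑f ∘ bigE n i) = fun s => bigE n i (σ s) := funext (hE i)
    rw [this]
    exact ofFn_prod_comp_perm σ _ (copies_bigE n i).comm_left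
  have hroot : ∀ i, f (rootBig n r i) = rootBig n r i := fun i => by
    fin_cases i
    · exact hu r
    · change f (List.ofFn fun s => rootVec q (bigE n r s) (bigE n r.rev s)).prod = _
      rw [map_list_prod, List.map_ofFn]
      have : (⇑f ∘ fun s => rootVec q (bigE n r s) (bigE n r.rev s)) =
          fun s => rootVec q (bigE n r (σ s)) (bigE n r.rev (σ s)) := by
        funext s
        rw [Function.comp_apply, map_rootVec, hE, hE]
      rw [this]
      exact ofFn_prod_comp_perm σ (fun s => rootVec q (bigE n r s) (bigE n r.rev s))
        (copies_bigE n r).rootVec_comm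
    · exact hu r.rev
  have hle : LinearMap.range (foldingMap r hn) ≤
      LinearMap.eqLocus f.toLinearMap LinearMap.id := by
    rw [foldingMap_range, Submodule.span_le]
    rintro _ ⟨a, rfl⟩
    change f _ = _
    rw [map_orderedMonomial]
    simp only [hroot]
    rfl
  exact hle ⟨a, rfl⟩

end Uberalgebra

/-! ### Lusztig's operators on the relations of `U_v(sl_3)` -/

section Sl3Relations

variable {K A : Type} [Field K] [Ring A] [Algebra K A]

/-- The defining relations of `U_v(sl_3)`, with the relations `K_i x K_i⁻¹ = c x` rewritten as
`K_i x = c x K_i`. -/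
structure Sl3Rel (v : K) (x : Gen (Fin 2) → A) : Prop where
  K_Kinv : ∀ r, x (.K r) * x (.Kinv r) = 1
  Kinv_K : ∀ r, x (.Kinv r) * x (.K r) = 1
  K_K : ∀ r, Commute (x (.K r)) (x (.K r.rev))
  E_F_same : ∀ r, x (.E r) * x (.F r) - x (.F r) * x (.E r) =
    (v - v⁻¹)⁻¹ • (x (.K r) - x (.Kinv r))
  E_F : ∀ r, Commute (x (.E r)) (x (.F r.rev))
  K_E_same : ∀ r, x (.K r) * x (.E r) = v ^ 2 • (x (.E r) * x (.K r))
  K_E : ∀ r, x (.K r) * x (.E r.rev) = v⁻¹ • (x (.E r.rev) * x (.K r))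
  K_F_same : ∀ r, x (.K r) * x (.F r) = (v ^ 2)⁻¹ • (x (.F r) * x (.K r))
  K_F : ∀ r, x (.K r) * x (.F r.rev) = v • (x (.F r.rev) * x (.K r))
  serre_E : ∀ r, SerreRel v (x (.E r)) (x (.E r.rev))
  serre_F : ∀ r, SerreRel v (x (.F r)) (x (.F r.rev))

/-- The images of the generators of `U_v(sl_3)` under Lusztig's operator `T'_{r,-1}`. -/
def braidGen (v : K) (x : Gen (Fin 2) → A) (r : Fin 2) : Gen (Fin 2) → A
  | .E a => if a = r then -(x (.Kinv r) * x (.F r))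
      else x (.E a) * x (.E r) - v⁻¹ • (x (.E r) * x (.E a))
  | .F a => if a = r then -(x (.E r) * x (.K r))
      else x (.F r) * x (.F a) - v • (x (.F a) * x (.F r))
  | .K a => if a = r then x (.Kinv r) else x (.K a) * x (.K r)
  | .Kinv a => if a = r then x (.K r) else x (.Kinv a) * x (.Kinv r)

lemma forall_fin_two_rev {P : Fin 2 → Prop} (r : Fin 2) (h : P r) (h' : P r.rev) : ∀ a, P a := by
  intro a
  have : a = r ∨ a = r.rev := by fin_cases a <;> fin_cases r <;> decide
  rcases this with rfl | rfl
  exacts [h, h']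

lemma rev_ne (r : Fin 2) : r.rev ≠ r := by fin_cases r <;> decide

lemma inv_mul_of_mul {k l x : A} {c : K} (hc : c ≠ 0) (hkl : k * l = 1) (hlk : l * k = 1)
    (h : k * x = c • (x * k)) : l * x = c⁻¹ • (x * l) := by
  have h1 : x * l = c • (l * x) := by
    calc x * l = l * (k * x) * l := by rw [← mul_assoc, hlk, one_mul]
      _ = c • (l * x * (k * l)) := by rw [h]; simp only [mul_smul_comm, smul_mul_assoc, mul_assoc]
      _ = c • (l * x) := by rw [hkl, mul_one]
  rw [h1, smul_smul, inv_mul_cancel₀ hc, one_smul]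

lemma mul_mul_of_mul {k x y : A} {a b : K} (hx : k * x = a • (x * k)) (hy : k * y = b • (y * k)) :
    k * (x * y) = (a * b) • (x * y * k) := by
  rw [← mul_assoc, hx, smul_mul_assoc, mul_assoc, hy, mul_smul_comm, smul_smul, mul_assoc]

lemma mul_left_of_mul {k l x : A} {a b : K} (hk : k * x = a • (x * k)) (hl : l * x = b • (x * l)) :
    (k * l) * x = (a * b) • (x * (k * l)) := by
  rw [mul_assoc, hl, mul_smul_comm, ← mul_assoc, hk, smul_mul_assoc, smul_smul, mul_assoc,
    mul_comm b]

namespace Sl3Rel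

variable {v : K} {x : Gen (Fin 2) → A}

lemma Kinv_E_same (h : Sl3Rel v x) (hv0 : v ≠ 0) (r : Fin 2) :
    x (.Kinv r) * x (.E r) = (v ^ 2)⁻¹ • (x (.E r) * x (.Kinv r)) :=
  inv_mul_of_mul (pow_ne_zero 2 hv0) (h.K_Kinv r) (h.Kinv_K r) (h.K_E_same r)

lemma Kinv_E (h : Sl3Rel v x) (hv0 : v ≠ 0) (r : Fin 2) :
    x (.Kinv r) * x (.E r.rev) = v • (x (.E r.rev) * x (.Kinv r)) := by
  simpa using inv_mul_of_mul (inv_ne_zero hv0) (h.K_Kinv r) (h.Kinv_K r) (h.K_E r)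

lemma Kinv_F_same (h : Sl3Rel v x) (hv0 : v ≠ 0) (r : Fin 2) :
    x (.Kinv r) * x (.F r) = v ^ 2 • (x (.F r) * x (.Kinv r)) := by
  simpa using inv_mul_of_mul (inv_ne_zero (pow_ne_zero 2 hv0)) (h.K_Kinv r) (h.Kinv_K r)
    (h.K_F_same r)

lemma Kinv_F (h : Sl3Rel v x) (hv0 : v ≠ 0) (r : Fin 2) :
    x (.Kinv r) * x (.F r.rev) = v⁻¹ • (x (.F r.rev) * x (.Kinv r)) :=
  inv_mul_of_mul hv0 (h.K_Kinv r) (h.Kinv_K r) (h.K_F r)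

lemma Kinv_Kinv (h : Sl3Rel v x) (r : Fin 2) : Commute (x (.Kinv r)) (x (.Kinv r.rev)) := by
  have h1 : Commute (x (.Kinv r)) (x (.K r.rev)) := by
    have := inv_mul_of_mul (K := K) one_ne_zero (h.K_Kinv r) (h.Kinv_K r)
      ((h.K_K r).eq.trans (one_smul K _).symm)
    rwa [inv_one, one_smul] at this
  have := inv_mul_of_mul (K := K) one_ne_zero (h.K_Kinv r.rev) (h.Kinv_K r.rev)
      (h1.symm.eq.trans (one_smul K _).symm)
  rw [inv_one, one_smul] at this
  exact this.symm

lemma K_Kinv_comm (h : Sl3Rel v x) (r : Fin 2) : Commute (x (.Kinv r)) (x (.K r.rev)) := by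
  have := inv_mul_of_mul (K := K) one_ne_zero (h.K_Kinv r) (h.Kinv_K r)
      ((h.K_K r).eq.trans (one_smul K _).symm)
  rwa [inv_one, one_smul] at this

section

variable (v x) (r : Fin 2)

lemma braidGen_E_same : braidGen v x r (.E r) = -(x (.Kinv r) * x (.F r)) := if_pos rfl

lemma braidGen_E : braidGen v x r (.E r.rev) =
    x (.E r.rev) * x (.E r) - v⁻¹ • (x (.E r) * x (.E r.rev)) := if_neg (rev_ne r)

lemma braidGen_F_same : braidGen v x r (.F r) = -(x (.E r) * x (.K r)) := if_pos rfl

lemma braidGen_F : braidGen v x r (.F r.rev) =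
    x (.F r) * x (.F r.rev) - v • (x (.F r.rev) * x (.F r)) := if_neg (rev_ne r)

lemma braidGen_K_same : braidGen v x r (.K r) = x (.Kinv r) := if_pos rfl

lemma braidGen_K : braidGen v x r (.K r.rev) = x (.K r.rev) * x (.K r) := if_neg (rev_ne r)

lemma braidGen_Kinv_same : braidGen v x r (.Kinv r) = x (.K r) := if_pos rfl

lemma braidGen_Kinv : braidGen v x r (.Kinv r.rev) = x (.Kinv r.rev) * x (.Kinv r) :=
  if_neg (rev_ne r)

end

variable (h : Sl3Rel v x) (hv0 : v ≠ 0) (hv : v - v⁻¹ ≠ 0) (r : Fin 2)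
include h hv0

lemma K_braidGen_E : x (.K r) * braidGen v x r (.E r.rev) =
    v • (braidGen v x r (.E r.rev) * x (.K r)) := by
  have h1 := mul_mul_of_mul (h.K_E r) (h.K_E_same r)
  have h2 := mul_mul_of_mul (h.K_E_same r) (h.K_E r)
  rw [braidGen_E, mul_sub, mul_smul_comm, h1, h2, sub_mul, smul_mul_assoc]
  match_scalars <;> field_simp

lemma K_rev_braidGen_E : x (.K r.rev) * braidGen v x r (.E r.rev) =
    v • (braidGen v x r (.E r.rev) * x (.K r.rev)) := by
  have hr := h.K_E r.rev
  rw [Fin.rev_rev] at hr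
  have h1 := mul_mul_of_mul (h.K_E_same r.rev) hr
  have h2 := mul_mul_of_mul hr (h.K_E_same r.rev)
  rw [braidGen_E, mul_sub, mul_smul_comm, h1, h2, sub_mul, smul_mul_assoc]
  match_scalars <;> field_simp

lemma K_braidGen_F : x (.K r) * braidGen v x r (.F r.rev) =
    v⁻¹ • (braidGen v x r (.F r.rev) * x (.K r)) := by
  have h1 := mul_mul_of_mul (h.K_F r) (h.K_F_same r)
  have h2 := mul_mul_of_mul (h.K_F_same r) (h.K_F r)
  rw [braidGen_F, mul_sub, mul_smul_comm, h1, h2, sub_mul, smul_mul_assoc]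
  match_scalars <;> field_simp

lemma K_rev_braidGen_F : x (.K r.rev) * braidGen v x r (.F r.rev) =
    v⁻¹ • (braidGen v x r (.F r.rev) * x (.K r.rev)) := by
  have hr := h.K_F r.rev
  rw [Fin.rev_rev] at hr
  have h1 := mul_mul_of_mul (h.K_F_same r.rev) hr
  have h2 := mul_mul_of_mul hr (h.K_F_same r.rev)
  rw [braidGen_F, mul_sub, mul_smul_comm, h1, h2, sub_mul, smul_mul_assoc]
  match_scalars <;> field_simp

lemma Kinv_braidGen_E : x (.Kinv r) * braidGen v x r (.E r.rev) =
    v⁻¹ • (braidGen v x r (.E r.rev) * x (.Kinv r)) :=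
  inv_mul_of_mul hv0 (h.K_Kinv r) (h.Kinv_K r) (h.K_braidGen_E hv0 r)

lemma Kinv_braidGen_F : x (.Kinv r) * braidGen v x r (.F r.rev) =
    v • (braidGen v x r (.F r.rev) * x (.Kinv r)) := by
  simpa using inv_mul_of_mul (inv_ne_zero hv0) (h.K_Kinv r) (h.Kinv_K r) (h.K_braidGen_F hv0 r)

include hv

lemma braidGen_E_mul_E : braidGen v x r (.E r.rev) * x (.E r) =
    v • (x (.E r) * braidGen v x r (.E r.rev)) := by
  have := (h.serre_E r).rootVec_mul hv0
  rw [braidGen_E, rootVec_eq_iff hv, smul_mul_assoc, this, mul_smul_comm, smul_comm]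

lemma E_mul_braidGen_E : x (.E r.rev) * braidGen v x r (.E r.rev) =
    v • (braidGen v x r (.E r.rev) * x (.E r.rev)) := by
  have h' := h.serre_E r.rev
  rw [Fin.rev_rev] at h'
  have := h'.mul_rootVec hv0
  rw [braidGen_E, rootVec_eq_iff hv, mul_smul_comm, this, smul_mul_assoc, smul_comm]

lemma braidGen_F_eq : braidGen v x r (.F r.rev) =
    (-(v * (v - v⁻¹))) • rootVec v (x (.F r)) (x (.F r.rev)) := by
  rw [braidGen_F, neg_smul, mul_smul, ← rootVec_eq_iff hv, smul_sub, smul_smul, mul_inv_cancel₀ hv0,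
    one_smul, neg_sub]

lemma braidGen_F_mul_F : braidGen v x r (.F r.rev) * x (.F r) =
    v • (x (.F r) * braidGen v x r (.F r.rev)) := by
  have := (h.serre_F r).rootVec_mul hv0
  rw [h.braidGen_F_eq hv0 hv, smul_mul_assoc, this, mul_smul_comm, smul_comm]

lemma F_mul_braidGen_F : x (.F r.rev) * braidGen v x r (.F r.rev) =
    v • (braidGen v x r (.F r.rev) * x (.F r.rev)) := by
  have h' := h.serre_F r.rev
  rw [Fin.rev_rev] at h'
  have := h'.mul_rootVec hv0
  rw [h.braidGen_F_eq hv0 hv, mul_smul_comm, this, smul_mul_assoc, smul_comm]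

lemma braidGen_E_F : braidGen v x r (.E r.rev) * x (.F r) - x (.F r) * braidGen v x r (.E r.rev) =
    v⁻¹ • (x (.E r.rev) * x (.K r)) := by
  have hs := sq_sub_one_ne_zero hv0 hv
  have h1 := h.E_F_same r
  have h2 := (h.E_F r.rev).eq
  rw [Fin.rev_rev] at h2
  have h3 := h.K_E r
  have h4 := h.Kinv_E hv0 r
  rw [braidGen_E]
  linear_combination (norm := skip) x (.E r.rev) * h1 - v⁻¹ • (h1 * x (.E r.rev)) + h2 * x (.E r)
    - v⁻¹ • (x (.E r) * h2) - (v⁻¹ * (v - v⁻¹)⁻¹) • h3 + (v⁻¹ * (v - v⁻¹)⁻¹) • h4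
  simp only [smul_mul_assoc, mul_smul_comm, sub_mul, mul_sub, mul_assoc]
  match_scalars <;> field_simp <;> ring

lemma braidGen_E_F_rev : braidGen v x r (.E r.rev) * x (.F r.rev)
    - x (.F r.rev) * braidGen v x r (.E r.rev) = -(x (.E r) * x (.Kinv r.rev)) := by
  have hs := sq_sub_one_ne_zero hv0 hv
  have h1 := h.E_F_same r.rev
  have h2 := (h.E_F r).eq
  have h3 := h.K_E r.rev
  have h4 := h.Kinv_E hv0 r.rev
  rw [Fin.rev_rev] at h3 h4
  rw [braidGen_E]
  linear_combination (norm := skip) h1 * x (.E r) - v⁻¹ • (x (.E r) * h1) + x (.E r.rev) * h2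
    - v⁻¹ • (h2 * x (.E r.rev)) + (v - v⁻¹)⁻¹ • h3 - (v - v⁻¹)⁻¹ • h4
  simp only [smul_mul_assoc, mul_smul_comm, sub_mul, mul_sub, mul_assoc]
  match_scalars <;> field_simp <;> ring

lemma E_braidGen_F : x (.E r) * braidGen v x r (.F r.rev) - braidGen v x r (.F r.rev) * x (.E r) =
    x (.F r.rev) * x (.Kinv r) := by
  have hs := sq_sub_one_ne_zero hv0 hv
  have h1 := h.E_F_same r
  have h2 := (h.E_F r).eq
  have h3 := h.K_F r
  have h4 := h.Kinv_F hv0 r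
  rw [braidGen_F]
  linear_combination (norm := skip) h1 * x (.F r.rev) - v • (x (.F r.rev) * h1) + x (.F r) * h2
    - v • (h2 * x (.F r)) + (v - v⁻¹)⁻¹ • h3 - (v - v⁻¹)⁻¹ • h4
  simp only [smul_mul_assoc, mul_smul_comm, sub_mul, mul_sub, mul_assoc]
  match_scalars <;> field_simp <;> ring

/-- `T_r (T_j (E_r)) = E_j`. -/
lemma braidGen_E_comm : braidGen v x r (.E r) * braidGen v x r (.E r.rev)
    - v⁻¹ • (braidGen v x r (.E r.rev) * braidGen v x r (.E r)) = x (.E r.rev) := by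
  have h1 := h.Kinv_braidGen_E hv0 r
  have h2 := h.braidGen_E_F hv0 hv r
  have h3 := h.Kinv_E hv0 r
  have h4 := h.Kinv_K r
  rw [braidGen_E_same]
  generalize braidGen v x r (.E r.rev) = e at *
  linear_combination (norm := skip) x (.Kinv r) * h2 - h1 * x (.F r) + v⁻¹ • (h3 * x (.K r))
    + x (.E r.rev) * h4
  simp only [smul_mul_assoc, mul_smul_comm, sub_mul, mul_sub, mul_assoc, neg_mul, mul_neg, mul_one]
  match_scalars <;> field_simp <;> ring

/-- `T_r (T_j (F_r)) = F_j`; the left-hand side is `-v⁻¹ T_r (T_j (F_r))`. -/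
lemma braidGen_F_comm : braidGen v x r (.F r) * braidGen v x r (.F r.rev)
    - v⁻¹ • (braidGen v x r (.F r.rev) * braidGen v x r (.F r)) = -(v⁻¹ • x (.F r.rev)) := by
  have h1 := h.K_braidGen_F hv0 r
  have h2 := h.E_braidGen_F hv0 hv r
  have h4 := h.Kinv_K r
  rw [braidGen_F_same]
  generalize braidGen v x r (.F r.rev) = f at *
  linear_combination (norm := skip) -(x (.E r) * h1) - v⁻¹ • (h2 * x (.K r))
    - v⁻¹ • (x (.F r.rev) * h4)
  simp only [smul_mul_assoc, mul_smul_comm, sub_mul, mul_sub, mul_assoc, neg_mul, mul_neg, mul_one]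
  match_scalars <;> field_simp <;> ring

/-- Lusztig's operator preserves the defining relations. -/
theorem braid : Sl3Rel v (braidGen v x r) := by
  have hE := h.braidGen_E_comm hv0 hv r
  have hF := h.braidGen_F_comm hv0 hv r
  have hKE := h.K_E r.rev
  have hKF := h.K_F r.rev
  have hEF := (h.E_F r.rev).eq
  have hKK := h.K_K r.rev
  have hLL := h.Kinv_Kinv r.rev
  have hLK := h.K_Kinv_comm r
  have hLK' := h.K_Kinv_comm r.rev
  simp only [Fin.rev_rev] at hKE hKF hEF hKK hLL hLK'
  have hEE : braidGen v x r (.E r) * x (.E r.rev) = v • (x (.E r.rev) * braidGen v x r (.E r)) := by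
    rw [braidGen_E_same]
    linear_combination (norm := skip) x (.Kinv r) * hEF - h.Kinv_E hv0 r * x (.F r)
    simp only [smul_mul_assoc, mul_smul_comm, mul_assoc, neg_mul, mul_neg, sub_mul, mul_sub]
    match_scalars <;> ring
  have hFF : braidGen v x r (.F r) * x (.F r.rev) = v • (x (.F r.rev) * braidGen v x r (.F r)) := by
    rw [braidGen_F_same]
    linear_combination (norm := skip) -(x (.E r) * h.K_F r) - v • ((h.E_F r).eq * x (.K r))
    simp only [smul_mul_assoc, mul_smul_comm, mul_assoc, neg_mul, mul_neg, sub_mul, mul_sub]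
    match_scalars <;> ring
  have hKFE : x (.K r) * (x (.F r) * x (.E r)) = x (.F r) * x (.E r) * x (.K r) := by
    rw [mul_mul_of_mul (h.K_F_same r) (h.K_E_same r), inv_mul_cancel₀ (pow_ne_zero 2 hv0), one_smul]
  constructor
  · refine forall_fin_two_rev r ?_ ?_
    · rw [braidGen_K_same, braidGen_Kinv_same]
      exact h.Kinv_K r
    · rw [braidGen_K, braidGen_Kinv, hLL.eq, mul_assoc, ← mul_assoc (x (.K r)), h.K_Kinv, one_mul,
        h.K_Kinv]
  · refine forall_fin_two_rev r ?_ ?_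
    · rw [braidGen_K_same, braidGen_Kinv_same]
      exact h.K_Kinv r
    · rw [braidGen_K, braidGen_Kinv, hKK.eq, mul_assoc, ← mul_assoc (x (.Kinv r)), h.Kinv_K,
        one_mul, h.Kinv_K]
  · have hc : Commute (braidGen v x r (.K r)) (braidGen v x r (.K r.rev)) := by
      rw [braidGen_K_same, braidGen_K]
      exact hLK.mul_right ((h.Kinv_K r).trans (h.K_Kinv r).symm)
    refine forall_fin_two_rev r hc ?_
    rw [Fin.rev_rev]
    exact hc.symm
  · refine forall_fin_two_rev r ?_ ?_
    · rw [braidGen_E_same, braidGen_F_same, braidGen_K_same, braidGen_Kinv_same]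
      have h1 := h.E_F_same r
      linear_combination (norm := skip) -x (.Kinv r) * hKFE + h.Kinv_K r * (x (.F r) * x (.E r))
        - h1 - x (.E r) * h.K_Kinv r * x (.F r)
      simp only [smul_mul_assoc, mul_smul_comm, mul_assoc, neg_mul, mul_neg, sub_mul, mul_sub,
        one_mul, neg_neg]
      match_scalars <;> ring
    · have h1 := h.braidGen_E_F hv0 hv r
      have h2 := h.braidGen_E_F_rev hv0 hv r
      have h3 := h.E_F_same r
      have h4 := h.E_F_same r.rev
      have h5 := h.Kinv_F hv0 r.rev
      rw [Fin.rev_rev] at h5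
      rw [braidGen_F, braidGen_K, braidGen_Kinv]
      generalize braidGen v x r (.E r.rev) = e at *
      linear_combination (norm := skip) h1 * x (.F r.rev) + x (.F r) * h2 - v • (h2 * x (.F r))
        - v • (x (.F r.rev) * h1) + v⁻¹ • (x (.E r.rev) * h.K_F r) + v • (x (.E r) * h5)
        + h4 * x (.K r) + h3 * x (.Kinv r.rev) + (v - v⁻¹)⁻¹ • hLL.eq
        - (v - v⁻¹)⁻¹ • hLK'.eq
      simp only [smul_mul_assoc, mul_smul_comm, mul_assoc, neg_mul, mul_neg, sub_mul, mul_sub]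
      match_scalars <;> field_simp <;> ring
  · refine forall_fin_two_rev r ?_ ?_
    · have h1 := h.braidGen_F_mul_F hv0 hv r
      have h2 := h.Kinv_braidGen_F hv0 r
      rw [braidGen_E_same, Commute, SemiconjBy]
      generalize braidGen v x r (.F r.rev) = f at *
      linear_combination (norm := skip) v⁻¹ • (x (.Kinv r) * h1) - v⁻¹ • (h2 * x (.F r))
      simp only [smul_mul_assoc, mul_smul_comm, mul_assoc, neg_mul, mul_neg, sub_mul, mul_sub]
      match_scalars <;> field_simp <;> ring
    · have h1 := h.braidGen_E_mul_E hv0 hv r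
      have h2 := h.K_braidGen_E hv0 r
      rw [Fin.rev_rev, braidGen_F_same, Commute, SemiconjBy]
      generalize braidGen v x r (.E r.rev) = e at *
      linear_combination (norm := skip) -(h1 * x (.K r)) + x (.E r) * h2
      simp only [smul_mul_assoc, mul_smul_comm, mul_assoc, neg_mul, mul_neg, sub_mul, mul_sub]
      match_scalars <;> ring
  · refine forall_fin_two_rev r ?_ ?_
    · rw [braidGen_K_same, braidGen_E_same, mul_neg,
        mul_mul_of_mul (one_smul K _).symm (h.Kinv_F_same hv0 r), one_mul, neg_mul, smul_neg]
    · rw [braidGen_K, mul_left_of_mul (h.K_rev_braidGen_E hv0 r) (h.K_braidGen_E hv0 r), pow_two]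
  · refine forall_fin_two_rev r ?_ ?_
    · rw [braidGen_K_same, h.Kinv_braidGen_E hv0]
    · rw [Fin.rev_rev, braidGen_K, braidGen_E_same, mul_neg, mul_left_of_mul
        (mul_mul_of_mul (hLK.symm.eq.trans (one_smul K _).symm) hKF)
        (mul_mul_of_mul (((h.K_Kinv r).trans (h.Kinv_K r).symm).trans (one_smul K _).symm)
          (h.K_F_same r)), neg_mul, smul_neg]
      congr 2
      field_simp
  · refine forall_fin_two_rev r ?_ ?_
    · rw [braidGen_K_same, braidGen_F_same, mul_neg, mul_mul_of_mul (h.Kinv_E_same hv0 r)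
        (((h.Kinv_K r).trans (h.K_Kinv r).symm).trans (one_smul K _).symm), mul_one, neg_mul,
        smul_neg]
    · rw [braidGen_K, mul_left_of_mul (h.K_rev_braidGen_F hv0 r) (h.K_braidGen_F hv0 r), pow_two,
        mul_inv]
  · refine forall_fin_two_rev r ?_ ?_
    · rw [braidGen_K_same, h.Kinv_braidGen_F hv0]
    · rw [Fin.rev_rev, braidGen_K, braidGen_F_same, mul_neg, mul_left_of_mul
        (mul_mul_of_mul hKE (hKK.eq.trans (one_smul K _).symm))
        (mul_mul_of_mul (h.K_E_same r) (one_smul K _).symm), neg_mul, smul_neg]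
      congr 2
      field_simp
  · refine forall_fin_two_rev r ?_ ?_
    · refine serreRel_of_mul_rootVec hv0 hv ?_
      rw [rootVec, hE, mul_smul_comm, hEE, smul_mul_assoc, smul_comm]
    · rw [Fin.rev_rev]
      refine serreRel_of_rootVec_mul hv0 hv ?_
      rw [rootVec, hE, mul_smul_comm, smul_mul_assoc, h.E_mul_braidGen_E hv0 hv, smul_comm]
  · refine forall_fin_two_rev r ?_ ?_
    · refine serreRel_of_mul_rootVec hv0 hv ?_
      rw [rootVec, hF]
      simp only [mul_smul_comm, smul_mul_assoc, mul_neg, neg_mul, smul_neg, hFF]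
      match_scalars <;> ring
    · rw [Fin.rev_rev]
      refine serreRel_of_rootVec_mul hv0 hv ?_
      rw [rootVec, hF]
      simp only [mul_smul_comm, smul_mul_assoc, mul_neg, neg_mul, smul_neg,
        h.F_mul_braidGen_F hv0 hv]
      match_scalars <;> ring

end Sl3Rel

end Sl3Relations

/-! ### Braid group operators and root vectors for a power of `sl_3` -/

/-- The generator of the copy `s` of `U_v(sl_3)`, for the labelling `nd` of the nodes. -/
def Gen.node {I : Type} {N : ℕ} (nd : Fin 2 × Fin N ≃ I) (s : Fin N) : Gen (Fin 2) → Gen I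
  | .E r => .E (nd (r, s))
  | .F r => .F (nd (r, s))
  | .K r => .K (nd (r, s))
  | .Kinv r => .Kinv (nd (r, s))

section UqRelations

variable {I : Type} (C : Matrix I I ℤ)

namespace Uq

lemma K_mul_Kinv (i : I) : gen C (.K i) * gen C (.Kinv i) = 1 := by
  have h := RingQuot.mkAlgHom_rel Kq (UqRel.K_Kinv (C := C) i)
  simp only [map_mul, map_one] at h
  exact h

lemma Kinv_mul_K (i : I) : gen C (.Kinv i) * gen C (.K i) = 1 := by
  have h := RingQuot.mkAlgHom_rel Kq (UqRel.Kinv_K (C := C) i)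
  simp only [map_mul, map_one] at h
  exact h

lemma commute_K_K (i j : I) : Commute (gen C (.K i)) (gen C (.K j)) := by
  have h := RingQuot.mkAlgHom_rel Kq (UqRel.K_K (C := C) i j)
  simp only [map_mul] at h
  exact h

lemma E_F_same (i : I) : gen C (.E i) * gen C (.F i) - gen C (.F i) * gen C (.E i) =
    (qi C i - (qi C i)⁻¹)⁻¹ • (gen C (.K i) - gen C (.Kinv i)) := by
  have h := RingQuot.mkAlgHom_rel Kq (UqRel.E_F_same (C := C) i)
  simp only [map_mul, map_sub, map_smul] at h
  exact h

lemma commute_E_F {i j : I} (hij : i ≠ j) : Commute (gen C (.E i)) (gen C (.F j)) := by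
  have h := RingQuot.mkAlgHom_rel Kq (UqRel.E_F (C := C) i j hij)
  simp only [map_mul] at h
  exact h

lemma K_mul_E (i j : I) : gen C (.K i) * gen C (.E j) =
    qi C i ^ cartan C i j • (gen C (.E j) * gen C (.K i)) := by
  have h := RingQuot.mkAlgHom_rel Kq (UqRel.K_E (C := C) i j)
  simp only [map_mul, map_smul] at h
  have h' : gen C (.K i) * gen C (.E j) * gen C (.Kinv i) = qi C i ^ cartan C i j • gen C (.E j) := h
  rw [← smul_mul_assoc, ← h', mul_assoc, Kinv_mul_K, mul_one]

lemma K_mul_F (i j : I) : gen C (.K i) * gen C (.F j) =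
    qi C i ^ (-cartan C i j) • (gen C (.F j) * gen C (.K i)) := by
  have h := RingQuot.mkAlgHom_rel Kq (UqRel.K_F (C := C) i j)
  simp only [map_mul, map_smul] at h
  have h' : gen C (.K i) * gen C (.F j) * gen C (.Kinv i) =
    qi C i ^ (-cartan C i j) • gen C (.F j) := h
  rw [← smul_mul_assoc, ← h', mul_assoc, Kinv_mul_K, mul_one]

lemma serre_E (i j : I) (hij : i ≠ j) : serre C (fun i => gen C (.E i)) i j = 0 := by
  have h := RingQuot.mkAlgHom_rel Kq (UqRel.serre_E (C := C) i j hij)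
  rw [map_serre, map_zero] at h
  exact h

lemma serre_F (i j : I) (hij : i ≠ j) : serre C (fun i => gen C (.F i)) i j = 0 := by
  have h := RingQuot.mkAlgHom_rel Kq (UqRel.serre_F (C := C) i j hij)
  rw [map_serre, map_zero] at h
  exact h

lemma incl_E (i : I) : incl C (Uplus.E C i) = gen C (.E i) := Uplus.lift_E C _ _ i

lemma exists_lift {A : Type} [Ring A] [Algebra Kq A] (y : Gen I → A)
    (hy : ∀ a b, UqRel C a b → FreeAlgebra.lift Kq y a = FreeAlgebra.lift Kq y b) :
    ∃ f : Uq C →ₐ[Kq] A, ∀ g, f (gen C g) = y g := by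
  refine ⟨RingQuot.liftAlgHom Kq ⟨FreeAlgebra.lift Kq y, hy⟩, fun g => ?_⟩
  have h := RingQuot.liftAlgHom_mkAlgHom_apply (S := Kq) (s := UqRel C)
    (FreeAlgebra.lift Kq y) hy (FreeAlgebra.ι Kq g)
  rw [FreeAlgebra.lift_ι_apply] at h
  exact h

end Uq

end UqRelations

lemma commute_inv_of_commute {A : Type} [Ring A] {k l x : A} (hkl : k * l = 1) (hlk : l * k = 1)
    (h : Commute k x) : Commute l x := by
  have h1 : x * l = l * x := by
    calc x * l = l * (k * x) * l := by rw [← mul_assoc, hlk, one_mul]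
      _ = l * x * (k * l) := by rw [h.eq]; simp only [mul_assoc]
      _ = l * x := by rw [hkl, mul_one]
  exact h1.symm

section BraidAction

variable {I : Type} {C : Matrix I I ℤ} {v : Kq} {N : ℕ} {nd : Fin 2 × Fin N ≃ I}

namespace IsA2Power

lemma cartan_same (hC : IsA2Power C v nd) (r : Fin 2) (s : Fin N) :
    cartan C (nd (r, s)) (nd (r, s)) = 2 := by simp [hC.cartan_eq]

lemma cartan_rev (hC : IsA2Power C v nd) (r : Fin 2) (s : Fin N) :
    cartan C (nd (r, s)) (nd (r.rev, s)) = -1 := by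
  simp [hC.cartan_eq, (rev_ne r).symm]

lemma cartan_far (hC : IsA2Power C v nd) (a b : Fin 2) {s t : Fin N} (hst : s ≠ t) :
    cartan C (nd (a, s)) (nd (b, t)) = 0 := by
  simp [hC.cartan_eq, hst]

lemma sl3Rel_gen (hC : IsA2Power C v nd) (s : Fin N) :
    Sl3Rel v fun g => Uq.gen C (Gen.node nd s g) where
  K_Kinv _ := Uq.K_mul_Kinv C _
  Kinv_K _ := Uq.Kinv_mul_K C _
  K_K _ := Uq.commute_K_K C _ _
  E_F_same r := by
    have h := Uq.E_F_same C (nd (r, s))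
    rw [hC.qi_eq] at h
    exact h
  E_F r := Uq.commute_E_F C fun h => rev_ne r (congrArg Prod.fst (nd.injective h)).symm
  K_E_same r := by
    have h := Uq.K_mul_E C (nd (r, s)) (nd (r, s))
    rw [hC.qi_eq, hC.cartan_same] at h
    exact_mod_cast h
  K_E r := by
    have h := Uq.K_mul_E C (nd (r, s)) (nd (r.rev, s))
    rw [hC.qi_eq, hC.cartan_rev, zpow_neg_one] at h
    exact h
  K_F_same r := by
    have h := Uq.K_mul_F C (nd (r, s)) (nd (r, s))
    rw [hC.qi_eq, hC.cartan_same, zpow_neg] at h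
    exact_mod_cast h
  K_F r := by
    have h := Uq.K_mul_F C (nd (r, s)) (nd (r.rev, s))
    rw [hC.qi_eq, hC.cartan_rev, neg_neg, zpow_one] at h
    exact h
  serre_E r := ((hC.serre_eq_zero_iff r).1 (Uq.serre_E C)).serre s
  serre_F r := ((hC.serre_eq_zero_iff r).1 (Uq.serre_F C)).serre s

lemma commute_of_serre (hC : IsA2Power C v nd) {A : Type} [Ring A] [Algebra Kq A] {x : I → A}
    (h : ∀ i j, i ≠ j → serre C x i j = 0) (a b : Fin 2) {s t : Fin N} (hst : s ≠ t) :
    Commute (x (nd (a, s))) (x (nd (b, t))) := by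
  have hc := (hC.serre_eq_zero_iff a).1 h
  revert b
  exact forall_fin_two_rev a (hc.comm_left s t) (hc.comm s t hst)

lemma commute_gen (hC : IsA2Power C v nd) {s t : Fin N} (hst : s ≠ t) (g g' : Gen (Fin 2)) :
    Commute (Uq.gen C (Gen.node nd s g)) (Uq.gen C (Gen.node nd t g')) := by
  have hK : ∀ {s t : Fin N}, s ≠ t → ∀ a g', Commute (Uq.gen C (.K (nd (a, s))))
      (Uq.gen C (Gen.node nd t g')) := by
    intro s t hst a g'
    cases g' with
    | E b =>
      have h := Uq.K_mul_E C (nd (a, s)) (nd (b, t))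
      rw [hC.cartan_far a b hst, zpow_zero, one_smul] at h
      exact h
    | F b =>
      have h := Uq.K_mul_F C (nd (a, s)) (nd (b, t))
      rw [hC.cartan_far a b hst, neg_zero, zpow_zero, one_smul] at h
      exact h
    | K b => exact Uq.commute_K_K C _ _
    | Kinv b =>
      exact (commute_inv_of_commute (Uq.K_mul_Kinv C _) (Uq.Kinv_mul_K C _)
        (Uq.commute_K_K C _ _)).symm
  have hL : ∀ {s t : Fin N}, s ≠ t → ∀ a g', Commute (Uq.gen C (.Kinv (nd (a, s))))
      (Uq.gen C (Gen.node nd t g')) := fun hst a g' =>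
    commute_inv_of_commute (Uq.K_mul_Kinv C _) (Uq.Kinv_mul_K C _) (hK hst a g')
  have hEF : ∀ {s t : Fin N}, s ≠ t → ∀ a b, Commute (Uq.gen C (.E (nd (a, s))))
      (Uq.gen C (.F (nd (b, t)))) := fun hst a b =>
    Uq.commute_E_F C fun h => hst (congrArg Prod.snd (nd.injective h))
  cases g with
  | K a => exact hK hst a g'
  | Kinv a => exact hL hst a g'
  | E a => cases g' with
    | K b => exact (hK hst.symm b (.E a)).symm
    | Kinv b => exact (hL hst.symm b (.E a)).symm
    | E b => exact hC.commute_of_serre (Uq.serre_E C) a b hst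
    | F b => exact hEF hst a b
  | F a => cases g' with
    | K b => exact (hK hst.symm b (.F a)).symm
    | Kinv b => exact (hL hst.symm b (.F a)).symm
    | E b => exact (hEF hst.symm b a).symm
    | F b => exact hC.commute_of_serre (Uq.serre_F C) a b hst

/-- The homomorphism from `U_v` given by commuting copies of the generators of `U_v(sl_3)`. -/
lemma exists_lift_Uq (hC : IsA2Power C v nd) {A : Type} [Ring A] [Algebra Kq A]
    (x : Fin N → Gen (Fin 2) → A) (hx : ∀ s, Sl3Rel v (x s))
    (hcomm : ∀ s t, s ≠ t → ∀ g g', Commute (x s g) (x t g')) :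
    ∃ f : Uq C →ₐ[Kq] A, ∀ s g, f (Uq.gen C (Gen.node nd s g)) = x s g := by
  let y : Gen I → A
    | .E i => x (nd.symm i).2 (.E (nd.symm i).1)
    | .F i => x (nd.symm i).2 (.F (nd.symm i).1)
    | .K i => x (nd.symm i).2 (.K (nd.symm i).1)
    | .Kinv i => x (nd.symm i).2 (.Kinv (nd.symm i).1)
  have hyE : ∀ a s, y (.E (nd (a, s))) = x s (.E a) := fun a s => by simp [y]
  have hyF : ∀ a s, y (.F (nd (a, s))) = x s (.F a) := fun a s => by simp [y]
  have hyK : ∀ a s, y (.K (nd (a, s))) = x s (.K a) := fun a s => by simp [y]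
  have hyL : ∀ a s, y (.Kinv (nd (a, s))) = x s (.Kinv a) := fun a s => by simp [y]
  have hsE : ∀ i j, i ≠ j → serre C (fun i => y (.E i)) i j = 0 := by
    refine (hC.serre_eq_zero_iff 0).2 ⟨hC.ne_zero, hC.sub_inv_ne_zero, ?_, ?_, ?_, ?_, ?_⟩ <;>
      simp only [hyE]
    · exact fun s => (hx s).serre_E 0
    · exact fun s => (hx s).serre_E (Fin.rev 0)
    · exact fun s t => (eq_or_ne s t).elim (fun e => e ▸ Commute.refl _) fun h => hcomm s t h _ _
    · exact fun s t => (eq_or_ne s t).elim (fun e => e ▸ Commute.refl _) fun h => hcomm s t h _ _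
    · exact fun s t h => hcomm s t h _ _
  have hsF : ∀ i j, i ≠ j → serre C (fun i => y (.F i)) i j = 0 := by
    refine (hC.serre_eq_zero_iff 0).2 ⟨hC.ne_zero, hC.sub_inv_ne_zero, ?_, ?_, ?_, ?_, ?_⟩ <;>
      simp only [hyF]
    · exact fun s => (hx s).serre_F 0
    · exact fun s => (hx s).serre_F (Fin.rev 0)
    · exact fun s t => (eq_or_ne s t).elim (fun e => e ▸ Commute.refl _) fun h => hcomm s t h _ _
    · exact fun s t => (eq_or_ne s t).elim (fun e => e ▸ Commute.refl _) fun h => hcomm s t h _ _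
    · exact fun s t h => hcomm s t h _ _
  -- moving the factor `K⁻¹` of a relation `K x K⁻¹ = c x` to the right
  have hconj : ∀ (s : Fin N) (a : Fin 2) (z : A) (c : Kq),
      x s (.K a) * z = c • (z * x s (.K a)) → x s (.K a) * z * x s (.Kinv a) = c • z := by
    intro s a z c h
    rw [h, smul_mul_assoc, mul_assoc, (hx s).K_Kinv, mul_one]
  obtain ⟨f, hf⟩ := Uq.exists_lift C y (by
    intro a b h
    cases h with
    | K_Kinv i =>
      obtain ⟨⟨a, s⟩, rfl⟩ := nd.surjective i
      simp only [fr, map_mul, map_one, FreeAlgebra.lift_ι_apply, hyK, hyL]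
      exact (hx s).K_Kinv a
    | Kinv_K i =>
      obtain ⟨⟨a, s⟩, rfl⟩ := nd.surjective i
      simp only [fr, map_mul, map_one, FreeAlgebra.lift_ι_apply, hyK, hyL]
      exact (hx s).Kinv_K a
    | K_K i j =>
      obtain ⟨⟨a, s⟩, rfl⟩ := nd.surjective i
      obtain ⟨⟨b, t⟩, rfl⟩ := nd.surjective j
      simp only [fr, map_mul, FreeAlgebra.lift_ι_apply, hyK]
      rcases eq_or_ne s t with rfl | hst
      · revert b
        exact forall_fin_two_rev a rfl ((hx s).K_K a)
      · exact hcomm s t hst _ _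
    | E_F_same i =>
      obtain ⟨⟨a, s⟩, rfl⟩ := nd.surjective i
      simp only [fr, map_mul, map_sub, map_smul, FreeAlgebra.lift_ι_apply, hyE, hyF, hyK, hyL,
        hC.qi_eq]
      exact (hx s).E_F_same a
    | E_F i j hij =>
      obtain ⟨⟨a, s⟩, rfl⟩ := nd.surjective i
      obtain ⟨⟨b, t⟩, rfl⟩ := nd.surjective j
      simp only [fr, map_mul, FreeAlgebra.lift_ι_apply, hyE, hyF]
      rcases eq_or_ne s t with rfl | hst
      · revert b
        exact forall_fin_two_rev a (fun h => absurd rfl h) fun _ => (hx s).E_F a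
      · exact hcomm s t hst _ _
    | K_E i j =>
      obtain ⟨⟨a, s⟩, rfl⟩ := nd.surjective i
      obtain ⟨⟨b, t⟩, rfl⟩ := nd.surjective j
      simp only [fr, map_mul, map_smul, FreeAlgebra.lift_ι_apply, hyE, hyK, hyL, hC.qi_eq]
      refine hconj s a _ _ ?_
      rcases eq_or_ne s t with rfl | hst
      · revert b
        refine forall_fin_two_rev a ?_ ?_
        · rw [hC.cartan_same]; exact_mod_cast (hx s).K_E_same a
        · rw [hC.cartan_rev, zpow_neg_one]; exact (hx s).K_E a
      · rw [hC.cartan_far a b hst, zpow_zero, one_smul]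
        exact hcomm s t hst _ _
    | K_F i j =>
      obtain ⟨⟨a, s⟩, rfl⟩ := nd.surjective i
      obtain ⟨⟨b, t⟩, rfl⟩ := nd.surjective j
      simp only [fr, map_mul, map_smul, FreeAlgebra.lift_ι_apply, hyF, hyK, hyL, hC.qi_eq]
      refine hconj s a _ _ ?_
      rcases eq_or_ne s t with rfl | hst
      · revert b
        refine forall_fin_two_rev a ?_ ?_
        · rw [hC.cartan_same, zpow_neg]; exact_mod_cast (hx s).K_F_same a
        · rw [hC.cartan_rev, neg_neg, zpow_one]; exact (hx s).K_F a
      · rw [hC.cartan_far a b hst, neg_zero, zpow_zero, one_smul]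
        exact hcomm s t hst _ _
    | serre_E i j hij =>
      rw [map_serre, map_zero]
      simp only [fr, FreeAlgebra.lift_ι_apply]
      exact hsE i j hij
    | serre_F i j hij =>
      rw [map_serre, map_zero]
      simp only [fr, FreeAlgebra.lift_ι_apply]
      exact hsF i j hij)
  refine ⟨f, fun s g => (hf _).trans ?_⟩
  cases g with
  | E a => exact hyE a s
  | F a => exact hyF a s
  | K a => exact hyK a s
  | Kinv a => exact hyL a s

end IsA2Power

lemma commute_braidGen {K A : Type} [Field K] [Ring A] [Algebra K A] {v : K}
    {x : Gen (Fin 2) → A} {z : A} (h : ∀ g, Commute z (x g)) (r : Fin 2) (g : Gen (Fin 2)) :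
    Commute z (braidGen v x r g) := by
  cases g with
  | E a =>
    rw [braidGen]
    split_ifs
    · exact ((h _).mul_right (h _)).neg_right
    · exact ((h _).mul_right (h _)).sub_right (((h _).mul_right (h _)).smul_right _)
  | F a =>
    rw [braidGen]
    split_ifs
    · exact ((h _).mul_right (h _)).neg_right
    · exact ((h _).mul_right (h _)).sub_right (((h _).mul_right (h _)).smul_right _)
  | K a =>
    rw [braidGen]
    split_ifs
    · exact h _
    · exact (h _).mul_right (h _)
  | Kinv a =>
    rw [braidGen]
    split_ifs
    · exact h _
    · exact (h _).mul_right (h _)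

namespace IsA2Power

/-- Lusztig's operator `T_i` acts on the copy of `U_v(sl_3)` containing the node `i`, and fixes the
other copies. -/
lemma exists_braidHom (hC : IsA2Power C v nd) (r : Fin 2) (s : Fin N) :
    ∃ f : Uq C →ₐ[Kq] Uq C,
      (∀ g, f (Uq.gen C (Gen.node nd s g)) =
        braidGen v (fun g => Uq.gen C (Gen.node nd s g)) r g) ∧
      ∀ t, t ≠ s → ∀ g, f (Uq.gen C (Gen.node nd t g)) = Uq.gen C (Gen.node nd t g) := by
  obtain ⟨f, hf⟩ := hC.exists_lift_Uq
    (fun t => if t = s then braidGen v (fun g => Uq.gen C (Gen.node nd s g)) r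
      else fun g => Uq.gen C (Gen.node nd t g)) (fun t => by
        split_ifs
        · exact (hC.sl3Rel_gen s).braid hC.ne_zero hC.sub_inv_ne_zero r
        · exact hC.sl3Rel_gen t) (fun t t' htt' g g' => by
        split_ifs with h h' h'
        · exact absurd (h.trans h'.symm) htt'
        · exact (commute_braidGen (fun g => hC.commute_gen (fun e => h' e) g' g) r g).symm
        · exact commute_braidGen (fun g' => hC.commute_gen (fun e => h e) g g') r g'
        · exact hC.commute_gen htt' g g')
  refine ⟨f, fun g => ?_, fun t ht g => ?_⟩
  · rw [hf, if_pos rfl]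
  · rw [hf, if_neg ht]

end IsA2Power

lemma Uq.Kpow_zero (i : I) : Uq.Kpow C i 0 = 1 := by simp [Uq.Kpow]

lemma Uq.Kpow_one (i : I) : Uq.Kpow C i 1 = Uq.gen C (.K i) := by simp [Uq.Kpow]

lemma Uq.Kpow_two (i : I) : Uq.Kpow C i 2 = Uq.gen C (.K i) ^ 2 := by simp [Uq.Kpow]

lemma Uq.Kpow_neg_one (i : I) : Uq.Kpow C i (-1) = Uq.gen C (.Kinv i) := by simp [Uq.Kpow]

lemma Uq.Kpow_neg_two (i : I) : Uq.Kpow C i (-2) = Uq.gen C (.Kinv i) ^ 2 := by simp [Uq.Kpow]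

lemma divPow_zero (c : Kq) (x : Uq C) : divPow C c x 0 = 1 := by simp [divPow, qFact_zero]

lemma divPow_one {c : Kq} (hc : c - c⁻¹ ≠ 0) (x : Uq C) : divPow C c x 1 = x := by
  simp [divPow, qFact_one hc]

namespace IsA2Power

/-- Lusztig's operators exist: they act copy by copy. -/
theorem exists_isBraidAction (hC : IsA2Power C v nd) :
    ∃ T : I → Uq C →ₐ[Kq] Uq C, IsBraidAction C T ∧
      (∀ r s g, T (nd (r, s)) (Uq.gen C (Gen.node nd s g)) =
        braidGen v (fun g => Uq.gen C (Gen.node nd s g)) r g) ∧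
      ∀ r s t, t ≠ s → ∀ g,
        T (nd (r, s)) (Uq.gen C (Gen.node nd t g)) = Uq.gen C (Gen.node nd t g) := by
  choose f hf hf' using fun r s => hC.exists_braidHom r s
  let T : I → Uq C →ₐ[Kq] Uq C := fun i => f (nd.symm i).1 (nd.symm i).2
  have hT : ∀ r s, T (nd (r, s)) = f r s := fun r s => by simp [T]
  have hsame : ∀ r s g, T (nd (r, s)) (Uq.gen C (Gen.node nd s g)) =
      braidGen v (fun g => Uq.gen C (Gen.node nd s g)) r g := fun r s g => by rw [hT, hf]
  have hfar : ∀ r s t, t ≠ s → ∀ g,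
      T (nd (r, s)) (Uq.gen C (Gen.node nd t g)) = Uq.gen C (Gen.node nd t g) :=
    fun r s t ht g => by rw [hT, hf' r s t ht]
  have hv := hC.sub_inv_ne_zero
  refine ⟨T, ⟨?_, ?_, ?_, ?_, ?_, ?_⟩, hsame, hfar⟩
  · intro i j
    obtain ⟨⟨a, s⟩, rfl⟩ := nd.surjective i
    obtain ⟨⟨b, t⟩, rfl⟩ := nd.surjective j
    rcases eq_or_ne t s with rfl | hst
    · refine (hsame a t (.K b)).trans ?_
      revert b
      refine forall_fin_two_rev a ?_ ?_
      · rw [Sl3Rel.braidGen_K_same, hC.cartan_same, Uq.Kpow_neg_two, pow_two, ← mul_assoc,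
          Uq.K_mul_Kinv, one_mul]
        rfl
      · rw [Sl3Rel.braidGen_K, hC.cartan_rev, neg_neg, Uq.Kpow_one]
        rfl
    · rw [hC.cartan_far a b hst.symm, neg_zero, Uq.Kpow_zero, mul_one]
      exact hfar a s t hst (.K b)
  · intro i j
    obtain ⟨⟨a, s⟩, rfl⟩ := nd.surjective i
    obtain ⟨⟨b, t⟩, rfl⟩ := nd.surjective j
    rcases eq_or_ne t s with rfl | hst
    · refine (hsame a t (.Kinv b)).trans ?_
      revert b
      refine forall_fin_two_rev a ?_ ?_
      · rw [Sl3Rel.braidGen_Kinv_same, hC.cartan_same, Uq.Kpow_two, pow_two, ← mul_assoc,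
          Uq.Kinv_mul_K, one_mul]
        rfl
      · rw [Sl3Rel.braidGen_Kinv, hC.cartan_rev, Uq.Kpow_neg_one]
        rfl
    · rw [hC.cartan_far a b hst.symm, Uq.Kpow_zero, mul_one]
      exact hfar a s t hst (.Kinv b)
  · intro i
    obtain ⟨⟨a, s⟩, rfl⟩ := nd.surjective i
    exact (hsame a s (.E a)).trans (Sl3Rel.braidGen_E_same _ _ _)
  · intro i
    obtain ⟨⟨a, s⟩, rfl⟩ := nd.surjective i
    exact (hsame a s (.F a)).trans (Sl3Rel.braidGen_F_same _ _ _)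
  · intro i j
    obtain ⟨⟨a, s⟩, rfl⟩ := nd.surjective i
    obtain ⟨⟨b, t⟩, rfl⟩ := nd.surjective j
    rcases eq_or_ne t s with rfl | hst
    · revert b
      refine forall_fin_two_rev a (fun h => absurd rfl h) fun _ => ?_
      refine (hsame a t (.E a.rev)).trans ?_
      rw [Sl3Rel.braidGen_E, hC.cartan_rev, hC.qi_eq]
      simp [Finset.Nat.antidiagonal_succ, divPow_zero, divPow_one hv, sub_eq_add_neg, Gen.node]
    · intro _
      rw [hC.cartan_far a b hst.symm]
      refine (hfar a s t hst (.E b)).trans ?_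
      simp [divPow_zero, Gen.node]
  · intro i j
    obtain ⟨⟨a, s⟩, rfl⟩ := nd.surjective i
    obtain ⟨⟨b, t⟩, rfl⟩ := nd.surjective j
    rcases eq_or_ne t s with rfl | hst
    · revert b
      refine forall_fin_two_rev a (fun h => absurd rfl h) fun _ => ?_
      refine (hsame a t (.F a.rev)).trans ?_
      rw [Sl3Rel.braidGen_F, hC.cartan_rev, hC.qi_eq]
      simp [Finset.Nat.antidiagonal_succ, divPow_zero, divPow_one hv, sub_eq_add_neg, Gen.node]
    · intro _
      rw [hC.cartan_far a b hst.symm]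
      refine (hfar a s t hst (.F b)).trans ?_
      simp [divPow_zero, Gen.node]

end IsA2Power

end BraidAction

/-! ### Root vectors -/

/-- A composition of maps `f s` with distinct indices, of which those with `s ≠ t` fix `x` and
`f t x`. -/
lemma foldr_eq_ite_of_fixed {ι α : Type} [DecidableEq ι] {f : ι → α → α} {t : ι} {x : α}
    (h : ∀ s, s ≠ t → f s x = x) (h' : ∀ s, s ≠ t → f s (f t x) = f t x) :
    ∀ l : List ι, l.Nodup → l.foldr f x = if t ∈ l then f t x else x
  | [], _ => by simp
  | s :: l, hl => by
    rw [List.nodup_cons] at hl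
    rw [List.foldr_cons, foldr_eq_ite_of_fixed h h' l hl.2]
    rcases eq_or_ne s t with rfl | hst
    · simp [hl.1]
    · simp only [List.mem_cons, hst.symm, false_or]
      split_ifs
      · exact h' s hst
      · exact h s hst

lemma foldr_ofFn_eq_of_fixed {α I : Type} {N : ℕ} {f : I → α → α} (i : Fin N → I) {t : Fin N}
    {x : α} (h : ∀ s, s ≠ t → f (i s) x = x) (h' : ∀ s, s ≠ t → f (i s) (f (i t) x) = f (i t) x) :
    (List.ofFn i).foldr f x = f (i t) x := by
  rw [List.ofFn_eq_map, List.foldr_map, foldr_eq_ite_of_fixed (f := fun s => f (i s)) h h' _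
    (List.nodup_finRange N), if_pos (List.mem_finRange t)]

lemma foldr_algHom_prod {R A I : Type} [CommRing R] [Ring A] [Algebra R A] (T : I → A →ₐ[R] A) :
    ∀ (l : List I) (L : List A), l.foldr (fun i y => T i y) L.prod =
      (L.map fun x => l.foldr (fun i y => T i y) x).prod
  | [], L => by simp
  | i :: l, L => by
    simp only [List.foldr_cons]
    rw [foldr_algHom_prod T l L, map_list_prod, List.map_map]
    rfl

lemma ofFn_prod_smul {K A : Type} [Field K] [Ring A] [Algebra K A] (c : K) :
    ∀ {N : ℕ} (x : Fin N → A), (List.ofFn fun s => c • x s).prod = c ^ N • (List.ofFn x).prod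
  | 0, x => by simp
  | N + 1, x => by
    rw [List.ofFn_succ, List.prod_cons, ofFn_prod_smul c fun s => x s.succ, List.ofFn_succ,
      List.prod_cons, smul_mul_smul_comm, pow_succ']

section RootVectors

variable {I : Type} {C : Matrix I I ℤ} {v : Kq} {N : ℕ} {nd : Fin 2 × Fin N ≃ I}
  [Fintype I] [DecidableEq I]

/-- The element `a α_r + b α_j` of the root lattice of the copy `t`, where `j ≠ r`. -/
def rootWt (nd : Fin 2 × Fin N ≃ I) (r : Fin 2) (t : Fin N) (a b : ℤ) : I → ℤ :=
  a • Pi.single (nd (r, t)) 1 + b • Pi.single (nd (r.rev, t)) 1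

lemma rootWt_rev (r : Fin 2) (t : Fin N) (a b : ℤ) :
    rootWt nd r.rev t a b = rootWt nd r t b a := by
  rw [rootWt, rootWt, Fin.rev_rev, add_comm]

lemma rootWt_sub (r : Fin 2) (t : Fin N) (a b a' b' : ℤ) :
    rootWt nd r t a b - rootWt nd r t a' b' = rootWt nd r t (a - a') (b - b') := by
  simp only [rootWt, sub_smul]
  abel

lemma single_eq_rootWt (r : Fin 2) (t : Fin N) :
    (Pi.single (nd (r, t)) 1 : I → ℤ) = rootWt nd r t 1 0 := by
  simp [rootWt]

lemma sum_rootWt_mul (r : Fin 2) (t : Fin N) (a b : ℤ) (f : I → ℤ) :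
    ∑ j, rootWt nd r t a b j * f j = a * f (nd (r, t)) + b * f (nd (r.rev, t)) := by
  simp [rootWt, add_mul, Finset.sum_add_distrib, Pi.single_apply]

namespace IsA2Power

lemma reflection_rootWt (hC : IsA2Power C v nd) (r : Fin 2) (t : Fin N) (a b : ℤ) :
    reflection C (nd (r, t)) (rootWt nd r t a b) = rootWt nd r t (b - a) b := by
  rw [reflection, sum_rootWt_mul, hC.cartan_same, hC.cartan_rev, single_eq_rootWt (nd := nd)]
  have : (a * 2 + b * -1) • rootWt nd r t 1 0 = rootWt nd r t (a * 2 + b * -1) 0 := by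
    simp [rootWt]
  rw [this, rootWt_sub]
  congr 1 <;> ring

lemma reflection_rootWt_far (hC : IsA2Power C v nd) (r : Fin 2) {s t : Fin N} (hst : s ≠ t)
    (a b : ℤ) : reflection C (nd (r, s)) (rootWt nd r t a b) = rootWt nd r t a b := by
  rw [reflection, sum_rootWt_mul, hC.cartan_far _ _ hst, hC.cartan_far _ _ hst]
  simp

lemma foldr_reflection (hC : IsA2Power C v nd) (r : Fin 2) (t : Fin N) (a b : ℤ) :
    (List.ofFn fun s => nd (r, s)).foldr (reflection C) (rootWt nd r t a b) =
      rootWt nd r t (b - a) b := by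
  rw [foldr_ofFn_eq_of_fixed (t := t) (fun s => nd (r, s))
    (fun s hs => hC.reflection_rootWt_far r hs a b) (fun s hs => by
      rw [hC.reflection_rootWt, hC.reflection_rootWt_far r hs]), hC.reflection_rootWt]

lemma gammaWt_rootWt (hC : IsA2Power C v nd) (r : Fin 2) (t : Fin N) (a b : ℤ) :
    gammaWt C (rootWt nd r t a b) = (v - v⁻¹) ^ (a + b) := by
  have hsum : ∀ s : Finset I, ∏ i ∈ s, (v - v⁻¹) ^ rootWt nd r t a b i =
      (v - v⁻¹) ^ ∑ i ∈ s, rootWt nd r t a b i := by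
    intro s
    classical
    induction s using Finset.induction_on with
    | empty => simp
    | insert i s hi ih =>
      rw [Finset.prod_insert hi, Finset.sum_insert hi, zpow_add₀ hC.sub_inv_ne_zero, ih]
  simp only [gammaWt, hC.qi_eq]
  rw [hsum]
  have := sum_rootWt_mul (nd := nd) r t a b fun _ => 1
  simp only [mul_one] at this
  rw [this]

/-- The modified root vectors of the word `(r, j, r)`, folded over the copies of `sl_3`. -/
theorem isRootVectors (hC : IsA2Power C v nd) (r : Fin 2) {o : Fin 2 → List I}
    (ho : ∀ r, o r = List.ofFn fun s => nd (r, s)) :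
    IsRootVectors C o (word r) ![(List.ofFn fun s => Uplus.E C (nd (r, s))).prod,
      (List.ofFn fun s =>
        rootVec v (Uplus.E C (nd (r, s))) (Uplus.E C (nd (r.rev, s)))).prod,
      (List.ofFn fun s => Uplus.E C (nd (r.rev, s))).prod] := by
  obtain ⟨T, hT, hsame, hfar⟩ := hC.exists_isBraidAction
  have hv0 := hC.ne_zero
  have hv := hC.sub_inv_ne_zero
  have hE : ∀ a s, T (nd (a, s)) (Uq.gen C (.E (nd (a.rev, s)))) =
      Uq.gen C (.E (nd (a.rev, s))) * Uq.gen C (.E (nd (a, s)))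
        - v⁻¹ • (Uq.gen C (.E (nd (a, s))) * Uq.gen C (.E (nd (a.rev, s)))) := fun a s =>
    (hsame a s (.E a.rev)).trans (Sl3Rel.braidGen_E _ _ _)
  have hE2 : ∀ a s, T (nd (a, s)) (Uq.gen C (.E (nd (a, s))) * Uq.gen C (.E (nd (a.rev, s)))
        - v⁻¹ • (Uq.gen C (.E (nd (a.rev, s))) * Uq.gen C (.E (nd (a, s))))) =
      Uq.gen C (.E (nd (a.rev, s))) := fun a s => by
    have h := (hC.sl3Rel_gen s).braidGen_E_comm hv0 hv a
    rw [← hsame, ← hsame] at h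
    rw [map_sub, map_smul, map_mul, map_mul]
    exact h
  have hfarE : ∀ a b s t, s ≠ t → T (nd (a, s)) (Uq.gen C (.E (nd (b, t)))) =
      Uq.gen C (.E (nd (b, t))) := fun a b s t hst => hfar a s t hst.symm (.E b)
  have hfar2 : ∀ a b s t, s ≠ t → T (nd (a, s))
      (Uq.gen C (.E (nd (b, t))) * Uq.gen C (.E (nd (b.rev, t)))
        - v⁻¹ • (Uq.gen C (.E (nd (b.rev, t))) * Uq.gen C (.E (nd (b, t))))) =
      Uq.gen C (.E (nd (b, t))) * Uq.gen C (.E (nd (b.rev, t)))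
        - v⁻¹ • (Uq.gen C (.E (nd (b.rev, t))) * Uq.gen C (.E (nd (b, t)))) := fun a b s t hst => by
    rw [map_sub, map_smul, map_mul, map_mul, hfarE a b s t hst, hfarE a b.rev s t hst]
  have hfold : ∀ a t, (List.ofFn fun s => nd (a, s)).foldr (fun i y => T i y)
      (Uq.gen C (.E (nd (a.rev, t)))) = Uq.gen C (.E (nd (a.rev, t))) * Uq.gen C (.E (nd (a, t)))
        - v⁻¹ • (Uq.gen C (.E (nd (a, t))) * Uq.gen C (.E (nd (a.rev, t)))) := fun a t => by
    rw [foldr_ofFn_eq_of_fixed (f := fun i y => T i y) (t := t) (fun s => nd (a, s))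
      (fun s hs => hfarE a a.rev s t hs) (fun s hs => by
        have h := hfar2 a a.rev s t hs
        rw [Fin.rev_rev] at h
        rw [hE, h]), hE]
  have hfold2 : ∀ a t, (List.ofFn fun s => nd (a, s)).foldr (fun i y => T i y)
      (Uq.gen C (.E (nd (a, t))) * Uq.gen C (.E (nd (a.rev, t)))
        - v⁻¹ • (Uq.gen C (.E (nd (a.rev, t))) * Uq.gen C (.E (nd (a, t))))) =
      Uq.gen C (.E (nd (a.rev, t))) := fun a t => by
    rw [foldr_ofFn_eq_of_fixed (f := fun i y => T i y) (t := t) (fun s => nd (a, s))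
      (fun s hs => hfar2 a a s t hs) (fun s hs => by
        rw [hE2, hfarE a a.rev s t hs]), hE2]
  have hincl : ∀ x : Fin N → Uplus C, incl C (List.ofFn x).prod =
      (List.ofFn fun s => incl C (x s)).prod := fun x => by
    rw [map_list_prod, List.map_ofFn]; rfl
  refine ⟨T, hT, fun k => ?_⟩
  have hword : List.ofFn (word r) = [r, r.rev, r] := by simp [word, List.ofFn_succ]
  rw [hword]
  obtain rfl | rfl | rfl : k = 0 ∨ k = 1 ∨ k = 2 := by fin_cases k <;> simp
  · change incl C (List.ofFn fun s => Uplus.E C (nd (r, s))).prod =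
      (((o r).map fun i => gammaWt C ((Pi.single i 1 : I → ℤ) - Pi.single i 1)).prod)⁻¹ •
        ((o r).map fun i => Uq.gen C (.E i)).prod
    have hg : gammaWt C 0 = 1 := by simp [gammaWt]
    rw [hincl, ho, List.map_ofFn, List.map_ofFn]
    simp only [Uq.incl_E, sub_self, hg]
    simp [Function.comp_def]
  · have hlist : ([r, r.rev, r].take ((1 : Fin 3) : ℕ)).flatMap o = o r := by simp
    have hr : word r 1 = r.rev := rfl
    rw [hlist, hr]
    change incl C (List.ofFn fun s =>
        rootVec v (Uplus.E C (nd (r, s))) (Uplus.E C (nd (r.rev, s)))).prod = _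
    have hroot : ∀ s, incl C (rootVec v (Uplus.E C (nd (r, s))) (Uplus.E C (nd (r.rev, s)))) =
        (v - v⁻¹)⁻¹ • (Uq.gen C (.E (nd (r.rev, s))) * Uq.gen C (.E (nd (r, s)))
          - v⁻¹ • (Uq.gen C (.E (nd (r, s))) * Uq.gen C (.E (nd (r.rev, s))))) := fun s => by
      rw [map_rootVec, Uq.incl_E, Uq.incl_E, rootVec]
    have hg : ∀ s, gammaWt C ((List.ofFn fun s => nd (r, s)).foldr (reflection C)
        (Pi.single (nd (r.rev, s)) 1) - Pi.single (nd (r.rev, s)) 1) = v - v⁻¹ := fun s => by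
      rw [single_eq_rootWt, rootWt_rev, hC.foldr_reflection, rootWt_sub, hC.gammaWt_rootWt]
      norm_num
    rw [hincl, foldr_algHom_prod, ho, ho, List.map_ofFn, List.map_ofFn, List.map_ofFn]
    simp only [Function.comp_def, hg, hfold, hroot, List.ofFn_const, List.prod_replicate]
    rw [ofFn_prod_smul, inv_pow]
  · have hlist : ([r, r.rev, r].take ((2 : Fin 3) : ℕ)).flatMap o = o r ++ o r.rev := by simp
    have hr : word r 2 = r := rfl
    rw [hlist, hr]
    change incl C (List.ofFn fun s => Uplus.E C (nd (r.rev, s))).prod = _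
    have hg : ∀ s, gammaWt C ((List.ofFn fun s => nd (r, s)).foldr (reflection C)
        ((List.ofFn fun s => nd (r.rev, s)).foldr (reflection C)
        (Pi.single (nd (r, s)) 1)) - Pi.single (nd (r, s)) 1) = 1 := fun s => by
      rw [single_eq_rootWt, ← rootWt_rev, hC.foldr_reflection, rootWt_rev, hC.foldr_reflection,
        rootWt_rev, rootWt_sub, hC.gammaWt_rootWt]
      norm_num
    have hf : ∀ t, (List.ofFn fun s => nd (r.rev, s)).foldr (fun i y => T i y)
        (Uq.gen C (.E (nd (r, t)))) = Uq.gen C (.E (nd (r, t))) * Uq.gen C (.E (nd (r.rev, t)))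
        - v⁻¹ • (Uq.gen C (.E (nd (r.rev, t))) * Uq.gen C (.E (nd (r, t)))) := fun t => by
      have h := hfold r.rev t
      rwa [Fin.rev_rev] at h
    rw [hincl, foldr_algHom_prod, ho, ho, List.map_ofFn, List.map_ofFn, List.map_ofFn]
    simp only [Function.comp_def, List.foldr_append, hg, hf, hfold2, Uq.incl_E, List.ofFn_const,
      List.prod_replicate]
    simp

end IsA2Power

end RootVectors

/-- The root vectors in `U_q^+` of the folded Cartan matrix. -/
lemma isRootVectors_small (n : ℕ) (hn : 0 < n) (r : Fin 2) :
    IsRootVectors (foldedMatrix (sl3Pow n) (orbit n)) (fun s => [s]) (word r) (rootSmall n r) := by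
  have h := (isA2Power_folded n hn).isRootVectors r (o := fun s => [s]) fun s => by simp
  convert h using 1
  funext i
  fin_cases i <;> simp [rootSmall, smallE]

lemma isRootVectors_big (n : ℕ) (r : Fin 2) :
    IsRootVectors (sl3Pow n) (orbit n) (word r) (rootBig n r) :=
  (isA2Power_sl3Pow n).isRootVectors r fun _ => rfl

/-- The folding is invariant under every permutation of the factors, cyclic or not. -/
theorem isQuantumFolding {n : ℕ} (hn : 0 < n) (r : Fin 2) (σ : Equiv.Perm (Fin n)) :
    IsQuantumFolding (sl3Pow n) (factorPerm n σ) (sl3Pow_factorPerm n σ) (orbit n) (word r)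
      (rootSmall n r) (rootBig n r) (foldingMap r hn) where
  rootVectors := isRootVectors_small n hn r
  foldedRootVectors := isRootVectors_big n r
  map_monomial := foldingMap_orderedMonomial r hn
  injective := foldingMap_injective r hn
  fixed := diagramHom_foldingMap r hn σ

/-! ### Specialization at `q = 1` -/

section RegularAtOne

open Polynomial

lemma regularAtOne_div {p s : ℂ[X]} (hs : s.eval 1 ≠ 0) :
    RegularAtOne (algebraMap ℂ[X] Kq p / algebraMap ℂ[X] Kq s) := by
  intro h
  obtain ⟨t, ht⟩ := RatFunc.denom_div_dvd p s
  rw [ht, eval_mul, h, zero_mul] at hs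
  exact hs rfl

lemma regularAtOne_algebraMap (p : ℂ[X]) : RegularAtOne (algebraMap ℂ[X] Kq p) := by
  simpa using regularAtOne_div (p := p) (s := 1) (by simp)

lemma evalOne_mul {f g : Kq} (hf : RegularAtOne f) (hg : RegularAtOne g) :
    evalOne (f * g) = evalOne f * evalOne g :=
  RatFunc.eval_mul _ _ hf hg

lemma evalOne_add {f g : Kq} (hf : RegularAtOne f) (hg : RegularAtOne g) :
    evalOne (f + g) = evalOne f + evalOne g :=
  RatFunc.eval_add _ _ hf hg

lemma evalOne_zero : evalOne 0 = 0 := RatFunc.eval_zero _ _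

lemma evalOne_algebraMap (p : ℂ[X]) : evalOne (algebraMap ℂ[X] Kq p) = p.eval 1 :=
  RatFunc.eval_algebraMap (S := ℂ[X]) _ _ p

lemma evalOne_div {p s : ℂ[X]} (hs : s.eval 1 ≠ 0) :
    evalOne (algebraMap ℂ[X] Kq p / algebraMap ℂ[X] Kq s) = p.eval 1 / s.eval 1 := by
  have hs0 : algebraMap ℂ[X] Kq s ≠ 0 := by
    refine RatFunc.algebraMap_ne_zero ?_
    rintro rfl
    simp at hs
  rw [eq_div_iff hs, ← evalOne_algebraMap s, ← evalOne_mul (regularAtOne_div hs)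
    (regularAtOne_algebraMap s), div_mul_cancel₀ _ hs0, evalOne_algebraMap]

lemma regularAtOne_zero : RegularAtOne 0 := by
  simpa using regularAtOne_algebraMap 0

lemma RegularAtOne.add {f g : Kq} (hf : RegularAtOne f) (hg : RegularAtOne g) :
    RegularAtOne (f + g) := by
  intro h
  obtain ⟨t, ht⟩ := RatFunc.denom_add_dvd f g
  have := congrArg (Polynomial.eval 1) ht
  rw [eval_mul, eval_mul, h, zero_mul] at this
  exact mul_ne_zero hf hg this

lemma regularAtOne_sum {ι : Type} (s : Finset ι) {f : ι → Kq} (hf : ∀ i, RegularAtOne (f i)) :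
    RegularAtOne (∑ i ∈ s, f i) := by
  classical
  induction s using Finset.induction_on with
  | empty => simpa using regularAtOne_zero
  | insert i s hi ih => rw [Finset.sum_insert hi]; exact (hf i).add ih

lemma q_zpow_eq (m : ℤ) : q ^ m =
    algebraMap ℂ[X] Kq (X ^ m.toNat) / algebraMap ℂ[X] Kq (X ^ (-m).toNat) := by
  rw [map_pow, map_pow, RatFunc.algebraMap_X, ← q, ← zpow_natCast, ← zpow_natCast,
    ← zpow_sub₀ q_ne_zero]
  congr 1
  omega

lemma regularAtOne_q_zpow (m : ℤ) : RegularAtOne (q ^ m) := by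
  rw [q_zpow_eq]
  exact regularAtOne_div (by simp)

lemma evalOne_q_zpow (m : ℤ) : evalOne (q ^ m) = 1 := by
  rw [q_zpow_eq, evalOne_div (by simp)]
  simp

/-- `[k + 1]_q⁻¹ = q ^ k / (1 + q ^ 2 + ⋯ + q ^ (2 k))`. -/
lemma qInt_inv_eq (k : ℕ) : (qInt q (k + 1))⁻¹ =
    algebraMap ℂ[X] Kq (X ^ k) / algebraMap ℂ[X] Kq (∑ i ∈ Finset.range (k + 1), (X ^ 2) ^ i) := by
  have h := geom_sum_mul (q ^ 2) (k + 1)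
  have hq := q_ne_zero
  have h1 : q ^ 2 - 1 ≠ 0 := sub_ne_zero.2 (q_pow_ne_one two_ne_zero)
  have h2 : (q ^ 2) ^ (k + 1) - 1 ≠ 0 := by
    rw [← pow_mul]
    exact sub_ne_zero.2 (q_pow_ne_one (by omega))
  simp only [map_sum, map_pow, RatFunc.algebraMap_X]
  rw [← q, eq_div_of_mul_eq h1 h, qInt, inv_div, div_div_eq_mul_div]
  have h3 : q - q⁻¹ ≠ 0 := q_sub_inv_ne_zero
  have h4 : q ^ (k + 1) - (q ^ (k + 1))⁻¹ ≠ 0 := q_pow_sub_inv_ne_zero (by omega)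
  rw [div_eq_div_iff h4 h2]
  field_simp
  ring

lemma eval_one_geom_sum (k : ℕ) :
    (∑ i ∈ Finset.range (k + 1), (X ^ 2) ^ i : ℂ[X]).eval 1 = (k : ℂ) + 1 := by
  simp [eval_finsetSum]

lemma regularAtOne_qInt_inv (k : ℕ) : RegularAtOne (qInt q (k + 1))⁻¹ := by
  rw [qInt_inv_eq]
  exact regularAtOne_div (by rw [eval_one_geom_sum]; exact Nat.cast_add_one_ne_zero k)

lemma evalOne_qInt_inv (k : ℕ) : evalOne (qInt q (k + 1))⁻¹ = ((k : ℂ) + 1)⁻¹ := by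
  rw [qInt_inv_eq, evalOne_div (by rw [eval_one_geom_sum]; exact Nat.cast_add_one_ne_zero k),
    eval_one_geom_sum]
  simp

end RegularAtOne

section SumEvalOne

variable {ι A : Type} [Ring A] [Algebra ℂ A] (M : ι → A)

lemma sum_evalOne_add {f g : ι →₀ Kq} (hf : ∀ a, RegularAtOne (f a))
    (hg : ∀ a, RegularAtOne (g a)) :
    ((f + g).sum fun a c => evalOne c • M a) =
      (f.sum fun a c => evalOne c • M a) + g.sum fun a c => evalOne c • M a := by
  classical
  have h0 : ∀ a ∈ f.support ∪ g.support, evalOne 0 • M a = 0 := fun a _ => by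
    rw [evalOne_zero, zero_smul]
  rw [Finsupp.sum_of_support_subset _ Finsupp.support_add _ h0,
    Finsupp.sum_of_support_subset _ Finset.subset_union_left _ h0,
    Finsupp.sum_of_support_subset _ Finset.subset_union_right _ h0, ← Finset.sum_add_distrib]
  exact Finset.sum_congr rfl fun a _ => by
    rw [Finsupp.add_apply, evalOne_add (hf a) (hg a), add_smul]

lemma sum_evalOne_single (a : ι) (c : Kq) :
    ((Finsupp.single a c).sum fun a c => evalOne c • M a) = evalOne c • M a :=
  Finsupp.sum_single_index (by rw [evalOne_zero, zero_smul])

lemma regularAtOne_single {c : Kq} (hc : RegularAtOne c) (a b : ι) :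
    RegularAtOne (Finsupp.single a c b) := by
  classical
  rw [Finsupp.single_apply]
  split_ifs
  exacts [hc, regularAtOne_zero]

lemma sum_evalOne_sum_single {κ : Type} (s : Finset κ) (a : κ → ι) {d : κ → Kq}
    (hd : ∀ l, RegularAtOne (d l)) :
    ((∑ l ∈ s, Finsupp.single (a l) (d l)).sum fun a c => evalOne c • M a) =
      ∑ l ∈ s, evalOne (d l) • M (a l) := by
  classical
  induction s using Finset.induction_on with
  | empty => simp
  | insert i s hi ih =>
    rw [Finset.sum_insert hi, Finset.sum_insert hi, sum_evalOne_add, ih, sum_evalOne_single]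
    · exact regularAtOne_single (hd i) _
    · intro b
      rw [Finsupp.finsetSum_apply]
      exact regularAtOne_sum _ fun l => regularAtOne_single (hd l) _ _

end SumEvalOne

section Specialization

variable {U : Type} [Ring U] [Algebra Kq U] {N : ℕ} {x : Fin N → U}

/-- The structure constants of a quadratic relation with a linear part. -/
lemma IsPBW.structConst_eq (h : IsPBW Kq x) {i j : Fin N} (hij : i < j) {c : Kq} {d : Fin N → Kq}
    (hx : x j * x i = c • (x i * x j) + ∑ l, d l • x l) :
    h.structConst i j = Finsupp.single (Pi.single i 1 + Pi.single j 1) c +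
      ∑ l, Finsupp.single (Pi.single l 1) (d l) := by
  have hb : ∀ a, orderedMonomial x a = h.basis a := fun a => by rw [IsPBW.basis, Module.Basis.mk_apply]
  have h1 : x i * x j = h.basis (Pi.single i 1 + Pi.single j 1) := by
    rw [← hb, orderedMonomial_single_add_single x hij]
  have h2 : ∀ l, x l = h.basis (Pi.single l 1) := fun l => by
    rw [← hb, orderedMonomial_single, pow_one]
  have h3 : ∑ l, d l • x l = ∑ l, d l • h.basis (Pi.single l 1) :=
    Finset.sum_congr rfl fun l _ => by rw [← h2 l]
  rw [IsPBW.structConst, hx, h1, h3]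
  simp only [map_add, map_smul, map_sum, Module.Basis.repr_self, Finsupp.smul_single, smul_eq_mul,
    mul_one]

lemma IsPBW.regularAtOne_structConst (h : IsPBW Kq x) {i j : Fin N} (hij : i < j) {c : Kq}
    {d : Fin N → Kq} (hx : x j * x i = c • (x i * x j) + ∑ l, d l • x l) (hc : RegularAtOne c)
    (hd : ∀ l, RegularAtOne (d l)) (a : Fin N → ℕ) : RegularAtOne (h.structConst i j a) := by
  rw [h.structConst_eq hij hx, Finsupp.add_apply, Finsupp.finsetSum_apply]
  exact (regularAtOne_single hc _ _).add (regularAtOne_sum _ fun l => regularAtOne_single (hd l) _ _)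

lemma IsPBW.sum_structConst (h : IsPBW Kq x) {i j : Fin N} (hij : i < j) {c : Kq}
    {d : Fin N → Kq} (hx : x j * x i = c • (x i * x j) + ∑ l, d l • x l) (hc : RegularAtOne c)
    (hd : ∀ l, RegularAtOne (d l)) {A : Type} [Ring A] [Algebra ℂ A] (y : Fin N → A) :
    ((h.structConst i j).sum fun a c => evalOne c • orderedMonomial y a) =
      evalOne c • (y i * y j) + ∑ l, evalOne (d l) • y l := by
  rw [h.structConst_eq hij hx, sum_evalOne_add _ (regularAtOne_single hc _), sum_evalOne_single,
    sum_evalOne_sum_single _ _ _ hd, orderedMonomial_single_add_single y hij]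
  · simp only [orderedMonomial_single, pow_one]
  · intro b
    rw [Finsupp.finsetSum_apply]
    exact regularAtOne_sum _ fun l => regularAtOne_single (hd l) _ _

lemma IsPBW.specGen_mul (h : IsPBW Kq x) {i j : Fin N} (hij : i < j) :
    h.specGen j * h.specGen i =
      (h.structConst i j).sum fun a c => evalOne c • orderedMonomial h.specGen a := by
  have e := RingQuot.mkAlgHom_rel ℂ (IsPBW.SpecRel.mk (h := h) i j hij)
  simp only [map_mul, Finsupp.sum, map_sum, map_smul, map_orderedMonomial] at e
  exact e

/-- The universal property of the specialization. -/
lemma IsPBW.exists_specLift (h : IsPBW Kq x) {A : Type} [Ring A] [Algebra ℂ A] (y : Fin N → A)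
    (hy : ∀ i j, i < j → y j * y i =
      (h.structConst i j).sum fun a c => evalOne c • orderedMonomial y a) :
    ∃ f : h.Specialization →ₐ[ℂ] A, ∀ i, f (h.specGen i) = y i := by
  have hy' : ∀ ⦃a b⦄, h.SpecRel a b → FreeAlgebra.lift ℂ y a = FreeAlgebra.lift ℂ y b := by
    rintro _ _ ⟨i, j, hij⟩
    simp only [map_mul, Finsupp.sum, map_sum, map_smul, map_orderedMonomial,
      FreeAlgebra.lift_ι_apply]
    exact hy i j hij
  refine ⟨RingQuot.liftAlgHom ℂ ⟨FreeAlgebra.lift ℂ y, hy'⟩, fun i => ?_⟩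
  have e := RingQuot.liftAlgHom_mkAlgHom_apply (S := ℂ) (s := h.SpecRel)
    (FreeAlgebra.lift ℂ y) hy' (FreeAlgebra.ι ℂ i)
  rw [FreeAlgebra.lift_ι_apply] at e
  exact e

lemma IsPBW.specHom_ext (h : IsPBW Kq x) {A : Type} [Ring A] [Algebra ℂ A]
    {f g : h.Specialization →ₐ[ℂ] A} (hfg : ∀ i, f (h.specGen i) = g (h.specGen i)) : f = g :=
  RingQuot.ringQuot_ext' (S := ℂ) (s := h.SpecRel) f g (FreeAlgebra.hom_ext (funext hfg))

end Specialization

/-! ### The enveloping algebra of `1^m ⋊ (sl_3)_+` -/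

section StrictUpperTriangular

/-- The matrix of an element of `(sl_3)_+`. -/
def sl3Plus.mat (x : sl3Plus) : Matrix (Fin 3) (Fin 3) ℂ := x.1.1

lemma sl3Plus.mat_injective : Function.Injective sl3Plus.mat := fun _ _ h =>
  Subtype.ext (Subtype.ext h)

lemma sl3Plus.mat_lie (x y : sl3Plus) : mat ⁅x, y⁆ = mat x * mat y - mat y * mat x := rfl

lemma sl3Plus.mat_add (x y : sl3Plus) : mat (x + y) = mat x + mat y := rfl

lemma sl3Plus.mat_smul (c : ℂ) (x : sl3Plus) : mat (c • x) = c • mat x := rfl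

lemma sl3Plus.mat_e : mat (e 0) = Matrix.single 0 1 1 ∧ mat (e 1) = Matrix.single 1 2 1 :=
  ⟨rfl, rfl⟩

lemma sl3Plus.mat_apply_of_le (x : sl3Plus) {i j : Fin 3} (hij : j ≤ i) : mat x i j = 0 := by
  obtain ⟨x, hx⟩ := x
  change (x : Matrix (Fin 3) (Fin 3) ℂ) i j = 0
  revert i j
  have key : ∀ i j : Fin 3, j ≤ i → (x : Matrix (Fin 3) (Fin 3) ℂ) i j = 0 := by
    induction hx using LieSubalgebra.lieSpan_induction with
    | mem x h =>
      obtain ⟨r, rfl⟩ := h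
      intro i j hij
      fin_cases r
      · change Matrix.single (0 : Fin 3) (1 : Fin 3) (1 : ℂ) i j = 0
        rw [Matrix.single_apply, if_neg]
        rintro ⟨rfl, rfl⟩
        exact absurd hij (by decide)
      · change Matrix.single (1 : Fin 3) (2 : Fin 3) (1 : ℂ) i j = 0
        rw [Matrix.single_apply, if_neg]
        rintro ⟨rfl, rfl⟩
        exact absurd hij (by decide)
    | zero => intro i j _; rfl
    | add x y _ _ hx hy =>
      intro i j hij
      change (x : Matrix (Fin 3) (Fin 3) ℂ) i j + (y : Matrix (Fin 3) (Fin 3) ℂ) i j = 0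
      rw [hx i j hij, hy i j hij, add_zero]
    | smul a x _ hx =>
      intro i j hij
      change a * (x : Matrix (Fin 3) (Fin 3) ℂ) i j = 0
      rw [hx i j hij, mul_zero]
    | lie x y _ _ hx hy =>
      intro i j hij
      rw [LieAlgebra.SpecialLinear.sl_bracket, Matrix.sub_apply, Matrix.mul_apply,
        Matrix.mul_apply, ← Finset.sum_sub_distrib]
      refine Finset.sum_eq_zero fun k _ => ?_
      rcases le_total k i with h | h
      · rw [hx i k h, hy i k h, zero_mul, zero_mul, sub_zero]
      · rw [hx k j (hij.trans h), hy k j (hij.trans h), mul_zero, mul_zero, sub_zero]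
  exact fun {i j} => key i j

lemma sl3Plus.mat_mul_apply (x y : sl3Plus) (i j : Fin 3) :
    (mat x * mat y) i j = if i = 0 ∧ j = 2 then mat x 0 1 * mat y 1 2 else 0 := by
  have hx := fun i j => mat_apply_of_le x (i := i) (j := j)
  have hy := fun i j => mat_apply_of_le y (i := i) (j := j)
  rw [Matrix.mul_apply, Fin.sum_univ_three]
  fin_cases i <;> fin_cases j <;> simp [hx, hy]

lemma sl3Plus.eq_sum (x : sl3Plus) :
    x = mat x 0 1 • e 0 + mat x 1 2 • e 1 + mat x 0 2 • ⁅e 0, e 1⁆ := by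
  refine mat_injective ?_
  have hx := fun i j => mat_apply_of_le x (i := i) (j := j)
  ext i j
  simp only [mat_add, mat_smul, mat_lie, Matrix.add_apply, Matrix.smul_apply, Matrix.sub_apply,
    mat_mul_apply, mat_e.1, mat_e.2]
  fin_cases i <;> fin_cases j <;> simp [hx, Matrix.single_apply]

end StrictUpperTriangular

section TrivSl3

variable {m : ℕ}

/-- The Heisenberg relation satisfied by the generators of `U(1^m ⋊ (sl_3)_+)`: the elements `z k`
are central, and the commutator of `a` and `b` is central. -/
structure HeisenbergFamily {A : Type} [Ring A] (a b : A) (z : Fin m → A) : Prop where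
  z_z : ∀ k l, Commute (z k) (z l)
  z_a : ∀ k, Commute (z k) a
  z_b : ∀ k, Commute (z k) b
  lie_a : Commute (a * b - b * a) a
  lie_b : Commute (a * b - b * a) b

lemma HeisenbergFamily.z_lie {A : Type} [Ring A] {a b : A} {z : Fin m → A}
    (h : HeisenbergFamily a b z) (k : Fin m) : Commute (z k) (a * b - b * a) :=
  ((h.z_a k).mul_right (h.z_b k)).sub_right ((h.z_b k).mul_right (h.z_a k))

lemma lie_left (x y : TrivSl3 m) : ⁅x, y⁆.left = 0 := by
  change (0 : AbelianLie m) + 0 - 0 = 0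
  simp

/-- The homomorphism from `U(1^m ⋊ (sl_3)_+)` given by the images of the generators. -/
lemma exists_envLift {A : Type} [Ring A] [Algebra ℂ A] {a b : A} {z : Fin m → A}
    (h : HeisenbergFamily a b z) :
    ∃ f : UniversalEnvelopingAlgebra ℂ (TrivSl3 m) →ₐ[ℂ] A,
      f (envE m 0) = a ∧ f (envE m 1) = b ∧ ∀ k, f (envZ m k) = z k := by
  let φ : TrivSl3 m → A := fun x => ∑ k, (x.left : Fin m → ℂ) k • z k + sl3Plus.mat x.right 0 1 • a +
    sl3Plus.mat x.right 1 2 • b + sl3Plus.mat x.right 0 2 • (a * b - b * a)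
  have hadd : ∀ x y, φ (x + y) = φ x + φ y := by
    intro x y
    have : ∑ k, ((x + y).left : Fin m → ℂ) k • z k =
        ∑ k, (x.left : Fin m → ℂ) k • z k + ∑ k, (y.left : Fin m → ℂ) k • z k := by
      rw [← Finset.sum_add_distrib]
      exact Finset.sum_congr rfl fun k _ => add_smul _ _ _
    simp only [φ, this]
    simp only [LieAlgebra.SemiDirectSum.add_eq_mk, sl3Plus.mat_add, Matrix.add_apply, add_smul]
    abel
  have hsmul : ∀ (c : ℂ) x, φ (c • x) = c • φ x := by
    intro c x
    have : ∑ k, ((c • x).left : Fin m → ℂ) k • z k = c • ∑ k, (x.left : Fin m → ℂ) k • z k := by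
      rw [Finset.smul_sum]
      exact Finset.sum_congr rfl fun k _ => mul_smul _ _ _
    simp only [φ, this]
    simp only [LieAlgebra.SemiDirectSum.smul_eq_mk, sl3Plus.mat_smul, Matrix.smul_apply, smul_add,
      smul_eq_mul, mul_smul]
  have hlie : ∀ x y, φ ⁅x, y⁆ = ⁅φ x, φ y⁆ := by
    intro x y
    have hz : ∀ t, (∀ k, Commute (z k) t) → ∀ c : Fin m → ℂ, Commute (∑ k, c k • z k) t :=
      fun t ht c => Commute.sum_left _ _ _ fun k _ => (ht k).smul_left (c k)
    have h0 : φ ⁅x, y⁆ = (sl3Plus.mat x.right 0 1 * sl3Plus.mat y.right 1 2 -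
        sl3Plus.mat y.right 0 1 * sl3Plus.mat x.right 1 2) • (a * b - b * a) := by
      have hl : ∑ k, (⁅x, y⁆.left : Fin m → ℂ) k • z k = 0 := by
        refine Finset.sum_eq_zero fun k _ => ?_
        rw [lie_left]
        exact zero_smul _ _
      simp only [φ, hl]
      simp only [LieAlgebra.SemiDirectSum.lie_eq_mk, sl3Plus.mat_lie, Matrix.sub_apply,
        sl3Plus.mat_mul_apply]
      simp
    rw [h0, LieRing.of_associative_ring_bracket]
    simp only [φ]
    have hzz : ∀ c d : Fin m → ℂ, Commute (∑ k, c k • z k) (∑ k, d k • z k) := fun c d =>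
      hz _ (fun k => Commute.sum_right _ _ _ fun l _ => (h.z_z k l).smul_right (d l)) c
    have e1 := (hzz x.left y.left).eq
    have e2 := (hz a h.z_a x.left).eq
    have e3 := (hz b h.z_b x.left).eq
    have e4 := (hz _ h.z_lie x.left).eq
    have e5 := (hz a h.z_a y.left).eq
    have e6 := (hz b h.z_b y.left).eq
    have e7 := (hz _ h.z_lie y.left).eq
    have e8 := h.lie_a.eq
    have e9 := h.lie_b.eq
    have e10 : a * b = a * b - b * a + b * a := by abel
    generalize (∑ k, (x.left : Fin m → ℂ) k • z k) = p at *
    generalize (∑ k, (y.left : Fin m → ℂ) k • z k) = p' at *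
    generalize a * b - b * a = w at *
    simp only [add_mul, mul_add, smul_mul_assoc, mul_smul_comm, e1, e2, e3, e4, ← e5, ← e6, ← e7,
      e8, e9, e10]
    match_scalars <;> ring
  let F : TrivSl3 m →ₗ⁅ℂ⁆ A :=
    { toFun := φ
      map_add' := hadd
      map_smul' := hsmul
      map_lie' := fun {x y} => hlie x y }
  have hF : ∀ x, UniversalEnvelopingAlgebra.lift ℂ F (UniversalEnvelopingAlgebra.ι ℂ x) = φ x :=
    fun x => UniversalEnvelopingAlgebra.lift_ι_apply ℂ F x
  have h0 : ∑ k, ((0 : AbelianLie m) : Fin m → ℂ) k • z k = 0 :=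
    Finset.sum_eq_zero fun k _ => zero_smul _ _
  refine ⟨UniversalEnvelopingAlgebra.lift ℂ F, ?_, ?_, fun k => ?_⟩
  · rw [envE, hF]
    simp only [φ, h0]
    rw [sl3Plus.mat_e.1]
    simp [Matrix.single_apply]
  · rw [envE, hF]
    simp only [φ, h0]
    rw [sl3Plus.mat_e.2]
    simp [Matrix.single_apply]
  · rw [envZ, hF]
    have hm : sl3Plus.mat 0 = 0 := rfl
    simp only [φ, hm]
    simp [Pi.single_apply]

lemma env_commutator : envE m 0 * envE m 1 - envE m 1 * envE m 0 =
    UniversalEnvelopingAlgebra.ι ℂ (⟨0, ⁅sl3Plus.e 0, sl3Plus.e 1⁆⟩ : TrivSl3 m) := by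
  have h := LieHom.map_lie (UniversalEnvelopingAlgebra.ι ℂ) (⟨0, sl3Plus.e 0⟩ : TrivSl3 m)
    ⟨0, sl3Plus.e 1⟩
  rw [LieRing.of_associative_ring_bracket] at h
  rw [envE, envE, ← h, LieAlgebra.SemiDirectSum.lie_eq_mk]
  simp

lemma heisenbergFamily_env : HeisenbergFamily (envE m 0) (envE m 1) (envZ m) := by
  have hι : ∀ x y : TrivSl3 m, ⁅x, y⁆ = 0 →
      Commute (UniversalEnvelopingAlgebra.ι ℂ x) (UniversalEnvelopingAlgebra.ι ℂ y) := by
    intro x y hxy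
    have h := LieHom.map_lie (UniversalEnvelopingAlgebra.ι ℂ) x y
    rw [hxy, map_zero, LieRing.of_associative_ring_bracket] at h
    exact (sub_eq_zero.1 h.symm)
  have hz : ∀ k (x : TrivSl3 m), Commute (envZ m k) (UniversalEnvelopingAlgebra.ι ℂ x) := by
    intro k x
    refine hι _ _ ?_
    exact LieAlgebra.SemiDirectSum.ext (lie_left _ _) (zero_lie x.right)
  have hlie : ∀ r, ⁅⁅sl3Plus.e 0, sl3Plus.e 1⁆, sl3Plus.e r⁆ = 0 := by
    intro r
    refine sl3Plus.mat_injective ?_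
    ext i j
    rw [sl3Plus.mat_lie, Matrix.sub_apply, sl3Plus.mat_mul_apply, sl3Plus.mat_mul_apply,
      sl3Plus.mat_lie]
    simp only [Matrix.sub_apply, sl3Plus.mat_mul_apply]
    simp
    rfl
  have hw' : ∀ r, Commute (envE m 0 * envE m 1 - envE m 1 * envE m 0) (envE m r) := by
    intro r
    rw [env_commutator]
    refine hι _ _ ?_
    rw [LieAlgebra.SemiDirectSum.lie_eq_mk, hlie]
    simp
  exact ⟨fun k l => hz k _, fun k => hz k _, fun k => hz k _, hw' 0, hw' 1⟩

lemma envHom_ext {A : Type} [Ring A] [Algebra ℂ A]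
    {f g : UniversalEnvelopingAlgebra ℂ (TrivSl3 m) →ₐ[ℂ] A} (he : ∀ r, f (envE m r) = g (envE m r))
    (hz : ∀ k, f (envZ m k) = g (envZ m k)) : f = g := by
  refine UniversalEnvelopingAlgebra.hom_ext ℂ (LieHom.ext fun x => ?_)
  let S : Submodule ℂ (TrivSl3 m) :=
    { carrier := {x | f (UniversalEnvelopingAlgebra.ι ℂ x) = g (UniversalEnvelopingAlgebra.ι ℂ x)}
      zero_mem' := by rw [Set.mem_ofPred_eq, map_zero, map_zero, map_zero]
      add_mem' := fun {x y} hx hy => by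
        rw [Set.mem_ofPred_eq] at hx hy ⊢
        rw [map_add, map_add, map_add, hx, hy]
      smul_mem' := fun c x hx => by
        rw [Set.mem_ofPred_eq] at hx ⊢
        rw [map_smul, map_smul, map_smul, hx] }
  change x ∈ S
  let L : (Fin m → ℂ) →ₗ[ℂ] TrivSl3 m :=
    { toFun := fun c => ⟨c, 0⟩
      map_add' := fun c d => LieAlgebra.SemiDirectSum.ext rfl (add_zero 0).symm
      map_smul' := fun c d => LieAlgebra.SemiDirectSum.ext rfl (smul_zero c).symm }
  let R : sl3Plus →ₗ[ℂ] TrivSl3 m :=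
    { toFun := fun y => ⟨0, y⟩
      map_add' := fun c d => LieAlgebra.SemiDirectSum.ext (add_zero 0).symm rfl
      map_smul' := fun c d => LieAlgebra.SemiDirectSum.ext (smul_zero c).symm rfl }
  have hx : x = L x.left + R x.right :=
    LieAlgebra.SemiDirectSum.ext (add_zero x.left).symm (zero_add x.right).symm
  have hL : ∀ c, L c ∈ S := fun c => by
    rw [pi_eq_sum_univ' c, map_sum]
    refine Submodule.sum_mem _ fun k _ => ?_
    rw [map_smul]
    refine Submodule.smul_mem _ _ ?_
    exact hz k
  have hlie : R ⁅sl3Plus.e 0, sl3Plus.e 1⁆ ∈ S := by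
    change f (UniversalEnvelopingAlgebra.ι ℂ (⟨0, ⁅sl3Plus.e 0, sl3Plus.e 1⁆⟩ : TrivSl3 m)) =
      g (UniversalEnvelopingAlgebra.ι ℂ (⟨0, ⁅sl3Plus.e 0, sl3Plus.e 1⁆⟩ : TrivSl3 m))
    rw [← env_commutator]
    simp only [map_sub, map_mul, he]
  have hR : R x.right ∈ S := by
    rw [sl3Plus.eq_sum x.right, map_add, map_add, map_smul, map_smul, map_smul]
    exact S.add_mem (S.add_mem (S.smul_mem _ (he 0)) (S.smul_mem _ (he 1))) (S.smul_mem _ hlie)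
  rw [hx]
  exact S.add_mem (hL _) hR

end TrivSl3

/-! ### The specialization of the algebra -/

section SpecializationOfAAlg

variable {n : ℕ}

lemma AAlg.pbwGen_eq : AAlg.pbwGen n = AAlg.scaledGen n 1 1 := by
  rw [AAlg.pbwGen, AAlg.scaledGen, one_smul]
  rfl

lemma AAlg.isPBW_pbwGen (hn : 0 < n) : IsPBW Kq (AAlg.pbwGen n) := by
  rw [AAlg.pbwGen_eq]
  exact AAlg.isPBW_scaledGen hn one_ne_zero

lemma AAlg.pbwGen_mul (i j : Fin (3 + (n - 1))) (hij : i < j) :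
    ∃ m : ℤ, AAlg.pbwGen n j * AAlg.pbwGen n i = q ^ m • (AAlg.pbwGen n i * AAlg.pbwGen n j) +
      ∑ l, AAlg.linCoef n 1 1 i j l • AAlg.pbwGen n l := by
  rw [AAlg.pbwGen_eq]
  exact AAlg.scaledGen_mul one_ne_zero i j hij

lemma AAlg.regularAtOne_linCoef (i j l : Fin (3 + (n - 1))) :
    RegularAtOne (AAlg.linCoef n 1 1 i j l) := by
  rw [AAlg.linCoef]
  split_ifs
  · induction l using Fin.addCases with
    | left l =>
      rw [Fin.append_left]
      have h1 : RegularAtOne (1 : Kq)⁻¹ := by simpa using regularAtOne_algebraMap 1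
      fin_cases l
      exacts [regularAtOne_zero, h1, regularAtOne_zero]
    | right k =>
      rw [Fin.append_right]
      exact regularAtOne_qInt_inv _
  · exact regularAtOne_zero

lemma AAlg.specializable (h : IsPBW Kq (AAlg.pbwGen n)) : h.Specializable := by
  intro i j hij
  obtain ⟨m, hm⟩ := AAlg.pbwGen_mul i j hij
  exact h.regularAtOne_structConst hij hm (regularAtOne_q_zpow m) (AAlg.regularAtOne_linCoef i j)

/-- The relations at `q = 1`: the generators commute, except for `u_2` and `u_1`. -/
lemma AAlg.sum_structConst (h : IsPBW Kq (AAlg.pbwGen n)) {A : Type} [Ring A] [Algebra ℂ A]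
    (y : Fin (3 + (n - 1)) → A) {i j : Fin (3 + (n - 1))} (hij : i < j) :
    ((h.structConst i j).sum fun a c => evalOne c • orderedMonomial y a) = y i * y j +
      if i = Fin.castAdd (n - 1) 0 ∧ j = Fin.castAdd (n - 1) 2 then
        y (Fin.castAdd (n - 1) 1) + ∑ k : Fin (n - 1), ((k : ℂ) + 1)⁻¹ • y (Fin.natAdd 3 k)
      else 0 := by
  obtain ⟨m, hm⟩ := AAlg.pbwGen_mul i j hij
  rw [h.sum_structConst hij hm (regularAtOne_q_zpow m) (AAlg.regularAtOne_linCoef i j),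
    evalOne_q_zpow, one_smul]
  congr 1
  by_cases hc : i = Fin.castAdd (n - 1) 0 ∧ j = Fin.castAdd (n - 1) 2
  · have h1 : evalOne 1 = 1 := by simpa using evalOne_algebraMap 1
    have h0 : zIndex (n := n) = fun k i => if i = 0 then k else k.rev := rfl
    simp only [AAlg.linCoef, if_pos hc, Fin.sum_univ_add, Fin.append_left, Fin.append_right,
      Fin.sum_univ_three, evalOne_qInt_inv]
    simp [evalOne_zero, h1, h0]
  · simp only [AAlg.linCoef, if_neg hc, evalOne_zero, zero_smul, Finset.sum_const_zero]

/-- At `q = 1` the generators `u_1`, `u_2`, `z_k` form a Heisenberg family, and `u_21` is determined by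
the commutator of `u_1` and `u_2`, as `[k]⁻¹` becomes `1 / k`. -/
lemma AAlg.heisenbergFamily_specGen (h : IsPBW Kq (AAlg.pbwGen n)) :
    h.specGen (Fin.castAdd (n - 1) 2) * h.specGen (Fin.castAdd (n - 1) 0) -
        h.specGen (Fin.castAdd (n - 1) 0) * h.specGen (Fin.castAdd (n - 1) 2) =
      h.specGen (Fin.castAdd (n - 1) 1) +
        ∑ k : Fin (n - 1), ((k : ℂ) + 1)⁻¹ • h.specGen (Fin.natAdd 3 k) ∧
    HeisenbergFamily (h.specGen (Fin.castAdd (n - 1) 2)) (h.specGen (Fin.castAdd (n - 1) 0))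
      fun k => h.specGen (Fin.natAdd 3 k) := by
  have hrel : h.specGen (Fin.castAdd (n - 1) 2) * h.specGen (Fin.castAdd (n - 1) 0) -
        h.specGen (Fin.castAdd (n - 1) 0) * h.specGen (Fin.castAdd (n - 1) 2) =
      h.specGen (Fin.castAdd (n - 1) 1) +
        ∑ k : Fin (n - 1), ((k : ℂ) + 1)⁻¹ • h.specGen (Fin.natAdd 3 k) := by
    rw [h.specGen_mul (by simp [Fin.lt_def]), AAlg.sum_structConst h _ (by simp [Fin.lt_def]),
      if_pos ⟨rfl, rfl⟩, add_sub_cancel_left]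
  have hcomm : ∀ i j, i < j → ¬ (i = Fin.castAdd (n - 1) 0 ∧ j = Fin.castAdd (n - 1) 2) →
      Commute (h.specGen j) (h.specGen i) := by
    intro i j hij hne
    have e := h.specGen_mul hij
    rwa [AAlg.sum_structConst h _ hij, if_neg hne, add_zero] at e
  have hz : ∀ k (i : Fin 3), Commute (h.specGen (Fin.natAdd 3 k))
      (h.specGen (Fin.castAdd (n - 1) i)) := fun k i =>
    hcomm _ _ (by rw [Fin.lt_def]; simp; omega) fun e => by
      have := congrArg Fin.val e.2
      simp at this
      omega
  refine ⟨hrel, fun k l => ?_, fun k => hz k 2, fun k => hz k 0, ?_, ?_⟩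
  · rcases lt_trichotomy k l with hkl | rfl | hkl
    · refine (hcomm _ _ ((Fin.natAdd_lt_natAdd_iff 3).2 hkl) fun e => ?_).symm
      have := congrArg Fin.val e.2
      simp at this
      omega
    · exact Commute.refl _
    · refine hcomm _ _ ((Fin.natAdd_lt_natAdd_iff 3).2 hkl) fun e => ?_
      have := congrArg Fin.val e.2
      simp at this
      omega
  · rw [hrel]
    refine Commute.add_left ?_ (Commute.sum_left _ _ _ fun k _ => (hz k 2).smul_left _)
    refine (hcomm _ _ (by simp [Fin.lt_def]) fun e => ?_).symm
    have := congrArg Fin.val e.1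
    simp at this
  · rw [hrel]
    refine Commute.add_left ?_ (Commute.sum_left _ _ _ fun k _ => (hz k 0).smul_left _)
    refine hcomm _ _ (by simp [Fin.lt_def]) fun e => ?_
    have := congrArg Fin.val e.2
    simp at this

/-- The family of generators of the specialization attached to a Heisenberg family. -/
def HeisenbergFamily.gen {A : Type} [Ring A] [Algebra ℂ A] (a b : A) (z : Fin (n - 1) → A) :
    Fin (3 + (n - 1)) → A :=
  Fin.append ![b, a * b - b * a - ∑ k : Fin (n - 1), ((k : ℂ) + 1)⁻¹ • z k, a] z

lemma HeisenbergFamily.exists_specLift (h : IsPBW Kq (AAlg.pbwGen n)) {A : Type} [Ring A]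
    [Algebra ℂ A] {a b : A} {z : Fin (n - 1) → A} (hf : HeisenbergFamily a b z) :
    ∃ f : h.Specialization →ₐ[ℂ] A, ∀ i, f (h.specGen i) = gen a b z i := by
  refine h.exists_specLift _ fun i j hij => ?_
  rw [AAlg.sum_structConst h _ hij]
  have hzs : ∀ t, (∀ k, Commute (z k) t) →
      Commute (∑ k : Fin (n - 1), ((k : ℂ) + 1)⁻¹ • z k) t := fun t ht =>
    Commute.sum_left _ _ _ fun k _ => (ht k).smul_left _
  have hza : ∀ k i, Commute (z k) (gen a b z (Fin.castAdd (n - 1) i)) := by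
    intro k i
    rw [gen, Fin.append_left]
    fin_cases i
    · exact hf.z_b k
    · exact (hf.z_lie k).sub_right (hzs _ fun l => hf.z_z l k).symm
    · exact hf.z_a k
  by_cases hc : i = Fin.castAdd (n - 1) 0 ∧ j = Fin.castAdd (n - 1) 2
  · obtain ⟨rfl, rfl⟩ := hc
    rw [if_pos ⟨rfl, rfl⟩]
    simp only [gen, Fin.append_left, Fin.append_right]
    change a * b = b * a + (a * b - b * a - _ + _)
    rw [sub_add_cancel, add_sub_cancel]
  · rw [if_neg hc, add_zero]
    change Commute _ _
    induction i using Fin.addCases with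
    | left i =>
      induction j using Fin.addCases with
      | left j =>
        have hij' : i < j := Fin.lt_def.2 (Fin.lt_def.1 hij)
        have hab := (hf.lie_b.sub_left (hzs _ hf.z_b)).symm
        have haa := hf.lie_a.sub_left (hzs _ hf.z_a)
        rw [gen, Fin.append_left, Fin.append_left]
        fin_cases i <;> fin_cases j <;> first | exact absurd hij' (by decide) | skip
        · exact hab.symm
        · exact absurd ⟨rfl, rfl⟩ hc
        · exact haa.symm
      | right l =>
        rw [show gen a b z (Fin.natAdd 3 l) = z l from Fin.append_right _ _ _]
        exact hza l i
    | right k =>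
      induction j using Fin.addCases with
      | left j =>
        have := Fin.lt_def.1 hij
        simp at this
        omega
      | right l =>
        rw [gen, Fin.append_right, Fin.append_right]
        exact hf.z_z l k

/-- The specialization at `q = 1` is the enveloping algebra of `1^(n-1) ⋊ (sl_3)_+`. -/
theorem AAlg.exists_specialization_equiv (h : IsPBW Kq (AAlg.pbwGen n)) :
    ∃ g : h.Specialization ≃ₐ[ℂ] UniversalEnvelopingAlgebra ℂ (TrivSl3 (n - 1)),
      g (h.specGen (Fin.castAdd (n - 1) 0)) = envE (n - 1) 1 ∧
      g (h.specGen (Fin.castAdd (n - 1) 2)) = envE (n - 1) 0 ∧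
      ∀ k, g (h.specGen (Fin.natAdd 3 k)) = envZ (n - 1) k := by
  obtain ⟨hrel, hspec⟩ := AAlg.heisenbergFamily_specGen h
  obtain ⟨f, hf⟩ := (heisenbergFamily_env (m := n - 1)).exists_specLift h
  obtain ⟨g, hg0, hg1, hgz⟩ := exists_envLift hspec
  have hf0 : f (h.specGen (Fin.castAdd (n - 1) 0)) = envE (n - 1) 1 := by
    rw [hf, HeisenbergFamily.gen, Fin.append_left]; rfl
  have hf2 : f (h.specGen (Fin.castAdd (n - 1) 2)) = envE (n - 1) 0 := by
    rw [hf, HeisenbergFamily.gen, Fin.append_left]; rfl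
  have hfz : ∀ k, f (h.specGen (Fin.natAdd 3 k)) = envZ (n - 1) k := fun k => by
    rw [hf, HeisenbergFamily.gen, Fin.append_right]
  have hf1 : f (h.specGen (Fin.castAdd (n - 1) 1)) = envE (n - 1) 0 * envE (n - 1) 1
      - envE (n - 1) 1 * envE (n - 1) 0
      - ∑ k : Fin (n - 1), ((k : ℂ) + 1)⁻¹ • envZ (n - 1) k := by
    rw [hf, HeisenbergFamily.gen, Fin.append_left]; rfl
  refine ⟨AlgEquiv.ofAlgHom f g ?_ ?_, hf0, hf2, hfz⟩
  · refine envHom_ext (fun r => ?_) fun k => ?_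
    · fin_cases r
      · exact (congrArg f hg0).trans hf2
      · exact (congrArg f hg1).trans hf0
    · exact (congrArg f (hgz k)).trans (hfz k)
  · refine h.specHom_ext fun i => ?_
    change g (f _) = h.specGen i
    induction i using Fin.addCases with
    | left i =>
      fin_cases i
      · exact (congrArg g hf0).trans hg1
      · refine (congrArg g hf1).trans ?_
        rw [map_sub, map_sub, map_mul, map_mul, map_sum, hg0, hg1, hrel]
        simp only [map_smul, hgz, add_sub_cancel_right]
        rfl
      · exact (congrArg g hf2).trans hg0
    | right k => rw [hfz, hgz]

end SpecializationOfAAlg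

end QuantumFolding

end

theorem theorem1p16 (n : ℕ) (hn : 3 ≤ n) (σ : Equiv.Perm (Fin n)) (hσ : σ.IsCycleOn Set.univ) :
    -- both foldings are enhanced liftable, with enhanced uberalgebra `AAlg n` for a common `Z₀`
    (∃ Z : Fin (n - 1) → UplusBig n, ∀ r : Fin 2,
      ∃ (X : Fin 3 → UplusSmall n) (Y : Fin 3 → UplusBig n)
        (ι : UplusSmall n →ₗ[Kq] UplusBig n),
        IsQuantumFolding (sl3Pow n)
          (factorPerm n σ) (sl3Pow_factorPerm n σ)
          (orbit n) (word r) X Y ι ∧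
        EnhancedLiftable X ι ∧
        IsEnhancedUberalgebra X ι (Fin.castAddOrderEmb (n - 1))
          (Fin.append Y Z) (AAlg.uberGen n r) ∧
        -- uniqueness of the enhanced uberalgebra for this `Z₀`
        (∀ (U : Type) (_ : Ring U) (_ : Algebra Kq U) (v : Fin (3 + (n - 1)) → U),
          IsEnhancedUberalgebra X ι (Fin.castAddOrderEmb (n - 1))
            (Fin.append Y Z) v →
          ∃ f : AAlg n ≃ₐ[Kq] U,
            ∀ j, f (AAlg.uberGen n r j) = v j)) ∧
    -- the projection to the quantized enveloping algebra
    (∃ μ : AAlg n →ₐ[Kq] UplusSmall n,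
      Function.Surjective μ ∧
      (∀ i, μ (AAlg.u n i) =
        Uplus.E (foldedMatrix (sl3Pow n)
          (orbit n)) i) ∧
      ∀ k, μ (AAlg.z n k) = 0) ∧
    -- the PBW presentation
    (∃ f : PAlg n ≃ₐ[Kq] AAlg n,
      f (PAlg.gen n .u2) = AAlg.u n 1 ∧
      f (PAlg.gen n .u21) = AAlg.uu n 0 ∧
      f (PAlg.gen n .u1) = AAlg.u n 0 ∧
      ∀ k, f (PAlg.gen n (.z k)) = AAlg.z n k) ∧
    -- the PBW property, and the specialization at `q = 1`
    ∃ h : IsPBW Kq (AAlg.pbwGen n),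
      h.Specializable ∧
      ∃ g : h.Specialization ≃ₐ[ℂ]
          UniversalEnvelopingAlgebra ℂ (TrivSl3 (n - 1)),
        g (h.specGen (Fin.castAdd (n - 1) 0)) = envE (n - 1) 1 ∧
        g (h.specGen (Fin.castAdd (n - 1) 2)) = envE (n - 1) 0 ∧
        ∀ k, g (h.specGen (Fin.natAdd 3 k)) = envZ (n - 1) k := by
  have hn0 : 0 < n := by omega
  refine ⟨⟨zBig n, fun r => ⟨rootSmall n r, rootBig n r, foldingMap r hn0,
    isQuantumFolding hn0 r σ, ⟨_, _, _, _, _, _, _, isEnhancedUberalgebra r hn0⟩,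
    isEnhancedUberalgebra r hn0, fun U _ _ v h => enhancedUberalgebra_unique r hn0 h⟩⟩,
    exists_proj_small hn0, exists_presentation_equiv n, AAlg.isPBW_pbwGen hn0,
    AAlg.specializable _, AAlg.exists_specialization_equiv _⟩
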